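/- Let $n\ge 4$ and let $M$ be a smooth (Hausdorff, second countable) $n$-manifold. A \emph{Nambu structure of order $p$} on an open set $U\subseteq M$ is a smooth $p$-vector field $\Pi$ on $U$ whose bracket $\{f_1,\dots,f_p\}=\Pi(df_1,\dots,df_p)$ satisfies $$\{f_1,\dots,f_{p-1},\{g_1,\dots,g_p\}\}=\sum_{k=1}^p\{g_1,\dots,g_{k-1},\{f_1,\dots,f_{p-1},g_k\},g_{k+1},\dots,g_p\}$$ for all smooth functions $f_i,g_j$ on $U$. Let $\mathcal E^1(U)=(TU\times\mathbb R)\oplus(T^*U\times\mathbb R)$, with the symmetric form $$\langle (X_1,\mu_1)+(\alpha_1,\lambda_1),(X_2,\mu_2)+(\alpha_2,\lambda_2)\rangle_+=\tfrac12\big(\alpha_1(X_2)+\alpha_2(X_1)+\lambda_1\mu_2+\lambda_2\mu_1\big)$$ and, on smooth sections $e_i=(X_i,f_i)+(\alpha_i,g_i)$, the bracket $$[e_1,e_2]=\big([X_1,X_2],\,X_1 f_2-X_2 f_1\big)+(\alpha,g),$$ $$\alpha=\mathcal L_{X_1}\alpha_2-\mathcal L_{X_2}\alpha_1+\tfrac12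 d(i_{X_2}\alpha_1-i_{X_1}\alpha_2)+f_1\alpha_2-f_2\alpha_1+\tfrac12(g_2df_1-g_1df_2-f_1dg_2+f_2dg_1),$$ $$g=X_1 g_2-X_2 g_1+\tfrac12(i_{X_2}\alpha_1-i_{X_1}\alpha_2-f_2g_1+f_1g_2).$$ A \emph{Dirac structure} of $\mathcal E^1(U)$ is a smooth sub-bundle $L$ that is maximally isotropic for $\langle\cdot,\cdot\rangle_+$ and whose smooth sections over $U$ are closed under $[\cdot,\cdot]$. For a 2-form $\omega$ and a closed 1-form $\eta$ let $L_{(\omega,\eta)}$ have fibres $$L_{(\omega,\eta)}(x)=\{(X,-\eta(X))+(i_X\omega+t\,\eta,\ t)\;:\;X\in T_xM,\ t\in\mathbb R\}.$$ (1) Let $\Pi$ be a Nambu structure of order $n-2$ on $M$; if $n=4$, assume also that the bivector $\Pi(x)$ is decomposable for every $x\in M$. Then every point $x_0$ with $\Pi(x_0)\neq 0$ lies in the domain $V$ of a smooth chart $(x_1,\dots,x_n)$ such that $\Pi=\frac{\partial}{\partial x_1}\wedge\dots\wedge\frac{\partial}{\partial x_{n-2}}$ on $V$ and such that, for every nowhere-vanishing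 smooth $f:V\to\mathbb R$, putting $\omega_f=i_\Pi(f\,dx_1\wedge\dots\wedge dx_n)$, the family $L_{(\omega_f,\,d\ln|f|)}$ is a Dirac structure of $\mathcal E^1(V)$. (2) Conversely, let $f$ be a nowhere-vanishing smooth function on $M$ and let $\omega=\omega_1\wedge\omega_2$, where $\omega_1,\omega_2$ are smooth 1-forms on $M$ that are linearly independent at every point. Suppose that $L_{(\omega,\,d\ln|f|)}$ is a Dirac structure of $\mathcal E^1(M)$. Then $L_{(g\omega,\,d\ln|fg|)}$ is a Dirac structure of $\mathcal E^1(M)$ for every nowhere-vanishing smooth function $g$ on $M$; and for every open $V\subseteq M$ and every volume form $\Omega$ on $V$ there is one and only one field $\Pi$ of $(n-2)$-vectors on $V$ with $i_\Pi\Omega=\omega|_V$, and this $\Pi$ is a (smooth) Nambu structure of order $n-2$ on $V$. -/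

import Mathlib

open scoped Manifold ContDiff

namespace NambuDirac

noncomputable section

/-! ### Multilinear algebra on one tangent space -/

section LinearAlgebra

variable {V : Type*} [AddCommGroup V] [Module ℝ V] [TopologicalSpace V]

/-- The wedge product `α₁ ∧ ⋯ ∧ α_k` of covectors: `(v₁, …, v_k) ↦ det (α_i (v_j))`. -/
def wedge {k : ℕ} (α : Fin k → (V →L[ℝ] ℝ)) : V [⋀^Fin k]→L[ℝ] ℝ :=
  { (Matrix.detRowAlternating (R := ℝ) (n := Fin k)).compLinearMap
      (LinearMap.pi fun i => (α i : V →ₗ[ℝ] ℝ)) with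
    cont := by
      change Continuous fun v : Fin k → V => Matrix.det (Matrix.of fun i j => α j (v i))
      refine Continuous.matrix_det ?_
      refine continuous_matrix fun i j => ?_
      exact (α j).continuous.comp (continuous_apply i) }

/-- A `p`-vector `P`, seen as an alternating form on covectors, is the decomposable `p`-vector
`X₁ ∧ ⋯ ∧ X_p`, that is `P(α₁, …, α_p) = det (α_i (X_j))`. -/
def IsWedgeOf {p : ℕ} (P : (V →L[ℝ] ℝ) [⋀^Fin p]→ₗ[ℝ] ℝ) (X : Fin p → V) : Prop :=
  ∀ α : Fin p → (V →L[ℝ] ℝ), P α = Matrix.det (Matrix.of fun i j => α i (X j))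

/-- The form `Ω(u₁, …, u_p, ·, …, ·)`. -/
def fixFirst {p q : ℕ} (Ω : V [⋀^Fin (p + q)]→L[ℝ] ℝ) (u : Fin p → V) :
    V [⋀^Fin q]→L[ℝ] ℝ where
  toFun Y := Ω (Fin.append u Y)
  map_update_add' Y i x y := by
    have h : ∀ z : V, Fin.append u (Function.update Y i z)
        = Function.update (Fin.append u Y) (Fin.natAdd p i) z := by
      intro z
      funext j
      refine Fin.addCases (fun j => ?_) (fun j => ?_) j
      · rw [Fin.append_left, Function.update_of_ne, Fin.append_left]
        intro hj
        have := congrArg Fin.val hj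
        simp only [Fin.val_castAdd, Fin.val_natAdd] at this
        omega
      · rw [Fin.append_right]
        by_cases hj : j = i
        · subst hj
          simp
        · rw [Function.update_of_ne hj, Function.update_of_ne, Fin.append_right]
          exact fun h' => hj (Fin.natAdd_injective _ _ h')
    convert Ω.map_update_add (Fin.append u Y) (Fin.natAdd p i) x y using 3 <;> rw [← h]
  map_update_smul' Y i c x := by
    have h : ∀ z : V, Fin.append u (Function.update Y i z)
        = Function.update (Fin.append u Y) (Fin.natAdd p i) z := by
      intro z
      funext j
      refine Fin.addCases (fun j => ?_) (fun j => ?_) j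
      · rw [Fin.append_left, Function.update_of_ne, Fin.append_left]
        intro hj
        have := congrArg Fin.val hj
        simp only [Fin.val_castAdd, Fin.val_natAdd] at this
        omega
      · rw [Fin.append_right]
        by_cases hj : j = i
        · subst hj
          simp
        · rw [Function.update_of_ne hj, Function.update_of_ne, Fin.append_right]
          exact fun h' => hj (Fin.natAdd_injective _ _ h')
    convert Ω.map_update_smul (Fin.append u Y) (Fin.natAdd p i) c x using 3 <;> rw [← h]
  map_eq_zero_of_eq' Y i j hY hij := by
    refine Ω.map_eq_zero_of_eq (Fin.append u Y) (i := Fin.natAdd p i) (j := Fin.natAdd p j) ?_ ?_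
    · simpa using hY
    · exact fun h => hij (Fin.natAdd_injective _ _ h)
  cont := by
    change Continuous fun Y : Fin q → V => Ω (Fin.append u Y)
    refine Ω.cont.comp (continuous_pi fun j => ?_)
    refine Fin.addCases (fun j => ?_) (fun j => ?_) j
    · simpa using continuous_const
    · simpa using continuous_apply j

/-- The contraction `i_P Ω` of a `p`-vector `P` with a form `Ω`. With respect to a basis `b` of `V`,
whose choice does not matter, and its dual basis `b*` it is
`(1 / p!) ∑_I P(b*_{I 1}, …, b*_{I p}) Ω(b_{I 1}, …, b_{I p}, ·, …, ·)`, so that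
`i_{X₁ ∧ ⋯ ∧ X_p} Ω = Ω(X₁, …, X_p, ·, …, ·)`. -/
def contract [IsTopologicalAddGroup V] [ContinuousSMul ℝ V] [T2Space V] [FiniteDimensional ℝ V]
    {p q : ℕ} (P : (V →L[ℝ] ℝ) [⋀^Fin p]→ₗ[ℝ] ℝ) (Ω : V [⋀^Fin (p + q)]→L[ℝ] ℝ) :
    V [⋀^Fin q]→L[ℝ] ℝ :=
  ((p.factorial : ℝ)⁻¹) • ∑ I : Fin p → Fin (Module.finrank ℝ V),
    P (fun k => LinearMap.toContinuousLinearMap ((Module.finBasis ℝ V).coord (I k))) •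
      fixFirst Ω (fun k => Module.finBasis ℝ V (I k))

/-- The covector `i_v β = β(v, ·)`. -/
def interiorProd (β : V [⋀^Fin 2]→L[ℝ] ℝ) (v : V) : V →L[ℝ] ℝ :=
  β.toContinuousLinearMap ![v, 0] 1

lemma interiorProd_apply (β : V [⋀^Fin 2]→L[ℝ] ℝ) (v w : V) : interiorProd β v w = β ![v, w] := by
  change β (Function.update ![v, 0] 1 w) = β ![v, w]
  congr 1
  funext i
  fin_cases i <;> rfl

/-- The fibre `(V × ℝ) ⊕ (V* × ℝ)` of the bundle `E¹`; its elements are written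
`(X, f) + (α, g)`. -/
abbrev Fibre (V : Type*) [AddCommGroup V] [Module ℝ V] [TopologicalSpace V] : Type _ :=
  (V × ℝ) × ((V →L[ℝ] ℝ) × ℝ)

/-- The symmetric form `⟨(X₁, μ₁) + (α₁, l₁), (X₂, μ₂) + (α₂, l₂)⟩₊`. -/
def pairing (a b : Fibre V) : ℝ :=
  (1 / 2) * (a.2.1 b.1.1 + b.2.1 a.1.1 + a.2.2 * b.1.2 + b.2.2 * a.1.2)

/-- A subspace on which `⟨·, ·⟩₊` vanishes. -/
def IsIsotropic (S : Submodule ℝ (Fibre V)) : Prop :=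
  ∀ a ∈ S, ∀ b ∈ S, pairing a b = 0

/-- The subspace `{(X, -η(X)) + (i_X β + f η, f)}` of the fibre, for a 2-form `β` and a
covector `η`. -/
def graphFibre (β : V [⋀^Fin 2]→L[ℝ] ℝ) (η : V →L[ℝ] ℝ) : Submodule ℝ (Fibre V) where
  carrier := {a | ∃ (X : V) (f : ℝ), a = ((X, -η X), (interiorProd β X + f • η, f))}
  zero_mem' := by
    refine ⟨0, 0, ?_⟩
    have h : interiorProd β 0 = 0 := by
      ext w
      rw [interiorProd_apply]
      exact β.map_coord_zero 0 rfl
    rw [h, map_zero, neg_zero, zero_smul, add_zero]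
    rfl
  add_mem' := by
    rintro _ _ ⟨X, f, rfl⟩ ⟨Y, g, rfl⟩
    refine ⟨X + Y, f + g, ?_⟩
    have h : interiorProd β (X + Y) = interiorProd β X + interiorProd β Y := by
      ext w
      have hu : ∀ z : V, Function.update ![X, w] 0 z = ![z, w] := by
        intro z
        funext i
        fin_cases i <;> rfl
      have := β.map_update_add ![X, w] 0 X Y
      rw [hu, hu, hu] at this
      change interiorProd β (X + Y) w = interiorProd β X w + interiorProd β Y w
      simpa only [interiorProd_apply] using this
    ext w <;> simp [h] <;> ring
  smul_mem' := by
    rintro c _ ⟨X, f, rfl⟩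
    refine ⟨c • X, c * f, ?_⟩
    have h : interiorProd β (c • X) = c • interiorProd β X := by
      ext w
      have hu : ∀ z : V, Function.update ![X, w] 0 z = ![z, w] := by
        intro z
        funext i
        fin_cases i <;> rfl
      have := β.map_update_smul ![X, w] 0 c X
      rw [hu, hu] at this
      change interiorProd β (c • X) w = c • interiorProd β X w
      simpa only [interiorProd_apply] using this
    ext w <;> simp [h] <;> ring

end LinearAlgebra

/-! ### Fields on a manifold -/

section Manifold

variable {n : ℕ} {M : Type*} [TopologicalSpace M] [ChartedSpace (EuclideanSpace ℝ (Fin n)) M]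
  [IsManifold (𝓡 n) ∞ M]

instance instFiniteDimensionalTangent (x : M) : FiniteDimensional ℝ (TangentSpace (𝓡 n) x) :=
  inferInstanceAs (FiniteDimensional ℝ (EuclideanSpace ℝ (Fin n)))

instance instT2SpaceTangent (x : M) : T2Space (TangentSpace (𝓡 n) x) :=
  inferInstanceAs (T2Space (EuclideanSpace ℝ (Fin n)))

variable (n M) in
/-- Vector fields, not necessarily smooth. -/
abbrev VField : Type _ := (x : M) → TangentSpace (𝓡 n) x

variable (n M) in
/-- Fields of covectors, not necessarily smooth. -/
abbrev CovField : Type _ := (x : M) → (TangentSpace (𝓡 n) x →L[ℝ] ℝ)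

variable (n M) in
/-- Fields of alternating `k`-forms, not necessarily smooth. -/
abbrev FormField (k : ℕ) : Type _ := (x : M) → (TangentSpace (𝓡 n) x [⋀^Fin k]→L[ℝ] ℝ)

variable (n M) in
/-- Fields of `p`-vectors, seen as alternating forms on covectors, not necessarily smooth. -/
abbrev MultiField (p : ℕ) : Type _ :=
  (x : M) → ((TangentSpace (𝓡 n) x →L[ℝ] ℝ) [⋀^Fin p]→ₗ[ℝ] ℝ)

variable (n M) in
/-- Sections of `E¹`, not necessarily smooth. -/
abbrev Sec : Type _ := (x : M) → Fibre (TangentSpace (𝓡 n) x)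

variable (n) in
/-- `f` is a smooth function on `U`. -/
def SmoothFun (U : Set M) (f : M → ℝ) : Prop := ContMDiffOn (𝓡 n) 𝓘(ℝ, ℝ) ∞ f U

/-- `X` is a smooth vector field on `U`. -/
def SmoothVField (U : Set M) (X : VField n M) : Prop :=
  ContMDiffOn (𝓡 n) (𝓡 n).tangent ∞ (fun x => (⟨x, X x⟩ : TangentBundle (𝓡 n) M)) U

/-- `α` is a smooth 1-form on the open set `U`. -/
def SmoothCovField (U : Set M) (α : CovField n M) : Prop :=
  ∀ W : Set M, IsOpen W → W ⊆ U → ∀ X : VField n M, SmoothVField W X →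
    SmoothFun n W (fun x => α x (X x))

/-- `β` is a smooth `k`-form on the open set `U`. -/
def SmoothForm {k : ℕ} (U : Set M) (β : FormField n M k) : Prop :=
  ∀ W : Set M, IsOpen W → W ⊆ U → ∀ X : Fin k → VField n M, (∀ i, SmoothVField W (X i)) →
    SmoothFun n W (fun x => β x (fun i => X i x))

variable (n) in
/-- The differential `df` of a function. -/
def dF (f : M → ℝ) : CovField n M := fun x => mfderiv (𝓡 n) 𝓘(ℝ, ℝ) f x

/-- The bracket `{f₁, …, f_p}_Π = Π(df₁, …, df_p)`. -/
def nambuBracket {p : ℕ} (P : MultiField n M p) (f : Fin p → M → ℝ) : M → ℝ :=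
  fun x => P x (fun i => dF n (f i) x)

/-- `Π` is a smooth `p`-vector field on the open set `U`. -/
def SmoothMultiField {p : ℕ} (U : Set M) (P : MultiField n M p) : Prop :=
  ∀ W : Set M, IsOpen W → W ⊆ U → ∀ f : Fin p → M → ℝ, (∀ i, SmoothFun n W (f i)) →
    SmoothFun n W (nambuBracket P f)

/-- The list `a₁, …, a_{p-1}, b`. -/
def withLast {A : Type*} {p : ℕ} (a : Fin (p - 1) → A) (b : A) : Fin p → A :=
  fun i => if h : i.val < p - 1 then a ⟨i.val, h⟩ else b

/-- `Π` is a Nambu structure of order `p` on the open set `U`: a smooth `p`-vector field that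
satisfies the Fundamental Identity. -/
def IsNambuOn {p : ℕ} (U : Set M) (P : MultiField n M p) : Prop :=
  SmoothMultiField U P ∧
  ∀ (f : Fin (p - 1) → M → ℝ) (g : Fin p → M → ℝ),
    (∀ i, SmoothFun n U (f i)) → (∀ i, SmoothFun n U (g i)) → ∀ x ∈ U,
      nambuBracket P (withLast f (nambuBracket P g)) x
        = ∑ k : Fin p,
            nambuBracket P (Function.update g k (nambuBracket P (withLast f (g k)))) x

/-- The exterior derivative of a 1-form, computed at `x` in the chart around `x`. -/
def extDerivOne (α : CovField n M) : FormField n M 2 := fun x =>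
  let φ := chartAt (EuclideanSpace ℝ (Fin n)) x
  let a : EuclideanSpace ℝ (Fin n) → (EuclideanSpace ℝ (Fin n) →L[ℝ] ℝ) := fun y =>
    (α (φ.symm y)).comp (mfderiv (𝓡 n) (𝓡 n) φ.symm y)
  (extDeriv (fun y => ContinuousAlternatingMap.ofSubsingleton ℝ (EuclideanSpace ℝ (Fin n)) ℝ
    (0 : Fin 1) (a y)) (φ x)).compContinuousLinearMap (mfderiv (𝓡 n) (𝓡 n) φ x)

/-- The function `i_X α`. -/
def evalForm (α : CovField n M) (X : VField n M) : M → ℝ := fun x => α x (X x)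

/-- The function `X · f = i_X df`. -/
def act (X : VField n M) (f : M → ℝ) : M → ℝ := fun x => dF n f x (X x)

/-- The Lie derivative `L_X α = d (i_X α) + i_X (dα)` of a 1-form. -/
def lieForm (X : VField n M) (α : CovField n M) : CovField n M := fun x =>
  dF n (evalForm α X) x + interiorProd (extDerivOne α x) (X x)

/-- The bracket of sections `e₁ = (X₁, f₁) + (α₁, g₁)` and `e₂ = (X₂, f₂) + (α₂, g₂)` of `E¹`. -/
def bracket (e₁ e₂ : Sec n M) : Sec n M :=
  let X₁ : VField n M := fun x => (e₁ x).1.1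
  let f₁ : M → ℝ := fun x => (e₁ x).1.2
  let α₁ : CovField n M := fun x => (e₁ x).2.1
  let g₁ : M → ℝ := fun x => (e₁ x).2.2
  let X₂ : VField n M := fun x => (e₂ x).1.1
  let f₂ : M → ℝ := fun x => (e₂ x).1.2
  let α₂ : CovField n M := fun x => (e₂ x).2.1
  let g₂ : M → ℝ := fun x => (e₂ x).2.2
  fun x =>
    ((VectorField.mlieBracket (𝓡 n) X₁ X₂ x, act X₁ f₂ x - act X₂ f₁ x),
     (lieForm X₁ α₂ x - lieForm X₂ α₁ x
        + (1 / 2 : ℝ) • dF n (fun y => evalForm α₁ X₂ y - evalForm α₂ X₁ y) x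
        + f₁ x • α₂ x - f₂ x • α₁ x
        + (1 / 2 : ℝ) • (g₂ x • dF n f₁ x - g₁ x • dF n f₂ x
            - f₁ x • dF n g₂ x + f₂ x • dF n g₁ x),
      act X₁ g₂ x - act X₂ g₁ x
        + (1 / 2) * (evalForm α₁ X₂ x - evalForm α₂ X₁ x - f₂ x * g₁ x + f₁ x * g₂ x)))

/-- `e` is a smooth section of `E¹` over the open set `U`. -/
def SmoothSec (U : Set M) (e : Sec n M) : Prop :=
  SmoothVField U (fun x => (e x).1.1) ∧ SmoothFun n U (fun x => (e x).1.2) ∧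
  SmoothCovField U (fun x => (e x).2.1) ∧ SmoothFun n U (fun x => (e x).2.2)

variable (n M) in
/-- A choice of a subspace of each fibre of `E¹`. -/
abbrev FibreFamily : Type _ := (x : M) → Submodule ℝ (Fibre (TangentSpace (𝓡 n) x))

/-- `L` is a smooth sub-bundle of `E¹` over the open set `U`: it has smooth local frames. -/
def IsSubbundleOn (U : Set M) (L : FibreFamily n M) : Prop :=
  ∀ x ∈ U, ∃ W : Set M, IsOpen W ∧ x ∈ W ∧ W ⊆ U ∧ ∃ (k : ℕ) (s : Fin k → Sec n M),
    (∀ i, SmoothSec W (s i)) ∧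
    ∀ y ∈ W, LinearIndependent ℝ (fun i => s i y) ∧
      Submodule.span ℝ (Set.range fun i => s i y) = L y

/-- `L` is a Dirac structure of `E¹(U)`: a sub-bundle that is maximally isotropic for `⟨·, ·⟩₊`
and whose smooth sections over `U` are closed under the bracket. -/
def IsDiracOn (U : Set M) (L : FibreFamily n M) : Prop :=
  IsSubbundleOn U L ∧
  (∀ x ∈ U, Maximal IsIsotropic (L x)) ∧
  ∀ e₁ e₂ : Sec n M, SmoothSec U e₁ → SmoothSec U e₂ →
    (∀ x ∈ U, e₁ x ∈ L x) → (∀ x ∈ U, e₂ x ∈ L x) → ∀ x ∈ U, bracket e₁ e₂ x ∈ L x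

/-- The family of subspaces `L_(β, η)` attached to a 2-form `β` and a 1-form `η`. -/
def graphFamily (β : FormField n M 2) (η : CovField n M) : FibreFamily n M :=
  fun x => graphFibre (β x) (η x)

variable (n) in
/-- The 1-form `d ln |f|`. -/
def dLogAbs (f : M → ℝ) : CovField n M := dF n (fun x => Real.log |f x|)

/-- The coordinate volume form `dx₁ ∧ ⋯ ∧ dx_n` of a chart. -/
def coordVolume (φ : OpenPartialHomeomorph M (EuclideanSpace ℝ (Fin n))) : FormField n M n :=
  fun y => wedge (fun i : Fin n => dF n (fun z => φ z i) y)

/-- The coordinate vector field `∂ / ∂x_i` of a chart. -/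
def coordVector (φ : OpenPartialHomeomorph M (EuclideanSpace ℝ (Fin n))) (i : Fin n) :
    VField n M :=
  fun y => (mfderiv (𝓡 n) (𝓡 n) φ y).inverse (EuclideanSpace.single i (1 : ℝ))

end Manifold

end

end NambuDirac

set_option linter.unusedSectionVars false

/-! Write n = p + 2.

Local form of a Nambu structure. Testing the Fundamental Identity on a product of two functions that
vanish at a point leaves a quadratic identity in the value of Π there
(`IsNambuOn.quadratic_identity`). For p ≥ 3 a dimension count turns it into decomposability
(`annihilated_of_quadratic_identity`); for p = 2 decomposability is assumed. Hence near x₀ one has Π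
= h Y₁ ∧ ⋯ ∧ Y_p, with fields Y_i dual to the differentials of p coordinates y_j and h = {y₁, …,
y_p} (`IsNambuOn.exists_local_form`). The Fundamental Identity on the y_j and one further function
then reads h² [Y_i, Y_j] = 0 (`commute_of_fundamental`). Commuting fields are straightened by a
Frobenius theorem (`exists_frobenius_straightening`): the plane field is integrated along rays, and
smooth dependence on parameters comes from the inverse function theorem in a space of curves.
Replacing one coordinate by a primitive of 1/h along it absorbs h (`IsNambuOn.exists_normal_chart`).
In the resulting chart ω_f = f dx_{n-1} ∧ dx_n.

Dirac structures. If dg = g dρ, the map (X, μ) + (α, l) ↦ (X, μ - dρ(X)) + g (α + l dρ, l) preserves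
the bracket (`gaugeMap_bracket`), and where g ≠ 0 it carries L_(β, η) onto L_(gβ, η + dρ). With ρ =
ln |g| this gives the rescaling statement, and it reduces L_(f dz ∧ dw, d ln |f|) to L_(dz ∧ dw, 0),
which is involutive because dz ∧ dw is closed.

Converse. A field X in the kernel of ω gives the section (X, -η(X)) + 0 of L_(ω, η). The bracket of
two such sections has no covector part, so the kernel is involutive
(`IsInvolutiveOn.kernel_bracket`). Complete ω₁, ω₂ locally to a coframe by exact forms dy_i: the
first p fields Y_i of the dual frame lie in the kernel, and their brackets are killed by the whole
coframe, so they commute. The equation i_Π Ω = ω has a unique solution by linear algebra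
(`eq_of_contract_eq`), namely Y₁ ∧ ⋯ ∧ Y_p divided by the value of Ω on the frame. A function times
a product of commuting fields satisfies the Fundamental Identity because the cofactors are
divergence free (`detBracket_fundamental`). -/

namespace NambuDirac

open Filter Topology

noncomputable section

/-! ### Smooth functions and their differentials -/

section Calculus

variable {n : ℕ} {M : Type*} [TopologicalSpace M] [ChartedSpace (EuclideanSpace ℝ (Fin n)) M]
  {U W : Set M} {x : M} {f g : M → ℝ}

lemma SmoothFun.contMDiffAt (hf : SmoothFun n U f) (hU : IsOpen U) (hx : x ∈ U) :
    ContMDiffAt (𝓡 n) 𝓘(ℝ, ℝ) ∞ f x :=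
  ContMDiffOn.contMDiffAt hf (hU.mem_nhds hx)

lemma SmoothFun.mdifferentiableAt (hf : SmoothFun n U f) (hU : IsOpen U) (hx : x ∈ U) :
    MDifferentiableAt (𝓡 n) 𝓘(ℝ, ℝ) f x :=
  (hf.contMDiffAt hU hx).mdifferentiableAt (by simp)

lemma SmoothFun.mono (hf : SmoothFun n U f) (h : W ⊆ U) : SmoothFun n W f :=
  ContMDiffOn.mono hf h

lemma SmoothFun.congr (hf : SmoothFun n U f) (h : ∀ x ∈ U, g x = f x) : SmoothFun n U g :=
  ContMDiffOn.congr hf h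

lemma smoothFun_const (U : Set M) (c : ℝ) : SmoothFun n U (fun _ => c) := contMDiffOn_const

lemma SmoothFun.add (hf : SmoothFun n U f) (hg : SmoothFun n U g) :
    SmoothFun n U (fun x => f x + g x) := ContMDiffOn.add hf hg

lemma SmoothFun.sub (hf : SmoothFun n U f) (hg : SmoothFun n U g) :
    SmoothFun n U (fun x => f x - g x) := ContMDiffOn.sub hf hg

lemma SmoothFun.neg (hf : SmoothFun n U f) :
    SmoothFun n U (fun x => - f x) := ContMDiffOn.neg hf

lemma SmoothFun.mul (hf : SmoothFun n U f) (hg : SmoothFun n U g) :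
    SmoothFun n U (fun x => f x * g x) := ContMDiffOn.mul hf hg

lemma SmoothFun.sum {ι : Type*} {s : Finset ι} {F : ι → M → ℝ}
    (hF : ∀ i ∈ s, SmoothFun n U (F i)) : SmoothFun n U (fun x => ∑ i ∈ s, F i x) :=
  contMDiffOn_finsetSum hF

lemma SmoothFun.prod {ι : Type*} {s : Finset ι} {F : ι → M → ℝ}
    (hF : ∀ i ∈ s, SmoothFun n U (F i)) : SmoothFun n U (fun x => ∏ i ∈ s, F i x) :=
  contMDiffOn_finsetProd hF

lemma SmoothFun.inv (hf : SmoothFun n U f) (h : ∀ x ∈ U, f x ≠ 0) :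
    SmoothFun n U (fun x => (f x)⁻¹) := ContMDiffOn.inv₀ hf h

/-- `Real.log` is even, so the absolute value can be dropped and the sign of f never matters. -/
lemma SmoothFun.logAbs (hf : SmoothFun n U f) (h : ∀ x ∈ U, f x ≠ 0) :
    SmoothFun n U (fun x => Real.log |f x|) := by
  intro x hx
  simp only [Real.log_abs]
  exact (Real.contDiffAt_log.2 (h x hx)).contMDiffAt.comp_contMDiffWithinAt x (hf x hx)

lemma SmoothFun.det {k : ℕ} {A : Fin k → Fin k → M → ℝ}
    (hA : ∀ i j, SmoothFun n U (A i j)) :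
    SmoothFun n U (fun x => Matrix.det (Matrix.of fun i j => A i j x)) := by
  simp only [Matrix.det_apply', Matrix.of_apply]
  exact SmoothFun.sum fun σ _ => (smoothFun_const U _).mul (SmoothFun.prod fun i _ => hA _ _)

lemma smoothFun_of_local (h : ∀ x ∈ U, ∃ W, IsOpen W ∧ x ∈ W ∧ SmoothFun n (U ∩ W) f) :
    SmoothFun n U f :=
  contMDiffOn_of_locally_contMDiffOn h

/-! #### Differentials -/

lemma dF_congr (h : f =ᶠ[𝓝 x] g) : dF n f x = dF n g x := h.mfderiv_eq

lemma dF_const (c : ℝ) : dF n (fun _ : M => c) x = 0 := mfderiv_const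

lemma dF_add (hf : MDifferentiableAt (𝓡 n) 𝓘(ℝ, ℝ) f x)
    (hg : MDifferentiableAt (𝓡 n) 𝓘(ℝ, ℝ) g x) :
    dF n (fun y => f y + g y) x = dF n f x + dF n g x := mfderiv_add hf hg

lemma dF_neg : dF n (fun y => - f y) x = - dF n f x := mfderiv_neg (f := f)

lemma dF_sub (hf : MDifferentiableAt (𝓡 n) 𝓘(ℝ, ℝ) f x)
    (hg : MDifferentiableAt (𝓡 n) 𝓘(ℝ, ℝ) g x) :
    dF n (fun y => f y - g y) x = dF n f x - dF n g x := mfderiv_sub hf hg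

lemma dF_mul (hf : MDifferentiableAt (𝓡 n) 𝓘(ℝ, ℝ) f x)
    (hg : MDifferentiableAt (𝓡 n) 𝓘(ℝ, ℝ) g x) :
    dF n (fun y => f y * g y) x = f x • dF n g x + g x • dF n f x :=
  (hf.hasMFDerivAt.mul hg.hasMFDerivAt).mfderiv

lemma dF_comp {F : ℝ → ℝ} {F' : ℝ} (hf : MDifferentiableAt (𝓡 n) 𝓘(ℝ, ℝ) f x)
    (hF : HasDerivAt F F' (f x)) : dF n (fun y => F (f y)) x = F' • dF n f x := by
  have h := (hF.hasFDerivAt.hasMFDerivAt).comp x hf.hasMFDerivAt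
  have h2 := h.mfderiv
  ext v
  change mfderiv (𝓡 n) 𝓘(ℝ, ℝ) (F ∘ f) x v = _
  rw [h2]
  change (ContinuousLinearMap.toSpanSingleton ℝ F') (dF n f x v) = F' * dF n f x v
  simp [mul_comm]

lemma dF_logAbs (hf : MDifferentiableAt (𝓡 n) 𝓘(ℝ, ℝ) f x) (h : f x ≠ 0) :
    dF n (fun y => Real.log |f y|) x = (f x)⁻¹ • dF n f x := by
  simp only [Real.log_abs]
  exact dF_comp hf (Real.hasDerivAt_log h)

end Calculus

/-! ### Vector fields, 1-forms and Lie brackets in charts -/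

section Charts

variable {n : ℕ} {M : Type*} [TopologicalSpace M] [ChartedSpace (EuclideanSpace ℝ (Fin n)) M]
  [IsManifold (𝓡 n) ∞ M] {U W : Set M} {x : M} {f g : M → ℝ}
  {φ : OpenPartialHomeomorph M (EuclideanSpace ℝ (Fin n))}

lemma chartAt_mem (x : M) :
    chartAt (EuclideanSpace ℝ (Fin n)) x ∈ IsManifold.maximalAtlas (𝓡 n) ∞ M :=
  IsManifold.chart_mem_maximalAtlas x

lemma mdifferentiable_of_mem (hφ : φ ∈ IsManifold.maximalAtlas (𝓡 n) ∞ M)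
    : φ.MDifferentiable (𝓡 n) (𝓡 n) :=
  ⟨(contMDiffOn_of_mem_maximalAtlas hφ).mdifferentiableOn (by simp),
    (contMDiffOn_symm_of_mem_maximalAtlas hφ).mdifferentiableOn (by simp)⟩

lemma mfderiv_invertible (hφ : φ ∈ IsManifold.maximalAtlas (𝓡 n) ∞ M)
    (hx : x ∈ φ.source) : (mfderiv (𝓡 n) (𝓡 n) φ x).IsInvertible :=
  ⟨(mdifferentiable_of_mem hφ).mfderiv hx, rfl⟩

lemma smoothFun_coord (hφ : φ ∈ IsManifold.maximalAtlas (𝓡 n) ∞ M)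
    (i : Fin n) : SmoothFun n φ.source (fun y => φ y i) := by
  have h1 := contMDiffOn_of_mem_maximalAtlas hφ
  have h2 : ContMDiff (𝓡 n) 𝓘(ℝ, ℝ) ∞ (fun v : EuclideanSpace ℝ (Fin n) => v i) :=
    (EuclideanSpace.proj (𝕜 := ℝ) i).contDiff.contMDiff
  exact h2.comp_contMDiffOn h1

lemma dF_coord_apply (hφ : φ ∈ IsManifold.maximalAtlas (𝓡 n) ∞ M)
    (hx : x ∈ φ.source) (i : Fin n) (v : TangentSpace (𝓡 n) x) :
    dF n (fun y => φ y i) x v =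
      (EuclideanSpace.proj (𝕜 := ℝ) i : EuclideanSpace ℝ (Fin n) →L[ℝ] ℝ)
        (mfderiv (𝓡 n) (𝓡 n) φ x v) := by
  have h := ((EuclideanSpace.proj (𝕜 := ℝ) i).hasFDerivAt (x := φ x)).hasMFDerivAt.comp x
    ((mdifferentiable_of_mem hφ).mdifferentiableAt hx).hasMFDerivAt
  have h2 := h.mfderiv
  change mfderiv (𝓡 n) 𝓘(ℝ, ℝ) ((EuclideanSpace.proj (𝕜 := ℝ) i) ∘ φ) x v = _
  rw [h2]
  rfl

lemma mfderiv_coordVector (hφ : φ ∈ IsManifold.maximalAtlas (𝓡 n) ∞ M)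
    (hx : x ∈ φ.source) (j : Fin n) :
    mfderiv (𝓡 n) (𝓡 n) φ x (coordVector φ j x) =
      (EuclideanSpace.single j (1 : ℝ) : EuclideanSpace ℝ (Fin n)) := by
  -- `inverse` is zero on maps that are not invertible, so the cancellation has to go through an
  -- actual equivalence.
  have key : ∀ A : TangentSpace (𝓡 n) x →L[ℝ] EuclideanSpace ℝ (Fin n), A.IsInvertible →
      ∀ w, A (A.inverse w) = w := by
    rintro _ ⟨e, rfl⟩ w
    rw [ContinuousLinearMap.inverse_equiv]
    exact e.apply_symm_apply w
  exact key _ (mfderiv_invertible hφ hx) _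

lemma dF_coord_coordVector (hφ : φ ∈ IsManifold.maximalAtlas (𝓡 n) ∞ M)
    (hx : x ∈ φ.source) (i j : Fin n) :
    dF n (fun y => φ y i) x (coordVector φ j x) = if i = j then 1 else 0 := by
  rw [dF_coord_apply hφ hx, mfderiv_coordVector hφ hx]
  simp

lemma eq_of_dF_coord (hφ : φ ∈ IsManifold.maximalAtlas (𝓡 n) ∞ M)
    (hx : x ∈ φ.source) {v w : TangentSpace (𝓡 n) x}
    (h : ∀ i, dF n (fun y => φ y i) x v = dF n (fun y => φ y i) x w) : v = w := by
  apply (mdifferentiable_of_mem hφ).mfderiv_injective hx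
  refine PiLp.ext (α := fun _ : Fin n => ℝ) fun i => ?_
  have := h i
  rwa [dF_coord_apply hφ hx, dF_coord_apply hφ hx] at this

lemma sum_coordVector (hφ : φ ∈ IsManifold.maximalAtlas (𝓡 n) ∞ M)
    (hx : x ∈ φ.source) (v : TangentSpace (𝓡 n) x) :
    ∑ i, dF n (fun y => φ y i) x v • coordVector φ i x = v := by
  apply eq_of_dF_coord hφ hx
  intro j
  rw [map_sum]
  simp only [map_smul, dF_coord_coordVector hφ hx, smul_eq_mul, mul_ite, mul_one, mul_zero]
  rw [Finset.sum_ite_eq Finset.univ j]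
  simp

lemma coordVector_linearIndependent (hφ : φ ∈ IsManifold.maximalAtlas (𝓡 n) ∞ M)
    (hx : x ∈ φ.source) :
    LinearIndependent ℝ (fun i => coordVector φ i x) := by
  rw [Fintype.linearIndependent_iff]
  intro c hc j
  have := congrArg (dF n (fun y => φ y j) x) hc
  rw [map_sum, map_zero] at this
  simpa [dF_coord_coordVector hφ hx] using this

/-- A coordinate field is the pullback by the chart of a constant field, and the derivative of the
chart is invertible. -/
lemma smoothVField_coordVector (hφ : φ ∈ IsManifold.maximalAtlas (𝓡 n) ∞ M) (i : Fin n) :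
    SmoothVField φ.source (coordVector φ i) := by
  have hn : ((∞ : WithTop ℕ∞)) + 1 ≤ ∞ := by simp
  intro x hx
  have hV : ContMDiffAt (𝓡 n) (𝓡 n).tangent ∞ (fun y : EuclideanSpace ℝ (Fin n) =>
      (⟨y, (EuclideanSpace.single i (1 : ℝ) : EuclideanSpace ℝ (Fin n))⟩ :
        TangentBundle (𝓡 n) (EuclideanSpace ℝ (Fin n)))) (φ x) :=
    contMDiffAt_vectorSpace_iff_contDiffAt.2 contDiffAt_const
  exact (ContMDiffAt.mpullback_vectorField_preimage hV
    ((contMDiffOn_of_mem_maximalAtlas hφ).contMDiffAt (φ.open_source.mem_nhds hx))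
    (mfderiv_invertible hφ hx) hn).contMDiffWithinAt

lemma SmoothVField.mono {X : VField n M} (hX : SmoothVField U X) (h : W ⊆ U) : SmoothVField W X :=
  ContMDiffOn.mono hX h

lemma SmoothVField.congr {X Y : VField n M} (hX : SmoothVField U X) (h : ∀ x ∈ U, Y x = X x) :
    SmoothVField U Y :=
  ContMDiffOn.congr hX fun x hx => by rw [h x hx]

lemma SmoothVField.smul {X : VField n M} (hf : SmoothFun n U f) (hX : SmoothVField U X) :
    SmoothVField U (fun x => f x • X x) :=
  ContMDiffOn.smul_section hf hX

lemma SmoothVField.sum {ι : Type*} {s : Finset ι} {X : ι → VField n M}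
    (hX : ∀ i ∈ s, SmoothVField U (X i)) : SmoothVField U (fun x => ∑ i ∈ s, X i x) :=
  ContMDiffOn.sum_section hX

lemma smoothVField_of_coord (hφ : φ ∈ IsManifold.maximalAtlas (𝓡 n) ∞ M) (hW : W ⊆ φ.source)
    {X : VField n M} (h : ∀ i, SmoothFun n W (fun y => dF n (fun z => φ z i) y (X y))) :
    SmoothVField W X := by
  refine (SmoothVField.sum (s := Finset.univ) (X := fun i y =>
    dF n (fun z => φ z i) y (X y) • coordVector φ i y) fun i _ =>
    (SmoothVField.smul (h i) ((smoothVField_coordVector hφ i).mono hW))).congr fun y hy => ?_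
  exact (sum_coordVector hφ (hW hy) (X y)).symm

/-- The tangent map of f is smooth; composing it with X and keeping the fibre component gives X · f.
-/
lemma SmoothVField.act {X : VField n M} (hU : IsOpen U) (hX : SmoothVField U X)
    (hf : SmoothFun n U f) : SmoothFun n U (act X f) := by
  have h1 := ContMDiffOn.contMDiffOn_tangentMapWithin (m := ∞) hf (by simp) hU.uniqueMDiffOn
  have h2 := (contMDiff_snd_tangentBundle_modelSpace (n := ∞) ℝ 𝓘(ℝ, ℝ)).comp_contMDiffOn
    (h1.comp hX (fun x hx => hx))
  refine h2.congr fun x hx => ?_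
  change dF n f x (X x) = mfderivWithin (𝓡 n) 𝓘(ℝ, ℝ) f U x (X x)
  rw [mfderivWithin_of_isOpen hU hx]
  rfl

/-- The components of a vector field in a chart, as a map of the model space. -/
def chartRep (φ : OpenPartialHomeomorph M (EuclideanSpace ℝ (Fin n))) (X : VField n M) :
    EuclideanSpace ℝ (Fin n) → EuclideanSpace ℝ (Fin n) :=
  fun y => WithLp.toLp 2 fun i => dF n (fun z => φ z i) (φ.symm y) (X (φ.symm y))

lemma SmoothFun.comp_symm (hφ : φ ∈ IsManifold.maximalAtlas (𝓡 n) ∞ M)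
    (hU : IsOpen U) (hf : SmoothFun n U f) (hx : x ∈ φ.source) (hxU : x ∈ U) :
    ContDiffAt ℝ ∞ (f ∘ φ.symm) (φ x) := by
  have h1 := (contMDiffOn_symm_of_mem_maximalAtlas hφ).contMDiffAt
    (φ.open_target.mem_nhds (φ.map_source hx))
  have h2 : ContMDiffAt (𝓡 n) 𝓘(ℝ, ℝ) ∞ f (φ.symm (φ x)) := by
    rw [φ.left_inv hx]; exact hf.contMDiffAt hU hxU
  exact (h2.comp _ h1).contDiffAt

lemma dF_eq_fderiv (hφ : φ ∈ IsManifold.maximalAtlas (𝓡 n) ∞ M) (hx : x ∈ φ.source)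
    (hf : MDifferentiableAt (𝓡 n) 𝓘(ℝ, ℝ) f x) (v : TangentSpace (𝓡 n) x) :
    dF n f x v = fderiv ℝ (f ∘ φ.symm) (φ x) (mfderiv (𝓡 n) (𝓡 n) φ x v) := by
  have h1 := (mdifferentiable_of_mem hφ).mdifferentiableAt hx
  have h2 := (mdifferentiable_of_mem hφ).mdifferentiableAt_symm (φ.map_source hx)
  have h3 : MDifferentiableAt (𝓡 n) 𝓘(ℝ, ℝ) f (φ.symm (φ x)) := by rwa [φ.left_inv hx]
  have h4 := h3.comp _ h2
  have h5 := (h4.hasMFDerivAt.comp x h1.hasMFDerivAt).mfderiv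
  have h6 : dF n f x = dF n ((f ∘ φ.symm) ∘ φ) x := by
    apply dF_congr
    filter_upwards [φ.open_source.mem_nhds hx] with y hy
    simp [φ.left_inv hy]
  rw [h6]
  change mfderiv (𝓡 n) 𝓘(ℝ, ℝ) ((f ∘ φ.symm) ∘ φ) x v = _
  rw [h5, mfderiv_eq_fderiv]
  rfl

lemma chartRep_apply (hφ : φ ∈ IsManifold.maximalAtlas (𝓡 n) ∞ M) (hx : x ∈ φ.source)
    (X : VField n M) : chartRep φ X (φ x) = mfderiv (𝓡 n) (𝓡 n) φ x (X x) := by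
  refine PiLp.ext (α := fun _ : Fin n => ℝ) fun i => ?_
  change dF n (fun z => φ z i) (φ.symm (φ x)) (X (φ.symm (φ x))) = _
  rw [φ.left_inv hx]
  exact dF_coord_apply hφ hx i _

lemma act_eq_fderiv (hφ : φ ∈ IsManifold.maximalAtlas (𝓡 n) ∞ M) (hx : x ∈ φ.source)
    (hf : MDifferentiableAt (𝓡 n) 𝓘(ℝ, ℝ) f x) (X : VField n M) :
    act X f x = fderiv ℝ (f ∘ φ.symm) (φ x) (chartRep φ X (φ x)) := by
  rw [chartRep_apply hφ hx]
  exact dF_eq_fderiv hφ hx hf (X x)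

lemma contDiffAt_chartRep (hφ : φ ∈ IsManifold.maximalAtlas (𝓡 n) ∞ M)
    {X : VField n M} (hU : IsOpen U) (hX : SmoothVField U X) (hx : x ∈ φ.source) (hxU : x ∈ U) :
    ContDiffAt ℝ ∞ (chartRep φ X) (φ x) := by
  refine (contDiffAt_piLp (p := 2)).2 fun i => ?_
  exact SmoothFun.comp_symm (n := n) (f := NambuDirac.act X (fun z => φ z i)) (U := U ∩ φ.source) hφ
    (hU.inter φ.open_source) (SmoothVField.act (hU.inter φ.open_source) (hX.mono Set.inter_subset_left)
      ((smoothFun_coord hφ i).mono Set.inter_subset_right)) hx ⟨hxU, hx⟩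

/-- Near x every field is the pullback of its chart representative, pullback commutes with brackets,
and on the model space the manifold bracket is the usual one. -/
lemma mfderiv_mlieBracket (hφ : φ ∈ IsManifold.maximalAtlas (𝓡 n) ∞ M)
    {X Y : VField n M} (hU : IsOpen U) (hX : SmoothVField U X) (hY : SmoothVField U Y)
    (hx : x ∈ φ.source) (hxU : x ∈ U) :
    mfderiv (𝓡 n) (𝓡 n) φ x (VectorField.mlieBracket (𝓡 n) X Y x) =
      VectorField.lieBracket ℝ (chartRep φ X) (chartRep φ Y) (φ x) := by
  have key : ∀ A : TangentSpace (𝓡 n) x →L[ℝ] EuclideanSpace ℝ (Fin n), A.IsInvertible →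
      ∀ w, A (A.inverse w) = w := by
    rintro _ ⟨e, rfl⟩ w
    rw [ContinuousLinearMap.inverse_equiv]
    exact e.apply_symm_apply w
  have key' : ∀ y : M, ∀ A : TangentSpace (𝓡 n) y →L[ℝ] EuclideanSpace ℝ (Fin n), A.IsInvertible →
      ∀ w, A.inverse (A w) = w := by
    rintro y _ ⟨e, rfl⟩ w
    rw [ContinuousLinearMap.inverse_equiv]
    exact e.symm_apply_apply w
  have hpull : ∀ Z : VField n M, Z =ᶠ[𝓝 x] VectorField.mpullback (𝓡 n) (𝓡 n) φ (chartRep φ Z) := by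
    intro Z
    filter_upwards [φ.open_source.mem_nhds hx] with y hy
    change Z y = (mfderiv (𝓡 n) (𝓡 n) φ y).inverse (chartRep φ Z (φ y))
    rw [chartRep_apply hφ hy]
    exact (key' y _ (mfderiv_invertible hφ hy) _).symm
  have hm : ∀ Z : VField n M, SmoothVField U Z → MDifferentiableAt (𝓡 n) (𝓡 n).tangent
      (fun y => (⟨y, chartRep φ Z y⟩ : TangentBundle (𝓡 n) (EuclideanSpace ℝ (Fin n)))) (φ x) :=
    fun Z hZ => (contMDiffAt_vectorSpace_iff_contDiffAt.2
      (contDiffAt_chartRep hφ hU hZ hx hxU)).mdifferentiableAt (by simp)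
  have : IsManifold (𝓡 n) (minSmoothness ℝ 2) M := by
    rw [minSmoothness_of_isRCLikeNormedField]
    exact IsManifold.of_le (n := ∞) (WithTop.coe_le_coe.2 (le_top (a := (2 : ℕ∞))))
  have : IsManifold (𝓡 n) (minSmoothness ℝ 2) (EuclideanSpace ℝ (Fin n)) := by
    rw [minSmoothness_of_isRCLikeNormedField]
    infer_instance
  rw [(hpull X).mlieBracket_vectorField_eq (hpull Y),
    ← VectorField.mpullback_mlieBracket (n := ∞) (hm X hX) (hm Y hY)
      ((contMDiffOn_of_mem_maximalAtlas hφ).contMDiffAt (φ.open_source.mem_nhds hx))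
      (by rw [minSmoothness_of_isRCLikeNormedField]
          exact WithTop.coe_le_coe.2 (le_top (a := (2 : ℕ∞))))]
  refine (key _ (mfderiv_invertible hφ hx) _).trans ?_
  have hflat : ∀ V W : (y : EuclideanSpace ℝ (Fin n)) → TangentSpace (𝓡 n) y,
      VectorField.mlieBracket (𝓡 n) V W = VectorField.lieBracket ℝ V W := by
    intro V W
    rw [← VectorField.mlieBracketWithin_univ, VectorField.mlieBracketWithin_eq_lieBracketWithin]
    exact VectorField.lieBracketWithin_univ (𝕜 := ℝ) (V := V) (W := W)
  exact congrFun (hflat _ _) _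

/-- An equality of germs is needed, because `act_mlieBracket` differentiates this expression once
more. -/
lemma eventually_act_eq (hφ : φ ∈ IsManifold.maximalAtlas (𝓡 n) ∞ M) (hU : IsOpen U)
    (hf : SmoothFun n U f) (hx : x ∈ φ.source) (hxU : x ∈ U) (X : VField n M) :
    (act X f) ∘ φ.symm =ᶠ[𝓝 (φ x)] fun y => fderiv ℝ (f ∘ φ.symm) y (chartRep φ X y) := by
  have h1 : φ.target ∩ φ.symm ⁻¹' U ∈ 𝓝 (φ x) :=
    (φ.isOpen_inter_preimage_symm hU).mem_nhds ⟨φ.map_source hx, by simpa [φ.left_inv hx]⟩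
  filter_upwards [h1] with y hy
  have := act_eq_fderiv hφ (φ.map_target hy.1) (hf.mdifferentiableAt hU hy.2) X
  rwa [φ.right_inv hy.1] at this

/-- In a chart this is the symmetry of the second derivative of f. In the later computations it is
also the form in which dρ, dz and dw are closed. -/
lemma act_mlieBracket {X Y : VField n M} (hU : IsOpen U) (hX : SmoothVField U X)
    (hY : SmoothVField U Y) (hf : SmoothFun n U f) (hx : x ∈ U) :
    dF n f x (VectorField.mlieBracket (𝓡 n) X Y x) = act X (act Y f) x - act Y (act X f) x := by
  have hφ := chartAt_mem (n := n) x
  have hxs := mem_chart_source (EuclideanSpace ℝ (Fin n)) x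
  rw [dF_eq_fderiv hφ hxs (hf.mdifferentiableAt hU hx), mfderiv_mlieBracket hφ hU hX hY hxs hx,
    act_eq_fderiv hφ hxs ((hY.act hU hf).mdifferentiableAt hU hx),
    act_eq_fderiv hφ hxs ((hX.act hU hf).mdifferentiableAt hU hx),
    (eventually_act_eq hφ hU hf hxs hx X).fderiv_eq,
    (eventually_act_eq hφ hU hf hxs hx Y).fderiv_eq]
  exact VectorField.fderiv_apply_lieBracket (SmoothFun.comp_symm hφ hU hf hxs hx)
    (by rw [minSmoothness_of_isRCLikeNormedField]; exact WithTop.coe_le_coe.2 (le_top (a := (2 : ℕ∞)))) ((contDiffAt_chartRep hφ hU hY hxs hx).differentiableAt (by simp))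
    ((contDiffAt_chartRep hφ hU hX hxs hx).differentiableAt (by simp))


lemma mfderiv_symm_single (hφ : φ ∈ IsManifold.maximalAtlas (𝓡 n) ∞ M)
    {y : EuclideanSpace ℝ (Fin n)} (hy : y ∈ φ.target) (v : EuclideanSpace ℝ (Fin n)) :
    mfderiv (𝓡 n) (𝓡 n) φ (φ.symm y) (mfderiv (𝓡 n) (𝓡 n) φ.symm y v) = v := by
  have h := (mdifferentiable_of_mem hφ).comp_symm_deriv hy
  exact congrArg (fun A => A v) h

/-- A field of covectors in a chart, as a map of the model space. -/
def chartCov (φ : OpenPartialHomeomorph M (EuclideanSpace ℝ (Fin n))) (α : CovField n M) :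
    EuclideanSpace ℝ (Fin n) → (EuclideanSpace ℝ (Fin n) →L[ℝ] ℝ) :=
  fun y => (α (φ.symm y)).comp (mfderiv (𝓡 n) (𝓡 n) φ.symm y)

lemma chartCov_apply_chartRep (hφ : φ ∈ IsManifold.maximalAtlas (𝓡 n) ∞ M)
    {y : EuclideanSpace ℝ (Fin n)} (hy : y ∈ φ.target) (α : CovField n M) (X : VField n M) :
    chartCov φ α y (chartRep φ X y) = evalForm α X (φ.symm y) := by
  have h := chartRep_apply hφ (φ.map_target hy) X
  rw [φ.right_inv hy] at h
  rw [h]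
  have h2 := (mdifferentiable_of_mem hφ).mfderiv_injective (φ.map_target hy)
    (mfderiv_symm_single hφ hy (mfderiv (𝓡 n) (𝓡 n) φ (φ.symm y) (X (φ.symm y))))
  exact congrArg (α (φ.symm y)) h2

lemma chartRep_coordVector (hφ : φ ∈ IsManifold.maximalAtlas (𝓡 n) ∞ M)
    {y : EuclideanSpace ℝ (Fin n)} (hy : y ∈ φ.target) (i : Fin n) :
    chartRep φ (coordVector φ i) y = EuclideanSpace.single i (1 : ℝ) := by
  have h := chartRep_apply hφ (φ.map_target hy) (coordVector φ i)
  rw [φ.right_inv hy] at h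
  rw [h]
  exact mfderiv_coordVector hφ (φ.map_target hy) i

lemma SmoothCovField.evalForm {α : CovField n M} {X : VField n M} (hU : IsOpen U)
    (hα : SmoothCovField U α) (hX : SmoothVField U X) : SmoothFun n U (evalForm α X) :=
  hα U hU subset_rfl X hX

lemma SmoothCovField.mono {α : CovField n M} (hα : SmoothCovField U α) (h : W ⊆ U) :
    SmoothCovField W α :=
  fun V hV hVW X hX => hα V hV (hVW.trans h) X hX

lemma SmoothCovField.add {α β : CovField n M} (hα : SmoothCovField U α) (hβ : SmoothCovField U β) :
    SmoothCovField U (fun x => α x + β x) :=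
  fun V hV hVW X hX => (hα V hV hVW X hX).add (hβ V hV hVW X hX)

lemma SmoothCovField.smul {α : CovField n M} (hf : SmoothFun n U f) (hα : SmoothCovField U α) :
    SmoothCovField U (fun x => f x • α x) :=
  fun V hV hVW X hX => (hf.mono hVW).mul (hα V hV hVW X hX)

lemma smoothCovField_dF (hf : SmoothFun n U f) : SmoothCovField U (dF n f) :=
  fun _ hV hVW _ hX => SmoothVField.act hV hX (hf.mono hVW)

/-- Smoothness of a 1-form is defined by testing on smooth fields; testing on coordinate fields
recovers the components of the chart representative. -/
lemma contDiffAt_chartCov (hφ : φ ∈ IsManifold.maximalAtlas (𝓡 n) ∞ M) {α : CovField n M}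
    (hU : IsOpen U) (hα : SmoothCovField U α) (hx : x ∈ φ.source) (hxU : x ∈ U) :
    ContDiffAt ℝ ∞ (chartCov φ α) (φ x) := by
  have h : ∀ i, ContDiffAt ℝ ∞ (fun y => chartCov φ α y (EuclideanSpace.single i (1 : ℝ)))
      (φ x) := by
    intro i
    have h1 : SmoothFun n (U ∩ φ.source) (NambuDirac.evalForm α (coordVector φ i)) :=
      (hα.mono Set.inter_subset_left).evalForm (hU.inter φ.open_source)
        ((smoothVField_coordVector hφ i).mono Set.inter_subset_right)
    refine (SmoothFun.comp_symm hφ (hU.inter φ.open_source) h1 hx ⟨hxU, hx⟩).congr_of_eventuallyEq ?_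
    filter_upwards [φ.open_target.mem_nhds (φ.map_source hx)] with y hy
    rw [← chartRep_coordVector hφ hy i, chartCov_apply_chartRep hφ hy]
    rfl
  have h2 : chartCov φ α = fun y => ∑ i, (chartCov φ α y (EuclideanSpace.single i (1 : ℝ))) •
      (EuclideanSpace.proj (𝕜 := ℝ) i : EuclideanSpace ℝ (Fin n) →L[ℝ] ℝ) := by
    funext y
    ext v
    have hv : v = ∑ i, v i • EuclideanSpace.single i (1 : ℝ) := by
      ext j; simp [Pi.single_apply]
    conv_lhs => rw [hv, map_sum]
    simp [mul_comm]
  rw [h2]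
  exact ContDiffAt.sum fun i _ => (h i).smul contDiffAt_const

/-- Cartan's formula. In the chart, the product rule splits Z · α(W) into a derivative of α and a
derivative of W. Antisymmetrising, the first parts give dα and the second parts α of the Lie
bracket. -/
lemma extDerivOne_apply {α : CovField n M} {X Y : VField n M} (hU : IsOpen U)
    (hα : SmoothCovField U α) (hX : SmoothVField U X) (hY : SmoothVField U Y) (hx : x ∈ U) :
    extDerivOne α x ![X x, Y x] = act X (evalForm α Y) x - act Y (evalForm α X) x
      - α x (VectorField.mlieBracket (𝓡 n) X Y x) := by
  have hφ := chartAt_mem (n := n) x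
  have hxs := mem_chart_source (EuclideanSpace ℝ (Fin n)) x
  set φ := chartAt (EuclideanSpace ℝ (Fin n)) x with hφdef
  have ha : DifferentiableAt ℝ (chartCov φ α) (φ x) :=
    (contDiffAt_chartCov hφ hU hα hxs hx).differentiableAt (by simp)
  have hXd := (contDiffAt_chartRep hφ hU hX hxs hx).differentiableAt (by simp)
  have hYd := (contDiffAt_chartRep hφ hU hY hxs hx).differentiableAt (by simp)
  have hlin : ∀ Z W : VField n M, SmoothVField U Z → SmoothVField U W → act Z (evalForm α W) x =
      fderiv ℝ (chartCov φ α) (φ x) (chartRep φ Z (φ x)) (chartRep φ W (φ x)) +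
      chartCov φ α (φ x) (fderiv ℝ (chartRep φ W) (φ x) (chartRep φ Z (φ x))) := by
    intro Z W hZ hW
    have hWd := (contDiffAt_chartRep hφ hU hW hxs hx).differentiableAt (by simp)
    have h1 : (evalForm α W) ∘ φ.symm =ᶠ[𝓝 (φ x)] fun y => chartCov φ α y (chartRep φ W y) := by
      filter_upwards [φ.open_target.mem_nhds (φ.map_source hxs)] with y hy
      exact (chartCov_apply_chartRep hφ hy α W).symm
    rw [act_eq_fderiv hφ hxs ((hα.evalForm hU hW).mdifferentiableAt hU hx), h1.fderiv_eq,
      fderiv_clm_apply ha hWd]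
    simp [add_comm]
  have hbr : α x (VectorField.mlieBracket (𝓡 n) X Y x) = chartCov φ α (φ x)
      (VectorField.lieBracket ℝ (chartRep φ X) (chartRep φ Y) (φ x)) := by
    have h1 := chartCov_apply_chartRep hφ (φ.map_source hxs) α
      (VectorField.mlieBracket (𝓡 n) X Y)
    rw [chartRep_apply hφ hxs, mfderiv_mlieBracket hφ hU hX hY hxs hx, φ.left_inv hxs] at h1
    exact h1.symm
  have hsub : DifferentiableAt ℝ (fun y => ContinuousAlternatingMap.ofSubsingleton ℝ
      (EuclideanSpace ℝ (Fin n)) ℝ (0 : Fin 1) (chartCov φ α y)) (φ x) := by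
    exact ((ContinuousAlternatingMap.ofSubsingletonLIE (𝕜 := ℝ)
      (E := EuclideanSpace ℝ (Fin n)) (F := ℝ) (0 : Fin 1)).toContinuousLinearEquiv.toContinuousLinearMap.differentiableAt).comp _ ha
  rw [hlin X Y hX hY, hlin Y X hY hX, hbr]
  have hext : extDerivOne α x ![X x, Y x] = extDeriv (fun y =>
      ContinuousAlternatingMap.ofSubsingleton ℝ (EuclideanSpace ℝ (Fin n)) ℝ (0 : Fin 1)
        (chartCov φ α y)) (φ x) ![chartRep φ X (φ x), chartRep φ Y (φ x)] := by
    change extDeriv (fun y =>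
      ContinuousAlternatingMap.ofSubsingleton ℝ (EuclideanSpace ℝ (Fin n)) ℝ (0 : Fin 1)
        (chartCov φ α y)) (φ x) (mfderiv (𝓡 n) (𝓡 n) φ x ∘ ![X x, Y x]) = _
    congr 1
    funext i
    fin_cases i
    · exact (chartRep_apply hφ hxs X).symm
    · exact (chartRep_apply hφ hxs Y).symm
  rw [hext, extDeriv_apply hsub, Fin.sum_univ_two]
  have hc : ∀ w : EuclideanSpace ℝ (Fin n), ∀ u, fderiv ℝ (fun y => chartCov φ α y w) (φ x) u =
      fderiv ℝ (chartCov φ α) (φ x) u w := by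
    intro w u
    rw [fderiv_clm_apply ha (differentiableAt_const w)]
    simp
  simp only [ContinuousAlternatingMap.ofSubsingleton_apply_apply, Fin.removeNth]
  simp only [Fin.succAbove, VectorField.lieBracket, map_sub]
  simp [hc]
  ring

/-- The term d(i_X α)(Y) = Y · α(X) cancels against the same term of Cartan's formula. -/
lemma lieForm_apply {α : CovField n M} {X Y : VField n M} (hU : IsOpen U)
    (hα : SmoothCovField U α) (hX : SmoothVField U X) (hY : SmoothVField U Y) (hx : x ∈ U) :
    lieForm X α x (Y x) = act X (evalForm α Y) x
      - α x (VectorField.mlieBracket (𝓡 n) X Y x) := by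
  change dF n (evalForm α X) x (Y x) + interiorProd (extDerivOne α x) (X x) (Y x) = _
  rw [interiorProd_apply, extDerivOne_apply hU hα hX hY hx]
  change act Y (evalForm α X) x + _ = _
  ring

/-- The vector field with constant components in the chart at `x` and value `v` at `x`. -/
def extendVector (x : M) (v : TangentSpace (𝓡 n) x) : VField n M := fun y =>
  ∑ i, dF n (fun z => chartAt (EuclideanSpace ℝ (Fin n)) x z i) x v •
    coordVector (chartAt (EuclideanSpace ℝ (Fin n)) x) i y

lemma extendVector_self (x : M) (v : TangentSpace (𝓡 n) x) : extendVector x v x = v :=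
  sum_coordVector (chartAt_mem x) (mem_chart_source _ x) v

lemma smoothVField_extendVector (x : M) (v : TangentSpace (𝓡 n) x) :
    SmoothVField (chartAt (EuclideanSpace ℝ (Fin n)) x).source (extendVector x v) :=
  SmoothVField.sum fun i _ => SmoothVField.smul (smoothFun_const _ _) (smoothVField_coordVector (chartAt_mem x) i)

end Charts

/-! ### Linear algebra of p-vectors and forms on one vector space -/

section Pointwise

variable {V : Type*} [AddCommGroup V] [Module ℝ V] [TopologicalSpace V]

lemma wedge_apply {k : ℕ} (α : Fin k → (V →L[ℝ] ℝ)) (v : Fin k → V) :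
    wedge α v = Matrix.det (Matrix.of fun i j => α j (v i)) := rfl

lemma fixFirst_apply {p q : ℕ} (Ω : V [⋀^Fin (p + q)]→L[ℝ] ℝ) (u : Fin p → V) (Y : Fin q → V) :
    fixFirst Ω u Y = Ω (Fin.append u Y) := rfl

/-- The decomposable `p`-vector `X₁ ∧ ⋯ ∧ X_p`. -/
def wedgeVec {p : ℕ} (X : Fin p → V) : (V →L[ℝ] ℝ) [⋀^Fin p]→ₗ[ℝ] ℝ :=
  (Matrix.detRowAlternating (R := ℝ) (n := Fin p)).compLinearMap
    (LinearMap.pi fun j =>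
      { toFun := fun α => α (X j), map_add' := fun _ _ => rfl, map_smul' := fun _ _ => rfl })

lemma wedgeVec_apply {p : ℕ} (X : Fin p → V) (α : Fin p → (V →L[ℝ] ℝ)) :
    wedgeVec X α = Matrix.det (Matrix.of fun i j => α i (X j)) := rfl

lemma IsWedgeOf.eq {p : ℕ} {P : (V →L[ℝ] ℝ) [⋀^Fin p]→ₗ[ℝ] ℝ} {X : Fin p → V}
    (h : IsWedgeOf P X) : P = wedgeVec X := AlternatingMap.ext h

lemma multilinear_expand {W ι : Type*} [AddCommGroup W] [Module ℝ W] [Fintype ι] {p : ℕ}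
    (f : MultilinearMap ℝ (fun _ : Fin p => W) ℝ) (c : Fin p → ι → ℝ) (w : ι → W) :
    f (fun k => ∑ j, c k j • w j) = ∑ I : Fin p → ι, (∏ k, c k (I k)) * f (fun k => w (I k)) := by
  classical
  rw [f.map_sum]
  refine Finset.sum_congr rfl fun I _ => ?_
  rw [f.map_smul_univ, smul_eq_mul]

lemma append_update_left {A : Type*} {p q : ℕ} [DecidableEq (Fin p)] (u : Fin p → A)
    (Y : Fin q → A) (i : Fin p) (z : A) : Fin.append (Function.update u i z) Y =
      Function.update (Fin.append u Y) (Fin.castAdd q i) z := by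
  funext j
  refine Fin.addCases (fun j => ?_) (fun j => ?_) j
  · rw [Fin.append_left]
    by_cases hj : j = i
    · subst hj; simp
    · rw [Function.update_of_ne hj, Function.update_of_ne
        (fun h => hj (Fin.castAdd_injective _ _ h)), Fin.append_left]
  · rw [Fin.append_right, Function.update_of_ne, Fin.append_right]
    intro hj
    have := congrArg Fin.val hj
    simp only [Fin.val_castAdd, Fin.val_natAdd] at this
    omega

/-! ### Contraction of p-vectors with top forms -/

section Contract

variable [IsTopologicalAddGroup V] [ContinuousSMul ℝ V] [T2Space V] [FiniteDimensional ℝ V]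
  {p q : ℕ}

lemma contract_apply (P : (V →L[ℝ] ℝ) [⋀^Fin p]→ₗ[ℝ] ℝ) (Ω : V [⋀^Fin (p + q)]→L[ℝ] ℝ)
    (Y : Fin q → V) : contract P Ω Y = ((p.factorial : ℝ)⁻¹) *
      ∑ I : Fin p → Fin (Module.finrank ℝ V),
        P (fun k => LinearMap.toContinuousLinearMap ((Module.finBasis ℝ V).coord (I k))) *
          Ω (Fin.append (fun k => Module.finBasis ℝ V (I k)) Y) := by
  rw [contract, ContinuousAlternatingMap.smul_apply, smul_eq_mul,
    ContinuousAlternatingMap.sum_apply]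
  rfl

lemma contract_smul_left (r : ℝ) (P : (V →L[ℝ] ℝ) [⋀^Fin p]→ₗ[ℝ] ℝ)
    (Ω : V [⋀^Fin (p + q)]→L[ℝ] ℝ) : contract (r • P) Ω = r • contract P Ω := by
  ext Y
  rw [ContinuousAlternatingMap.smul_apply, contract_apply, contract_apply, smul_eq_mul,
    mul_left_comm, Finset.mul_sum (a := r)]
  simp only [AlternatingMap.smul_apply, smul_eq_mul, mul_assoc]

lemma contract_smul_right (r : ℝ) (P : (V →L[ℝ] ℝ) [⋀^Fin p]→ₗ[ℝ] ℝ)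
    (Ω : V [⋀^Fin (p + q)]→L[ℝ] ℝ) : contract P (r • Ω) = r • contract P Ω := by
  ext Y
  rw [ContinuousAlternatingMap.smul_apply, contract_apply, contract_apply, smul_eq_mul,
    mul_left_comm, Finset.mul_sum (a := r)]
  simp only [ContinuousAlternatingMap.smul_apply, smul_eq_mul, mul_left_comm _ r]

/-- `i_{X₁ ∧ ⋯ ∧ X_p} Ω = Ω(X₁, …, X_p, ·, …, ·)`. -/
lemma contract_wedgeVec (X : Fin p → V) (Ω : V [⋀^Fin (p + q)]→L[ℝ] ℝ) :
    contract (wedgeVec X) Ω = fixFirst Ω X := by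
  ext Y
  let b := Module.finBasis ℝ V
  let F : V [⋀^Fin p]→ₗ[ℝ] ℝ :=
    { toFun := fun u => Ω (Fin.append u Y)
      map_update_add' := fun u i x y => by
        simp only [append_update_left]
        exact Ω.map_update_add _ _ _ _
      map_update_smul' := fun u i c x => by
        simp only [append_update_left]
        exact Ω.map_update_smul _ _ _ _
      map_eq_zero_of_eq' := fun u i j huv hij => by
        refine Ω.map_eq_zero_of_eq (Fin.append u Y) (i := Fin.castAdd q i)
          (j := Fin.castAdd q j) (by simpa using huv) ?_
        exact fun h => hij (Fin.castAdd_injective _ _ h) }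
  rw [contract_apply, fixFirst_apply]
  have hσ : ∀ σ : Equiv.Perm (Fin p), Ω (Fin.append (X ∘ σ) Y) =
      ∑ I : Fin p → Fin (Module.finrank ℝ V), (∏ k, b.coord (I k) (X (σ k))) *
        Ω (Fin.append (fun k => b (I k)) Y) := by
    intro σ
    have h := multilinear_expand F.toMultilinearMap (fun k j => b.coord j (X (σ k))) b
    have h2 : (fun k => ∑ j, b.coord j (X (σ k)) • b j) = X ∘ σ := by
      funext k
      exact b.sum_repr (X (σ k))
    rw [h2] at h
    exact h
  -- The Leibniz expansion of the determinant exchanges the sum over multi-indices for a sum over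
  -- permutations of the X_k.
  have hsum : ∑ I : Fin p → Fin (Module.finrank ℝ V),
      wedgeVec X (fun k => LinearMap.toContinuousLinearMap (b.coord (I k))) *
        Ω (Fin.append (fun k => b (I k)) Y) =
      ∑ σ : Equiv.Perm (Fin p), (Equiv.Perm.sign σ : ℝ) * Ω (Fin.append (X ∘ σ) Y) := by
    simp only [hσ, wedgeVec_apply, Finset.mul_sum]
    rw [Finset.sum_comm]
    refine Finset.sum_congr rfl fun I _ => ?_
    rw [← Matrix.det_transpose, Matrix.det_apply', Finset.sum_mul]
    refine Finset.sum_congr rfl fun σ _ => ?_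
    rw [mul_assoc]
    rfl
  -- All p! summands agree because Ω is alternating; this is what the factor 1 / p! compensates.
  have hone : ∀ σ : Equiv.Perm (Fin p),
      (Equiv.Perm.sign σ : ℝ) * Ω (Fin.append (X ∘ σ) Y) = Ω (Fin.append X Y) := by
    intro σ
    have h : Ω (Fin.append (X ∘ σ) Y) = _ := F.map_perm X σ
    rw [h]
    change ((Equiv.Perm.sign σ : ℤ) : ℝ) * ((Equiv.Perm.sign σ) • Ω (Fin.append X Y)) = _
    rw [Units.smul_def, zsmul_eq_mul, ← mul_assoc, ← Int.cast_mul]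
    simp
  have hp : (p.factorial : ℝ) ≠ 0 := by exact_mod_cast p.factorial_ne_zero
  change (p.factorial : ℝ)⁻¹ * (∑ I : Fin p → Fin (Module.finrank ℝ V),
      wedgeVec X (fun k => LinearMap.toContinuousLinearMap (b.coord (I k))) *
        Ω (Fin.append (fun k => b (I k)) Y)) = _
  rw [hsum, Finset.sum_congr rfl fun σ _ => hone σ, Finset.sum_const, Finset.card_univ,
    Fintype.card_perm, Fintype.card_fin, nsmul_eq_mul, ← mul_assoc, inv_mul_cancel₀ hp, one_mul]

/-- A determinant with the last vectors of a basis as last columns. -/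
lemma basis_det_append_right (c : Module.Basis (Fin (p + q)) ℝ V) (v : Fin p → V) :
    c.det (Fin.append v (fun k => c (Fin.natAdd p k))) =
      Matrix.det (Matrix.of fun i j => c.coord (Fin.castAdd q i) (v j)) := by
  rw [Module.Basis.det_apply, ← Matrix.det_submatrix_equiv_self finSumFinEquiv]
  -- The last q columns are unit vectors, so the matrix is block triangular with an identity block.
  have h : (c.toMatrix (Fin.append v (fun k => c (Fin.natAdd p k)))).submatrix
      finSumFinEquiv finSumFinEquiv = Matrix.fromBlocks
        (Matrix.of fun i j => c.coord (Fin.castAdd q i) (v j)) 0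
        (Matrix.of fun i j => c.coord (Fin.natAdd p i) (v j)) 1 := by
    ext i j
    rcases i with i | i <;> rcases j with j | j
    · simp [Module.Basis.toMatrix_apply]
    · have : Fin.castAdd q i ≠ Fin.natAdd p j := by
        intro h; have := congrArg Fin.val h; simp at this; omega
      simp [Module.Basis.toMatrix_apply, this.symm]
    · simp [Module.Basis.toMatrix_apply]
    · simp [Module.Basis.toMatrix_apply, Finsupp.single_apply, Matrix.one_apply, eq_comm]
  rw [h, Matrix.det_fromBlocks_zero₁₂, Matrix.det_one, mul_one]

/-- A determinant with the first vectors of a basis as first columns. -/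
lemma basis_det_append_left (c : Module.Basis (Fin (p + q)) ℝ V) (v : Fin q → V) :
    c.det (Fin.append (fun k => c (Fin.castAdd q k)) v) =
      Matrix.det (Matrix.of fun i j => c.coord (Fin.natAdd p i) (v j)) := by
  rw [Module.Basis.det_apply, ← Matrix.det_submatrix_equiv_self finSumFinEquiv]
  have h : (c.toMatrix (Fin.append (fun k => c (Fin.castAdd q k)) v)).submatrix
      finSumFinEquiv finSumFinEquiv = Matrix.fromBlocks
        1 (Matrix.of fun i j => c.coord (Fin.castAdd q i) (v j))
        0 (Matrix.of fun i j => c.coord (Fin.natAdd p i) (v j)) := by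
    ext i j
    rcases i with i | i <;> rcases j with j | j
    · simp [Module.Basis.toMatrix_apply, Finsupp.single_apply, Matrix.one_apply, eq_comm]
    · simp [Module.Basis.toMatrix_apply]
    · have : Fin.natAdd p i ≠ Fin.castAdd q j := by
        intro h; have := congrArg Fin.val h; simp at this; omega
      simp [Module.Basis.toMatrix_apply, this.symm]
    · simp [Module.Basis.toMatrix_apply]
  rw [h, Matrix.det_fromBlocks_zero₂₁, Matrix.det_one, one_mul]

lemma topForm_eq (c : Module.Basis (Fin (p + q)) ℝ V) (Ω : V [⋀^Fin (p + q)]→L[ℝ] ℝ)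
    (v : Fin (p + q) → V) : Ω v = Ω c * c.det v := by
  have h := Ω.toAlternatingMap.eq_smul_basis_det c
  exact congrArg (fun A => A v) h

lemma topForm_basis_ne_zero (c : Module.Basis (Fin (p + q)) ℝ V) {Ω : V [⋀^Fin (p + q)]→L[ℝ] ℝ}
    (hΩ : Ω ≠ 0) : Ω c ≠ 0 := by
  intro h
  apply hΩ
  ext v
  rw [topForm_eq c Ω v, h, zero_mul]
  rfl

/-- A `p`-vector is determined by its contraction with a volume form. -/
lemma contract_basis (c : Module.Basis (Fin (p + q)) ℝ V) (P : (V →L[ℝ] ℝ) [⋀^Fin p]→ₗ[ℝ] ℝ)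
    (Ω : V [⋀^Fin (p + q)]→L[ℝ] ℝ) :
    contract P Ω (fun k => c (Fin.natAdd p k)) =
      P (fun i => LinearMap.toContinuousLinearMap (c.coord (Fin.castAdd q i))) * Ω c := by
  let b := Module.finBasis ℝ V
  let α : Fin p → (V →L[ℝ] ℝ) := fun i => LinearMap.toContinuousLinearMap
    (c.coord (Fin.castAdd q i))
  -- Dual to `contract_wedgeVec`: now P is expanded in the dual basis, and the determinant comes
  -- from Ω, through `basis_det_append_right`.
  have hσ : ∀ σ : Equiv.Perm (Fin p), P (α ∘ σ) =
      ∑ I : Fin p → Fin (Module.finrank ℝ V), (∏ k, α (σ k) (b (I k))) *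
        P (fun k => LinearMap.toContinuousLinearMap (b.coord (I k))) := by
    intro σ
    have h := multilinear_expand P.toMultilinearMap (fun k j => α (σ k) (b j))
      (fun j => LinearMap.toContinuousLinearMap (b.coord j))
    have h2 : (fun k => ∑ j, α (σ k) (b j) • LinearMap.toContinuousLinearMap (b.coord j)) =
        α ∘ σ := by
      funext k
      ext v
      have hv := congrArg (α (σ k)) (b.sum_repr v)
      rw [map_sum] at hv
      simp only [map_smul, smul_eq_mul] at hv
      rw [Function.comp_apply, ← hv]
      simp [mul_comm]
    rw [h2] at h
    exact h
  have hsum : ∑ I : Fin p → Fin (Module.finrank ℝ V),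
      P (fun k => LinearMap.toContinuousLinearMap (b.coord (I k))) *
        Ω (Fin.append (fun k => b (I k)) (fun k => c (Fin.natAdd p k))) =
      ∑ σ : Equiv.Perm (Fin p), (Equiv.Perm.sign σ : ℝ) * P (α ∘ σ) * Ω c := by
    simp only [hσ, Finset.mul_sum, Finset.sum_mul]
    rw [Finset.sum_comm]
    refine Finset.sum_congr rfl fun I _ => ?_
    rw [topForm_eq c, basis_det_append_right, Matrix.det_apply', Finset.mul_sum, Finset.mul_sum]
    refine Finset.sum_congr rfl fun σ _ => ?_
    have : ∏ k, (Matrix.of fun i j => c.coord (Fin.castAdd q i) (b (I j))) (σ k) k =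
      ∏ k, α (σ k) (b (I k)) := rfl
    rw [this]
    ring
  have hone : ∀ σ : Equiv.Perm (Fin p),
      (Equiv.Perm.sign σ : ℝ) * P (α ∘ σ) * Ω c = P α * Ω c := by
    intro σ
    rw [P.map_perm, Units.smul_def, zsmul_eq_mul, ← mul_assoc, ← Int.cast_mul]
    simp
  have hp : (p.factorial : ℝ) ≠ 0 := by exact_mod_cast p.factorial_ne_zero
  rw [contract_apply, hsum, Finset.sum_congr rfl fun σ _ => hone σ, Finset.sum_const,
    Finset.card_univ, Fintype.card_perm, Fintype.card_fin, nsmul_eq_mul, ← mul_assoc,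
    inv_mul_cancel₀ hp, one_mul]

/-- Serves to move any p distinct indices to the first p places of a basis. -/
lemma exists_perm_extending {N : ℕ} (I : Fin p → Fin N) (J : Fin p → Fin N)
    (hI : Function.Injective I) (hJ : Function.Injective J) :
    ∃ π : Equiv.Perm (Fin N), ∀ k, π (J k) = I k := by
  classical
  let e : {x // x ∈ Set.range J} ≃ {x // x ∈ Set.range I} :=
    (Equiv.ofInjective J hJ).symm.trans (Equiv.ofInjective I hI)
  refine ⟨e.extendSubtype, fun k => ?_⟩
  rw [Equiv.extendSubtype_apply_of_mem _ _ ⟨k, rfl⟩]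
  have : (⟨J k, ⟨k, rfl⟩⟩ : {x // x ∈ Set.range J}) = Equiv.ofInjective J hJ k := rfl
  change ((Equiv.ofInjective I hI ((Equiv.ofInjective J hJ).symm _) : Set.range I) : Fin N) = I k
  rw [this, Equiv.symm_apply_apply]
  rfl

/-- A permutation of b puts any p distinct dual vectors in front; `contract_basis` then reads the
value of P on them off the contraction, up to the nonzero factor Ω(c). Such values determine an
alternating map. -/
lemma eq_of_contract_eq (b : Module.Basis (Fin (p + q)) ℝ V)
    {P P' : (V →L[ℝ] ℝ) [⋀^Fin p]→ₗ[ℝ] ℝ} {Ω : V [⋀^Fin (p + q)]→L[ℝ] ℝ} (hΩ : Ω ≠ 0)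
    (h : contract P Ω = contract P' Ω) : P = P' := by
  let B : Module.Basis (Fin (p + q)) ℝ (V →L[ℝ] ℝ) :=
    b.dualBasis.map LinearMap.toContinuousLinearMap
  have hB : ∀ i, B i = LinearMap.toContinuousLinearMap (b.coord i) := by
    intro i
    simp [B]
  refine Module.Basis.ext_alternating B fun I hI => ?_
  obtain ⟨π, hπ⟩ := exists_perm_extending I (Fin.castAdd q) hI (Fin.castAdd_injective _ _)
  let c := b.reindex π.symm
  have hc : ∀ i, LinearMap.toContinuousLinearMap (c.coord (Fin.castAdd q i)) = B (I i) := by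
    intro i
    rw [hB, ← hπ]
    ext v
    simp [c]
  have h1 := contract_basis c P Ω
  have h2 := contract_basis c P' Ω
  simp only [hc] at h1 h2
  rw [h] at h1
  exact mul_right_cancel₀ (topForm_basis_ne_zero c hΩ) (h1.symm.trans h2)

/-- The contraction of a volume form with a multiple of `c₁ ∧ ⋯ ∧ c_p` is the wedge product of the
last two dual covectors. -/
lemma contract_frame (c : Module.Basis (Fin (p + 2)) ℝ V) {Ω : V [⋀^Fin (p + 2)]→L[ℝ] ℝ}
    (hΩ : Ω ≠ 0) :
    contract ((Ω c)⁻¹ • wedgeVec (fun k => c (Fin.castAdd 2 k))) Ω =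
      wedge ![LinearMap.toContinuousLinearMap (c.coord (Fin.natAdd p 0)),
        LinearMap.toContinuousLinearMap (c.coord (Fin.natAdd p 1))] := by
  ext v
  rw [contract_smul_left, contract_wedgeVec, ContinuousAlternatingMap.smul_apply, fixFirst_apply,
    topForm_eq c Ω (Fin.append _ v), basis_det_append_left, smul_eq_mul, ← mul_assoc,
    inv_mul_cancel₀ (topForm_basis_ne_zero c hΩ), one_mul, wedge_apply, ← Matrix.det_transpose]
  congr 1
  ext i j
  fin_cases i <;> fin_cases j <;> rfl

end Contract

/-! #### The subspaces `L_(β, η)` -/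

lemma mem_graphFibre {β : V [⋀^Fin 2]→L[ℝ] ℝ} {η : V →L[ℝ] ℝ} {a : Fibre V} :
    a ∈ graphFibre β η ↔ a.1.2 = -η a.1.1 ∧ a.2.1 = interiorProd β a.1.1 + a.2.2 • η := by
  constructor
  · rintro ⟨X, f, rfl⟩
    exact ⟨rfl, rfl⟩
  · rintro ⟨h1, h2⟩
    refine ⟨a.1.1, a.2.2, ?_⟩
    rw [← h1, ← h2]

lemma form_swap (β : V [⋀^Fin 2]→L[ℝ] ℝ) (v w : V) : β ![v, w] = - β ![w, v] := by
  have h := β.toAlternatingMap.map_swap ![w, v] (i := 0) (j := 1) (by decide)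
  have h2 : ![w, v] ∘ (Equiv.swap (0 : Fin 2) 1) = ![v, w] := by
    funext i; fin_cases i <;> rfl
  rw [h2] at h
  exact h

/-- Every `L_(β, η)` is maximally isotropic. -/
lemma maximal_isIsotropic_graphFibre (β : V [⋀^Fin 2]→L[ℝ] ℝ) (η : V →L[ℝ] ℝ) :
    Maximal IsIsotropic (graphFibre β η) := by
  refine ⟨?_, fun S hS hle b hb => ?_⟩
  · rintro a ⟨X, f, rfl⟩ b ⟨Y, g, rfl⟩
    simp only [pairing, add_apply, interiorProd_apply, smul_apply, smul_eq_mul]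
    rw [form_swap β X Y]
    ring
  -- Pairing b with the general element of the subspace gives an identity affine in t. The
  -- coefficient of t fixes the function part of b, the rest its covector part.
  · have key : ∀ (X : V) (t : ℝ), β ![X, b.1.1] + t * η b.1.1 + b.2.1 X + t * b.1.2
        - b.2.2 * η X = 0 := by
      intro X t
      have h := hS ((X, -η X), (interiorProd β X + t • η, t)) (hle ⟨X, t, rfl⟩) b hb
      simp only [pairing, add_apply, interiorProd_apply, smul_apply, smul_eq_mul] at h
      linarith
    rw [mem_graphFibre]
    have h0 : ∀ X : V, β ![X, b.1.1] + b.2.1 X - b.2.2 * η X = 0 := by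
      intro X
      have := key X 0
      linarith
    refine ⟨?_, ?_⟩
    · have h1 := key 0 1
      have h2 := h0 0
      linarith
    · ext X
      have := h0 X
      rw [form_swap β X] at this
      simp only [add_apply, interiorProd_apply, smul_apply, smul_eq_mul]
      linarith

end Pointwise

/-! ### Smooth inverse function theorem -/

section InverseFunction

variable {E F : Type*} [NormedAddCommGroup E] [NormedSpace ℝ E] [CompleteSpace E]
  [NormedAddCommGroup F] [NormedSpace ℝ F] [CompleteSpace F]

/-- The inverse function theorem for `C^∞` maps on an open set. -/
theorem exists_smooth_openPartialHomeomorph {f : E → F} {U : Set E} (hU : IsOpen U)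
    (hf : ContDiffOn ℝ ∞ f U) {x₀ : E} (hx₀ : x₀ ∈ U) {f' : E ≃L[ℝ] F}
    (hf' : HasFDerivAt f (f' : E →L[ℝ] F) x₀) :
    ∃ e : OpenPartialHomeomorph E F, x₀ ∈ e.source ∧ e.source ⊆ U ∧ (e : E → F) = f ∧
      ContDiffOn ℝ ∞ e e.source ∧ ContDiffOn ℝ ∞ e.symm e.target := by
  have hne : (∞ : WithTop ℕ∞) ≠ 0 := by simp
  have hat : ContDiffAt ℝ ∞ f x₀ := hf.contDiffAt (hU.mem_nhds hx₀)
  -- On S the derivative is invertible at every point, so after restriction the inverse is smooth on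
  -- the whole target and not only at the image of x₀.
  let S : Set E := U ∩ fderiv ℝ f ⁻¹' Set.range ((↑) : (E ≃L[ℝ] F) → E →L[ℝ] F)
  have hS : IsOpen S := (hf.continuousOn_fderiv_of_isOpen hU (by simp)).isOpen_inter_preimage hU
    (ContinuousLinearEquiv.isOpen)
  let e₀ := hat.toOpenPartialHomeomorph f hf' hne
  have hx : x₀ ∈ S := ⟨hx₀, ⟨f', hf'.fderiv.symm⟩⟩
  refine ⟨e₀.restrOpen S hS, ⟨hat.mem_toOpenPartialHomeomorph_source hf' hne, hx⟩,
    fun y hy => hy.2.1, rfl, ?_, ?_⟩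
  · exact hf.mono fun y hy => hy.2.1
  · intro y hy
    have hsrc : (e₀.restrOpen S hS).symm y ∈ (e₀.restrOpen S hS).source :=
      (e₀.restrOpen S hS).map_target hy
    obtain ⟨g, hg⟩ := hsrc.2.2
    have hfy := hf.contDiffAt (hU.mem_nhds hsrc.2.1)
    refine ((e₀.restrOpen S hS).contDiffAt_symm hy (f₀' := g) ?_ hfy).contDiffWithinAt
    rw [hg]
    exact (hfy.differentiableAt hne).hasFDerivAt

end InverseFunction

/-! ### Superposition operators on spaces of curves -/

section Superposition

variable {I : Type*} [TopologicalSpace I] [CompactSpace I]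
  {E G : Type*} [NormedAddCommGroup E] [NormedSpace ℝ E] [NormedAddCommGroup G] [NormedSpace ℝ G]

/-- Pointwise application of a continuous family of linear maps, as a continuous linear map. -/
def pointwiseApply : C(I, E →L[ℝ] G) →L[ℝ] C(I, E) →L[ℝ] C(I, G) :=
  LinearMap.mkContinuous₂
    (LinearMap.mk₂ ℝ (fun (A : C(I, E →L[ℝ] G)) (η : C(I, E)) =>
        (⟨fun r => A r (η r), by fun_prop⟩ : C(I, G)))
      (fun _ _ _ => rfl) (fun _ _ _ => rfl) (fun _ _ _ => by ext; simp) (fun _ _ _ => by ext; simp))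
    1 (fun A η => by
      rw [one_mul, ContinuousMap.norm_le _ (by positivity)]
      intro r
      exact (A r).le_of_opNorm_le_of_le (A.norm_coe_le_norm r) (η.norm_coe_le_norm r))

@[simp] lemma pointwiseApply_apply (A : C(I, E →L[ℝ] G)) (η : C(I, E)) (r : I) :
    pointwiseApply A η r = A r (η r) := rfl

/-- The superposition operator `γ ↦ F ∘ γ` on continuous maps. -/
def superposition (F : E → G) (hF : Continuous F) (γ : C(I, E)) : C(I, G) :=
  ⟨fun r => F (γ r), by fun_prop⟩

@[simp] lemma superposition_apply (F : E → G) (hF : Continuous F) (γ : C(I, E)) (r : I) :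
    superposition F hF γ r = F (γ r) := rfl

/-- The derivative of F is uniformly continuous on the compact ball of radius ‖γ‖ + 1, so the mean
value inequality on the segments from γ(r) to γ(r) + η(r) bounds the remainder by c ‖η‖ uniformly in
r. -/
lemma hasFDerivAt_superposition [ProperSpace E] {F : E → G} (hF : ContDiff ℝ 1 F) (γ : C(I, E)) :
    HasFDerivAt (superposition (I := I) F hF.continuous)
      (pointwiseApply (superposition (fderiv ℝ F) (hF.continuous_fderiv (by simp)) γ)) γ := by
  rw [hasFDerivAt_iff_isLittleO_nhds_zero, Asymptotics.isLittleO_iff]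
  intro c hc
  have huc : UniformContinuousOn (fderiv ℝ F) (Metric.closedBall 0 (‖γ‖ + 1)) :=
    (isCompact_closedBall _ _).uniformContinuousOn_of_continuous
      (hF.continuous_fderiv (by simp)).continuousOn
  obtain ⟨δ, hδ, hδ'⟩ := Metric.uniformContinuousOn_iff.1 huc c hc
  filter_upwards [Metric.ball_mem_nhds (0 : C(I, E)) (lt_min hδ one_pos)] with η hη
  rw [mem_ball_zero_iff, lt_min_iff] at hη
  rw [ContinuousMap.norm_le _ (by positivity)]
  intro r
  have hηr := η.norm_coe_le_norm r
  have hγr := γ.norm_coe_le_norm r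
  have hmem : γ r ∈ Metric.ball (γ r) (‖η r‖) ∪ {γ r} := by simp
  have key := (convex_segment (γ r) (γ r + η r)).norm_image_sub_le_of_norm_hasFDerivWithin_le'
    (f := F) (f' := fderiv ℝ F) (φ := fderiv ℝ F (γ r)) (C := c)
    (fun y _ => ((hF.differentiable (by simp)) y).hasFDerivAt.hasFDerivWithinAt) (fun y hy => by
      have hy1 : ‖y - γ r‖ ≤ ‖η r‖ := by
        have := norm_sub_le_of_mem_segment hy
        simpa using this
      have hy2 : ‖y‖ ≤ ‖γ‖ + 1 := by
        calc ‖y‖ = ‖(y - γ r) + γ r‖ := by simp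
          _ ≤ ‖y - γ r‖ + ‖γ r‖ := norm_add_le _ _
          _ ≤ ‖γ‖ + 1 := by linarith [hη.2]
      have := hδ' y (by simpa using hy2) (γ r) (by simp; linarith) (by
        rw [dist_eq_norm]; linarith [hη.1])
      rw [dist_eq_norm] at this
      exact this.le) (left_mem_segment ℝ _ _) (right_mem_segment ℝ _ _)
  have : ‖F (γ r + η r) - F (γ r) - fderiv ℝ F (γ r) (η r)‖ ≤ c * ‖η r‖ := by
    simpa using key
  exact this.trans (by gcongr)

end Superposition

/-! ### Smoothness of superposition operators -/

section SuperpositionSmooth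

universe u
variable {I : Type*} [TopologicalSpace I] [CompactSpace I]
  {E : Type u} [NormedAddCommGroup E] [NormedSpace ℝ E] [ProperSpace E]

/-- The derivative is again a superposition operator, that of `fderiv ℝ F`, followed by a bounded
bilinear map, so induction applies with the target space varying. E and G share a universe so that E
→L[ℝ] G is an admissible target. -/
lemma contDiff_nat_superposition (k : ℕ) : ∀ {G : Type u} [NormedAddCommGroup G] [NormedSpace ℝ G]
    {F : E → G} (hF : ContDiff ℝ ∞ F),
    ContDiff ℝ k (superposition (I := I) F hF.continuous) := by
  induction k with
  | zero =>
    intro G _ _ F hF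
    exact contDiff_zero.2 (ContinuousMap.continuous_postcomp (⟨F, hF.continuous⟩ : C(E, G)))
  | succ k ih =>
    intro G _ _ F hF
    have h1 : ContDiff ℝ ∞ (fderiv ℝ F) := hF.fderiv_right (by simp)
    refine contDiff_succ_iff_hasFDerivAt.2 ⟨fun γ => pointwiseApply
      (superposition (fderiv ℝ F) h1.continuous γ), ?_, fun γ =>
        hasFDerivAt_superposition (hF.of_le (by simp)) γ⟩
    exact pointwiseApply.contDiff.comp (ih h1)

/-- The superposition operator of a smooth map is smooth. -/
theorem contDiff_superposition {G : Type u} [NormedAddCommGroup G] [NormedSpace ℝ G]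
    {F : E → G} (hF : ContDiff ℝ ∞ F) :
    ContDiff ℝ ∞ (superposition (I := I) F hF.continuous) :=
  contDiff_infty.2 fun k => contDiff_nat_superposition k hF

end SuperpositionSmooth

/-! ### Integration of curves -/

section Primitive

variable {G : Type*} [NormedAddCommGroup G] [NormedSpace ℝ G] [CompleteSpace G]

open unitInterval

/-- Integration from `0`, as a continuous linear map on curves over the unit interval. -/
def primitive : C(I, G) →L[ℝ] C(I, G) :=
  LinearMap.mkContinuous
    { toFun := fun γ => ⟨fun s => ∫ r in (0 : ℝ)..s, γ (Set.projIcc 0 1 zero_le_one r), by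
        have : Continuous fun s : ℝ => ∫ r in (0 : ℝ)..s, γ (Set.projIcc 0 1 zero_le_one r) :=
          intervalIntegral.continuous_primitive (fun a b => Continuous.intervalIntegrable
            (γ.continuous.comp continuous_projIcc) _ _) 0
        exact this.comp continuous_subtype_val⟩
      map_add' := fun γ η => by
        ext s
        exact intervalIntegral.integral_add
          ((γ.continuous.comp continuous_projIcc).intervalIntegrable _ _)
          ((η.continuous.comp continuous_projIcc).intervalIntegrable _ _)
      map_smul' := fun c γ => by
        ext s
        exact intervalIntegral.integral_smul c _ }
    1 (fun γ => by
      rw [one_mul, ContinuousMap.norm_le _ (norm_nonneg _)]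
      intro s
      have := intervalIntegral.norm_integral_le_of_norm_le_const (a := 0) (b := (s : ℝ)) (C := ‖γ‖)
        (f := fun r => γ (Set.projIcc 0 1 zero_le_one r)) (fun r _ => γ.norm_coe_le_norm _)
      refine this.trans ?_
      have h0 := s.2.1
      have h1 := s.2.2
      rw [sub_zero, abs_of_nonneg h0]
      exact mul_le_of_le_one_right (norm_nonneg _) h1)

lemma primitive_apply (γ : C(I, G)) (s : I) :
    primitive γ s = ∫ r in (0 : ℝ)..s, γ (Set.projIcc 0 1 zero_le_one r) := rfl

end Primitive

/-- A smooth map on an open set agrees near any point with a globally smooth map. -/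
lemma exists_contDiff_eqOn {E F : Type*} [NormedAddCommGroup E] [NormedSpace ℝ E]
    [FiniteDimensional ℝ E] [NormedAddCommGroup F] [NormedSpace ℝ F] {f : E → F} {U : Set E}
    (hU : IsOpen U) (hf : ContDiffOn ℝ ∞ f U) {x₀ : E} (hx₀ : x₀ ∈ U) :
    ∃ g : E → F, ContDiff ℝ ∞ g ∧ ∃ ε > 0, Metric.ball x₀ ε ⊆ U ∧
      ∀ x ∈ Metric.ball x₀ ε, g x = f x := by
  obtain ⟨r, hr, hrU⟩ := Metric.isOpen_iff.1 hU x₀ hx₀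
  -- The bump is 1 on the ball of radius r/3 and supported in the closed ball of radius r/2, which
  -- lies inside U.
  let χ : ContDiffBump x₀ := ⟨r / 3, r / 2, by positivity, by linarith⟩
  have hin : χ.rIn = r / 3 := rfl
  have hout : χ.rOut = r / 2 := rfl
  refine ⟨fun x => χ x • f x, ?_, r / 3, by positivity,
    (Metric.ball_subset_ball (by linarith)).trans hrU, fun x hx => ?_⟩
  · rw [contDiff_iff_contDiffAt]
    intro x
    by_cases hx : x ∈ U
    · exact χ.contDiffAt.smul (hf.contDiffAt (hU.mem_nhds hx))
    · have hx' : x ∉ tsupport χ := by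
        rw [χ.tsupport_eq, hout]
        exact fun h => hx (hrU (Metric.closedBall_subset_ball (by linarith) h))
      have h0 : (fun x => χ x • f x) =ᶠ[𝓝 x] fun _ => 0 := by
        filter_upwards [(isClosed_tsupport χ).isOpen_compl.mem_nhds hx'] with y hy
        rw [image_eq_zero_of_notMem_tsupport hy, zero_smul]
      exact contDiffAt_const.congr_of_eventuallyEq h0
  · simp only
    rw [χ.one_of_mem_closedBall (by rw [hin]; exact Metric.ball_subset_closedBall hx), one_smul]

/-! ### Frobenius theorem by radial integration -/

section Frobenius

open unitInterval

universe u
variable {T Z : Type u} [NormedAddCommGroup T] [NormedSpace ℝ T] [FiniteDimensional ℝ T]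
  [NormedAddCommGroup Z] [NormedSpace ℝ Z] [FiniteDimensional ℝ Z]

/-- The curve `r ↦ (r t, γ r, t)`. -/
def radialCurve : (T × C(I, Z)) →L[ℝ] C(I, T × Z × T) :=
  LinearMap.mkContinuous
    { toFun := fun x => ⟨fun r => ((r : ℝ) • x.1, x.2 r, x.1), by fun_prop⟩
      map_add' := fun x y => by ext r <;> simp
      map_smul' := fun c x => by ext r <;> simp [smul_comm c] }
    1 (fun x => by
      rw [one_mul, ContinuousMap.norm_le _ (norm_nonneg _)]
      intro r
      have h1 : ‖(r : ℝ) • x.1‖ ≤ ‖x.1‖ := by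
        rw [norm_smul, Real.norm_of_nonneg r.2.1]
        exact mul_le_of_le_one_left (norm_nonneg _) r.2.2
      have h2 := x.2.norm_coe_le_norm r
      exact max_le (h1.trans (le_max_left _ _)) (max_le (h2.trans (le_max_right _ _))
        (le_max_left _ _)))

@[simp] lemma radialCurve_apply (x : T × C(I, Z)) (r : I) :
    radialCurve x r = ((r : ℝ) • x.1, x.2 r, x.1) := rfl

/-- Constant curves, as a continuous linear map. -/
def constCurve : Z →L[ℝ] C(I, Z) :=
  LinearMap.mkContinuous
    { toFun := fun z => ContinuousMap.const I z
      map_add' := fun _ _ => rfl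
      map_smul' := fun _ _ => rfl }
    1 (fun z => by
      rw [one_mul, ContinuousMap.norm_le _ (norm_nonneg _)]
      intro r; exact le_rfl)

@[simp] lemma constCurve_apply (z : Z) (r : I) : constCurve z r = z := rfl

/-- The map `(τ, w, t) ↦ a(τ, w) t`. -/
def radialField (a : T × Z → T →L[ℝ] Z) (x : T × Z × T) : Z := a (x.1, x.2.1) x.2.2

lemma contDiff_radialField {a : T × Z → T →L[ℝ] Z} (ha : ContDiff ℝ ∞ a) :
    ContDiff ℝ ∞ (radialField a) := by
  unfold radialField
  fun_prop

lemma fderiv_radialField {a : T × Z → T →L[ℝ] Z} (ha : ContDiff ℝ ∞ a) (x v : T × Z × T) :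
    fderiv ℝ (radialField a) x v =
      fderiv ℝ a (x.1, x.2.1) (v.1, v.2.1) x.2.2 + a (x.1, x.2.1) v.2.2 := by
  have h1 : HasFDerivAt a (fderiv ℝ a (x.1, x.2.1)) (x.1, x.2.1) :=
    (ha.differentiable (by simp) _).hasFDerivAt
  have h2 : HasFDerivAt (fun x : T × Z × T => (x.1, x.2.1))
      ((ContinuousLinearMap.fst ℝ T (Z × T)).prod
        ((ContinuousLinearMap.fst ℝ Z T).comp (ContinuousLinearMap.snd ℝ T (Z × T)))) x :=
    ((ContinuousLinearMap.fst ℝ T (Z × T)).prod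
        ((ContinuousLinearMap.fst ℝ Z T).comp (ContinuousLinearMap.snd ℝ T (Z × T)))).hasFDerivAt
  have h3 : HasFDerivAt (fun x : T × Z × T => x.2.2)
      ((ContinuousLinearMap.snd ℝ Z T).comp (ContinuousLinearMap.snd ℝ T (Z × T))) x :=
    ((ContinuousLinearMap.snd ℝ Z T).comp (ContinuousLinearMap.snd ℝ T (Z × T))).hasFDerivAt
  have h4 := (HasFDerivAt.comp x h1 h2).clm_apply h3
  have h5 : fderiv ℝ (radialField a) x = _ := h4.fderiv
  rw [h5]
  simp [add_comm]

/-- The solutions of `γ' = a(s t, γ) t`, `γ(0) = z` over the unit interval, for `t` near `0` and `z`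
near `z₀`, depend smoothly on `(t, z)`. -/
lemma exists_radial_solution {a : T × Z → T →L[ℝ] Z} (ha : ContDiff ℝ ∞ a) (z₀ : Z) :
    ∃ (O : Set (T × Z)) (γ : T × Z → C(I, Z)), IsOpen O ∧ ((0 : T), z₀) ∈ O ∧
      ContDiffOn ℝ ∞ γ O ∧ γ (0, z₀) = constCurve z₀ ∧
      ∀ p ∈ O, γ p = constCurve p.2 + primitive (superposition (radialField a)
        (contDiff_radialField ha).continuous (radialCurve (p.1, γ p))) := by
  have hG := contDiff_radialField ha
  let N : C(I, T × Z × T) → C(I, Z) := superposition (radialField a) hG.continuous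
  have hN : ContDiff ℝ ∞ N := contDiff_superposition hG
  -- Zeros of Φ are the solutions of the integral equation with parameters (t, z); the implicit
  -- function argument takes place in the Banach space of curves.
  let Φ : (T × Z) × C(I, Z) → C(I, Z) := fun x =>
    x.2 - constCurve x.1.2 - primitive (N (radialCurve (x.1.1, x.2)))
  have hΦ : ContDiff ℝ ∞ Φ := by
    have h0 : ContDiff ℝ ∞ (fun x : (T × Z) × C(I, Z) => (x.1.1, x.2)) := by fun_prop
    have h1 : ContDiff ℝ ∞ (fun x : (T × Z) × C(I, Z) => radialCurve (x.1.1, x.2)) :=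
      (radialCurve (T := T) (Z := Z)).contDiff.comp h0
    have h2 : ContDiff ℝ ∞ (fun x : (T × Z) × C(I, Z) => constCurve (Z := Z) x.1.2) :=
      (constCurve (Z := Z)).contDiff.comp (contDiff_snd.comp contDiff_fst)
    exact (contDiff_snd.sub h2).sub ((primitive (G := Z)).contDiff.comp (hN.comp h1))
  -- For t = 0 the radial field vanishes, so the derivative of Φ in the curve direction is the
  -- identity and no smallness estimate is needed.
  have hΦ0 : ∀ z (γ : C(I, Z)), Φ ((0, z), γ) = γ - constCurve z := by
    intro z γ
    have : N (radialCurve ((0 : T), γ)) = 0 := by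
      ext r
      simp [N, radialField]
    simp [Φ, this]
  let x₀ : (T × Z) × C(I, Z) := ((0, z₀), constCurve z₀)
  let Φ' := fderiv ℝ Φ x₀
  have hΦ' : HasFDerivAt Φ Φ' x₀ := (hΦ.differentiable (by simp) x₀).hasFDerivAt
  have hinr : ∀ η, Φ' (0, η) = η := by
    have h1 : HasFDerivAt (fun γ : C(I, Z) => (((0 : T), z₀), γ))
        (ContinuousLinearMap.inr ℝ (T × Z) C(I, Z)) (constCurve z₀) :=
      hasFDerivAt_prodMk_right _ _
    have h2 : HasFDerivAt (Φ ∘ fun γ : C(I, Z) => (((0 : T), z₀), γ))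
        (Φ'.comp (ContinuousLinearMap.inr ℝ (T × Z) C(I, Z))) (constCurve z₀) :=
      HasFDerivAt.comp _ hΦ' h1
    have h3 : HasFDerivAt (Φ ∘ fun γ : C(I, Z) => (((0 : T), z₀), γ))
        (ContinuousLinearMap.id ℝ C(I, Z)) (constCurve z₀) := by
      have : (Φ ∘ fun γ : C(I, Z) => (((0 : T), z₀), γ)) = fun γ => γ - constCurve z₀ := by
        funext γ; exact hΦ0 z₀ γ
      rw [this]
      exact (hasFDerivAt_id _).sub_const _
    intro η
    exact congrArg (fun A => A η) (h2.unique h3)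
  have hsplit : ∀ p η, Φ' (p, η) = Φ' (p, 0) + η := by
    intro p η
    rw [← hinr η, ← map_add, hinr]
    simp
  -- The derivative of (p, γ) ↦ (p, Φ(p, γ)) is triangular with identity diagonal, hence explicitly
  -- invertible.
  let L : ((T × Z) × C(I, Z)) ≃L[ℝ] ((T × Z) × C(I, Z)) :=
    ContinuousLinearEquiv.equivOfInverse
      ((ContinuousLinearMap.fst ℝ (T × Z) C(I, Z)).prod Φ')
      ((ContinuousLinearMap.fst ℝ (T × Z) C(I, Z)).prod
        (ContinuousLinearMap.snd ℝ (T × Z) C(I, Z) -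
          Φ'.comp ((ContinuousLinearMap.inl ℝ (T × Z) C(I, Z)).comp
            (ContinuousLinearMap.fst ℝ (T × Z) C(I, Z)))))
      (fun x => by
        obtain ⟨p, η⟩ := x
        simp [hsplit p η])
      (fun x => by
        obtain ⟨p, η⟩ := x
        simp [hsplit p (η - _)])
  let Ψ : (T × Z) × C(I, Z) → (T × Z) × C(I, Z) := fun x => (x.1, Φ x)
  have hΨ : ContDiff ℝ ∞ Ψ := contDiff_fst.prodMk hΦ
  have hΨ' : HasFDerivAt Ψ (L : _ →L[ℝ] _) x₀ := hasFDerivAt_fst.prodMk hΦ'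
  obtain ⟨e, hx₀, -, he, -, hes⟩ := exists_smooth_openPartialHomeomorph isOpen_univ
    hΨ.contDiffOn (Set.mem_univ x₀) hΨ'
  have hcont : Continuous fun p : T × Z => (p, (0 : C(I, Z))) := by fun_prop
  have he0 : e x₀ = ((0, z₀), 0) := by
    rw [he]
    simp [Ψ, x₀, hΦ0]
  refine ⟨(fun p : T × Z => (p, (0 : C(I, Z)))) ⁻¹' e.target, fun p => (e.symm (p, 0)).2,
    e.open_target.preimage hcont, ?_, ?_, ?_, ?_⟩
  · change ((0, z₀), (0 : C(I, Z))) ∈ e.target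
    rw [← he0]; exact e.map_source hx₀
  · exact (hes.comp (contDiff_id.prodMk contDiff_const).contDiffOn fun p hp => hp).snd
  · change (e.symm ((0, z₀), 0)).2 = _
    rw [← he0, e.left_inv hx₀]
  · intro p hp
    have h1 : e (e.symm (p, 0)) = (p, 0) := e.right_inv hp
    rw [he] at h1
    have h2 : (e.symm (p, 0)).1 = p := congrArg Prod.fst h1
    have h3 : Φ (e.symm (p, 0)) = 0 := congrArg Prod.snd h1
    simp only [Φ, h2] at h3
    rw [sub_sub, sub_eq_zero] at h3
    exact h3

/-- Δ is the variation of the solution in the direction τ, and s a(st, Γ)τ is its expected value.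
Integrability exchanges t and τ in the derivative of the latter, so all inhomogeneous terms cancel
and the defect satisfies a homogeneous linear equation. -/
lemma hasDerivAt_radial_defect {a : T × Z → T →L[ℝ] Z} (ha : ContDiff ℝ ∞ a) {t τ : T} {s : ℝ}
    {Γ Δ : ℝ → Z} (hΓ : HasDerivAt Γ (a (s • t, Γ s) t) s)
    (hΔ : HasDerivAt Δ (fderiv ℝ a (s • t, Γ s) (s • τ, Δ s) t + a (s • t, Γ s) τ) s)
    (hint : fderiv ℝ a (s • t, Γ s) (t, a (s • t, Γ s) t) τ =
      fderiv ℝ a (s • t, Γ s) (τ, a (s • t, Γ s) τ) t) :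
    HasDerivAt (fun s => Δ s - s • a (s • t, Γ s) τ)
      (fderiv ℝ a (s • t, Γ s) (0, Δ s - s • a (s • t, Γ s) τ) t) s := by
  have hadiff : HasFDerivAt a (fderiv ℝ a (s • t, Γ s)) (s • t, Γ s) :=
    (ha.differentiable (by simp) _).hasFDerivAt
  have h0 : HasDerivAt (fun s : ℝ => s • t) t s := by
    simpa using (hasDerivAt_id' s).smul_const t
  have h1 : HasDerivAt (fun s : ℝ => (s • t, Γ s)) (t, a (s • t, Γ s) t) s := h0.prodMk hΓ
  have h2 : HasDerivAt (fun s : ℝ => a (s • t, Γ s) τ)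
      (fderiv ℝ a (s • t, Γ s) (t, a (s • t, Γ s) t) τ) s := by
    have h2a : HasDerivAt (fun s : ℝ => a (s • t, Γ s))
      (fderiv ℝ a (s • t, Γ s) (t, a (s • t, Γ s) t)) s := hadiff.comp_hasDerivAt s h1
    have h2b := h2a.clm_apply (hasDerivAt_const s τ)
    rwa [map_zero, add_zero] at h2b
  have h3 := hΔ.sub ((hasDerivAt_id' s).smul h2)
  refine h3.congr_deriv ?_
  have h5 : ((0 : T), Δ s - s • a (s • t, Γ s) τ) =
      (s • τ, Δ s) - s • (τ, a (s • t, Γ s) τ) := by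
    rw [Prod.smul_mk, Prod.mk_sub_mk, sub_self]
  rw [h5, hint]
  generalize fderiv ℝ a (s • t, Γ s) = A
  rw [map_sub, map_smul, sub_apply, smul_apply, one_smul]
  abel

/-- The derivative of a radial solution in the parameter `t`, under the integrability condition. -/
lemma radial_derivative {a : T × Z → T →L[ℝ] Z} (ha : ContDiff ℝ ∞ a) {t τ : T} {z : Z}
    {γ δ : C(I, Z)}
    (hγ : γ = constCurve z + primitive (superposition (radialField a)
        (contDiff_radialField ha).continuous (radialCurve (t, γ))))
    (hδ : δ = primitive (pointwiseApply (superposition (fderiv ℝ (radialField a))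
        ((contDiff_radialField ha).continuous_fderiv (by simp)) (radialCurve (t, γ)))
        (radialCurve (τ, δ))))
    (hint : ∀ r : I, ∀ τ τ' : T, fderiv ℝ a ((r : ℝ) • t, γ r) (τ, a ((r : ℝ) • t, γ r) τ) τ' =
      fderiv ℝ a ((r : ℝ) • t, γ r) (τ', a ((r : ℝ) • t, γ r) τ') τ) :
    δ 1 = a (t, γ 1) τ := by
  have hG := contDiff_radialField ha
  -- Extending the integrands constantly beyond [0, 1] makes Γ and Δ differentiable on all of ℝ,
  -- with two-sided derivatives at the endpoints.
  let π : ℝ → I := Set.projIcc 0 1 zero_le_one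
  let c : C(I, Z) := superposition (radialField a) hG.continuous (radialCurve (t, γ))
  let d : C(I, Z) := pointwiseApply (superposition (fderiv ℝ (radialField a))
        (hG.continuous_fderiv (by simp)) (radialCurve (t, γ))) (radialCurve (τ, δ))
  let Γ : ℝ → Z := fun s => z + ∫ r in (0 : ℝ)..s, c (π r)
  let Δ : ℝ → Z := fun s => ∫ r in (0 : ℝ)..s, d (π r)
  have hπc : Continuous π := continuous_projIcc
  have hΓ' : ∀ s, HasDerivAt Γ (c (π s)) s := fun s =>
    ((c.continuous.comp hπc).integral_hasStrictDerivAt 0 s).hasDerivAt.const_add z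
  have hΔ' : ∀ s, HasDerivAt Δ (d (π s)) s := fun s =>
    ((d.continuous.comp hπc).integral_hasStrictDerivAt 0 s).hasDerivAt
  have hΓγ : ∀ s : I, Γ s = γ s := fun s => by
    conv_rhs => rw [hγ]
    rfl
  have hΔδ : ∀ s : I, Δ s = δ s := fun s => by
    conv_rhs => rw [hδ]
    rfl
  let w : ℝ → Z := fun s => Δ s - s • a (s • t, Γ s) τ
  have hw : ∀ s ∈ Set.Ico (0 : ℝ) 1, HasDerivAt w (fderiv ℝ a (s • t, Γ s) (0, w s) t) s := by
    intro s hs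
    have hsI : s ∈ Set.Icc (0 : ℝ) 1 := ⟨hs.1, hs.2.le⟩
    have hπs : π s = ⟨s, hsI⟩ := Set.projIcc_of_mem _ hsI
    have hγs : γ (π s) = Γ s := by rw [hπs]; exact (hΓγ ⟨s, hsI⟩).symm
    have hδs : δ (π s) = Δ s := by rw [hπs]; exact (hΔδ ⟨s, hsI⟩).symm
    have hcs : c (π s) = a (s • t, Γ s) t := by
      change a ((π s : ℝ) • t, γ (π s)) t = _
      rw [hγs, hπs]
    have hds : d (π s) = fderiv ℝ a (s • t, Γ s) (s • τ, Δ s) t + a (s • t, Γ s) τ := by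
      change fderiv ℝ (radialField a) ((π s : ℝ) • t, γ (π s), t) ((π s : ℝ) • τ, δ (π s), τ) = _
      rw [fderiv_radialField ha, hγs, hδs, hπs]
    have hi := hint ⟨s, hsI⟩ t τ
    rw [← hΓγ ⟨s, hsI⟩] at hi
    exact hasDerivAt_radial_defect ha (hcs ▸ hΓ' s) (hds ▸ hΔ' s) hi
  have hB : Continuous fun s : ℝ => fderiv ℝ a (s • t, Γ s) := by
    have hΓc : Continuous Γ := continuous_iff_continuousAt.2 fun s => (hΓ' s).continuousAt
    exact (ha.continuous_fderiv (by simp)).comp (by fun_prop)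
  obtain ⟨K, hK⟩ := (isCompact_Icc (a := (0 : ℝ)) (b := 1)).exists_bound_of_continuousOn
    (f := fun s : ℝ => fderiv ℝ a (s • t, Γ s)) hB.continuousOn
  have hΔc : Continuous Δ := continuous_iff_continuousAt.2 fun s => (hΔ' s).continuousAt
  have hΓc : Continuous Γ := continuous_iff_continuousAt.2 fun s => (hΓ' s).continuousAt
  have hac : Continuous a := ha.continuous
  have hwc : Continuous w := by fun_prop
  have hw0 : w 0 = 0 := by simp [w, Δ]
  -- The defect starts at 0 and solves a homogeneous linear equation with bounded coefficients, so
  -- Grönwall's inequality makes it vanish; its value at s = 1 is the claim.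
  have hgron := norm_le_gronwallBound_of_norm_deriv_right_le (f := w)
    (f' := fun s => fderiv ℝ a (s • t, Γ s) (0, w s) t) (δ := 0) (K := K * ‖t‖) (ε := 0) (a := 0)
    (b := 1) hwc.continuousOn (fun s hs => (hw s hs).hasDerivWithinAt) (by simp [hw0])
    (fun s hs => by
      have h1 := hK s ⟨hs.1, hs.2.le⟩
      have h2 : ‖((0 : T), w s)‖ = ‖w s‖ := by simp [Prod.norm_def]
      calc ‖fderiv ℝ a (s • t, Γ s) (0, w s) t‖
          ≤ ‖fderiv ℝ a (s • t, Γ s) (0, w s)‖ * ‖t‖ := ContinuousLinearMap.le_opNorm _ _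
        _ ≤ (‖fderiv ℝ a (s • t, Γ s)‖ * ‖((0 : T), w s)‖) * ‖t‖ := by
          gcongr; exact ContinuousLinearMap.le_opNorm _ _
        _ ≤ (K * ‖w s‖) * ‖t‖ := by rw [h2]; gcongr
        _ = K * ‖t‖ * ‖w s‖ + 0 := by ring)
    1 (Set.right_mem_Icc.2 zero_le_one)
  rw [gronwallBound_ε0, zero_mul] at hgron
  have hw1 : w 1 = 0 := norm_le_zero_iff.1 hgron
  have h1 := hΔδ 1
  have h2 := hΓγ 1
  simp only [w, one_smul] at hw1
  rw [sub_eq_zero] at hw1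
  simp only [Set.Icc.coe_one] at h1 h2
  rw [← h1, hw1, h2]

/-- **Frobenius theorem**: if `a` satisfies the integrability condition, then the plane field
spanned by the vectors `(τ, a τ)` is straightened by a local diffeomorphism over `T`. -/
theorem exists_frobenius_straightening {a : T × Z → T →L[ℝ] Z} {U : Set (T × Z)} (hU : IsOpen U)
    (ha : ContDiffOn ℝ ∞ a U) {z₀ : Z} (h0 : ((0 : T), z₀) ∈ U)
    (hint : ∀ p ∈ U, ∀ τ τ' : T, fderiv ℝ a p (τ, a p τ) τ' = fderiv ℝ a p (τ', a p τ') τ) :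
    ∃ e : OpenPartialHomeomorph (T × Z) (T × Z), ((0 : T), z₀) ∈ e.source ∧ e (0, z₀) = (0, z₀) ∧
      e.target ⊆ U ∧ ContDiffOn ℝ ∞ e e.source ∧ ContDiffOn ℝ ∞ e.symm e.target ∧
      (∀ p ∈ e.source, (e p).1 = p.1) ∧
      ∀ p ∈ e.source, ∀ τ, fderiv ℝ e p (τ, 0) = (τ, a (e p) τ) := by
  -- The superposition operator needs a globally defined field, so a is replaced by a smooth b that
  -- agrees with it on a ball.
  obtain ⟨b, hb, ε, hε, hεU, hba⟩ := exists_contDiff_eqOn hU ha h0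
  obtain ⟨O, γ, hO, hO0, hγs, hγ0, hγ⟩ := exists_radial_solution hb z₀
  -- For parameters in V the whole curve (r t, γ(r)) stays in the ball where b = a, so that the
  -- integrability condition is available along it.
  let V : Set (T × Z) := O ∩ (fun p : T × Z => (p.1, γ p)) ⁻¹'
    (Metric.ball 0 ε ×ˢ Metric.ball (constCurve z₀) ε)
  have hV : IsOpen V := (continuousOn_fst.prodMk hγs.continuousOn).isOpen_inter_preimage hO
    (Metric.isOpen_ball.prod Metric.isOpen_ball)
  have hV0 : ((0 : T), z₀) ∈ V := ⟨hO0, by simp [hε], by simp [hγ0, hε]⟩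
  have hVball : ∀ p ∈ V, ∀ r : I, ((r : ℝ) • p.1, γ p r) ∈ Metric.ball ((0 : T), z₀) ε := by
    rintro p ⟨-, hp1, hp2⟩ r
    rw [← ball_prod_same]
    refine ⟨?_, ?_⟩
    · rw [mem_ball_zero_iff] at hp1 ⊢
      refine lt_of_le_of_lt ?_ hp1
      rw [norm_smul, Real.norm_of_nonneg r.2.1]
      exact mul_le_of_le_one_left (norm_nonneg _) r.2.2
    · rw [mem_ball_iff_norm] at hp2 ⊢
      exact lt_of_le_of_lt ((γ p - constCurve z₀).norm_coe_le_norm r) hp2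
  let u : T × Z → Z := fun p => γ p 1
  have hus : ContDiffOn ℝ ∞ u V :=
    ((ContinuousMap.evalCLM ℝ (1 : I) : C(I, Z) →L[ℝ] Z).contDiff.comp_contDiffOn hγs).mono Set.inter_subset_left
  have hudiff : ∀ p ∈ V, DifferentiableAt ℝ u p := fun p hp =>
    (hus.contDiffAt (hV.mem_nhds hp)).differentiableAt (by simp)
  have hut : ∀ p ∈ V, ∀ τ, fderiv ℝ u p (τ, 0) = b (p.1, u p) τ := by
    intro p hp τ
    have hγd : HasFDerivAt γ (fderiv ℝ γ p) p :=
      ((hγs.contDiffAt (hO.mem_nhds hp.1)).differentiableAt (by simp)).hasFDerivAt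
    have hG := contDiff_radialField hb
    have h1 : HasFDerivAt (fun p : T × Z => radialCurve (p.1, γ p))
        ((radialCurve (T := T) (Z := Z)).comp
          ((ContinuousLinearMap.fst ℝ T Z).prod (fderiv ℝ γ p))) p :=
      (radialCurve (T := T) (Z := Z)).hasFDerivAt.comp p (hasFDerivAt_fst.prodMk hγd)
    have h2 := (primitive (G := Z)).hasFDerivAt.comp p
      ((hasFDerivAt_superposition (hG.of_le (by simp)) (radialCurve (p.1, γ p))).comp p h1)
    have h3 := ((constCurve (Z := Z)).hasFDerivAt.comp p hasFDerivAt_snd).add h2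
    -- Differentiating the fixed point equation for γ in the direction (τ, 0) gives the linearised
    -- integral equation required by `radial_derivative`.
    have h4 := hγd.congr_of_eventuallyEq (f₁ := fun p : T × Z => constCurve p.2 + primitive
        (superposition (radialField b) hG.continuous (radialCurve (p.1, γ p)))) (by
      filter_upwards [hO.mem_nhds hp.1] with q hq
      exact (hγ q hq).symm)
    have h5 := congrArg (fun A => A (τ, 0)) (h4.unique h3)
    have h6 : fderiv ℝ γ p (τ, 0) = primitive (pointwiseApply (superposition
        (fderiv ℝ (radialField b)) (hG.continuous_fderiv (by simp)) (radialCurve (p.1, γ p)))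
        (radialCurve (τ, fderiv ℝ γ p (τ, 0)))) := by
      simpa using h5
    have h7 := radial_derivative hb (hγ p hp.1) h6 (by
      intro r ν τ''
      have hr := hVball p hp r
      have hev : b =ᶠ[𝓝 ((r : ℝ) • p.1, γ p r)] a := by
        filter_upwards [Metric.isOpen_ball.mem_nhds hr] with q hq using hba q hq
      rw [hev.fderiv_eq, hev.self_of_nhds]
      exact hint _ (hεU hr) ν τ'')
    have h8 : HasFDerivAt u ((ContinuousMap.evalCLM ℝ (1 : I) : C(I, Z) →L[ℝ] Z).comp (fderiv ℝ γ p)) p :=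
      (ContinuousMap.evalCLM ℝ (1 : I) : C(I, Z) →L[ℝ] Z).hasFDerivAt.comp p hγd
    rw [h8.fderiv]
    exact h7
  -- For t = 0 the curve is constant, so u(0, ·) is the identity. This makes the derivative of (t,
  -- z) ↦ (t, u(t, z)) at (0, z₀) invertible.
  have hu0 : ∀ z, ((0 : T), z) ∈ O → u (0, z) = z := by
    intro z hz
    change γ (0, z) 1 = z
    rw [hγ _ hz]
    have : superposition (radialField b) (contDiff_radialField hb).continuous
        (radialCurve ((0 : T), γ (0, z))) = 0 := by
      ext r
      simp [radialField]
    simp [this]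
  have huz : ∀ ζ, fderiv ℝ u (0, z₀) (0, ζ) = ζ := by
    have h1 : HasFDerivAt (fun z : Z => ((0 : T), z)) (ContinuousLinearMap.inr ℝ T Z) z₀ :=
      hasFDerivAt_prodMk_right _ _
    have h2 : HasFDerivAt (u ∘ fun z : Z => ((0 : T), z))
        ((fderiv ℝ u (0, z₀)).comp (ContinuousLinearMap.inr ℝ T Z)) z₀ :=
      HasFDerivAt.comp z₀ (hudiff _ hV0).hasFDerivAt h1
    have h3 : HasFDerivAt (u ∘ fun z : Z => ((0 : T), z)) (ContinuousLinearMap.id ℝ Z) z₀ := by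
      refine (hasFDerivAt_id z₀).congr_of_eventuallyEq ?_
      have hc : Continuous fun z : Z => ((0 : T), z) := by fun_prop
      filter_upwards [(hO.preimage hc).mem_nhds hO0] with z hz
      exact hu0 z hz
    intro ζ
    exact congrArg (fun A => A ζ) (h2.unique h3)
  let D := fderiv ℝ u (0, z₀)
  have hsplit : ∀ τ ζ, D (τ, ζ) = D (τ, 0) + ζ := by
    intro τ ζ
    rw [← huz ζ, ← map_add, huz]
    simp
  let L : (T × Z) ≃L[ℝ] (T × Z) :=
    ContinuousLinearEquiv.equivOfInverse
      ((ContinuousLinearMap.fst ℝ T Z).prod D)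
      ((ContinuousLinearMap.fst ℝ T Z).prod (ContinuousLinearMap.snd ℝ T Z -
          D.comp ((ContinuousLinearMap.inl ℝ T Z).comp (ContinuousLinearMap.fst ℝ T Z))))
      (fun x => by
        obtain ⟨p, η⟩ := x
        simp [hsplit p η])
      (fun x => by
        obtain ⟨p, η⟩ := x
        simp [hsplit p (η - _)])
  have hΘ : ContDiffOn ℝ ∞ (fun p : T × Z => (p.1, u p)) V := contDiffOn_fst.prodMk hus
  have hΘ' : HasFDerivAt (fun p : T × Z => (p.1, u p)) (L : (T × Z) →L[ℝ] (T × Z)) (0, z₀) :=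
    hasFDerivAt_fst.prodMk (hudiff _ hV0).hasFDerivAt
  obtain ⟨e, he0, heV, he, hes, hes'⟩ := exists_smooth_openPartialHomeomorph hV hΘ hV0 hΘ'
  have hmem : ∀ p ∈ V, (p.1, u p) ∈ Metric.ball ((0 : T), z₀) ε := by
    intro p hp
    simpa using hVball p hp 1
  refine ⟨e, he0, ?_, ?_, hes, hes', ?_, ?_⟩
  · rw [he]
    simp [u, hγ0]
  · intro q hq
    rw [← e.right_inv hq, he]
    exact hεU (hmem _ (heV (e.map_target hq)))
  · intro p _
    rw [he]
  · intro p hp τ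
    have h1 : HasFDerivAt (fun p : T × Z => (p.1, u p))
      ((ContinuousLinearMap.fst ℝ T Z).prod (fderiv ℝ u p)) p :=
      hasFDerivAt_fst.prodMk (hudiff p (heV hp)).hasFDerivAt
    rw [he, h1.fderiv]
    change (τ, fderiv ℝ u p (τ, 0)) = _
    rw [hut p (heV hp), hba _ (hmem p (heV hp))]

end Frobenius

/-! ### Primitives in a fixed direction -/

section Primitive

open unitInterval

/-- A smooth function has, locally, a smooth primitive in the direction of a given vector. -/
theorem exists_directional_primitive {E : Type} [NormedAddCommGroup E] [NormedSpace ℝ E]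
    [FiniteDimensional ℝ E] {k : E → ℝ} {U : Set E} (hU : IsOpen U) (hk : ContDiffOn ℝ ∞ k U)
    {x₀ : E} (hx₀ : x₀ ∈ U) {ℓ : E →L[ℝ] ℝ} {v : E} (hv : ℓ v = 1) :
    ∃ (w : E → ℝ) (V : Set E), IsOpen V ∧ x₀ ∈ V ∧ V ⊆ U ∧ ContDiff ℝ ∞ w ∧
      ∀ x ∈ V, fderiv ℝ w x v = k x := by
  obtain ⟨g, hg, ε, hε, hεU, hgk⟩ := exists_contDiff_eqOn hU hk hx₀
  -- The segment from x - ℓ(x) v, the projection of x to the kernel of ℓ along v, up to x. It is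
  -- linear in x, so w below is a composition of smooth maps.
  let Q : E →L[ℝ] C(I, E) := LinearMap.toContinuousLinearMap
    { toFun := fun x => ⟨fun r => x + ((r : ℝ) - 1) • ℓ x • v, by fun_prop⟩
      map_add' := fun x y => by ext r; simp [add_smul]; abel
      map_smul' := fun c x => by ext r; simp [smul_smul]; ring_nf }
  let w : E → ℝ := fun x => ℓ x * primitive (superposition g hg.continuous (Q x)) 1
  have hw : ContDiff ℝ ∞ w := by
    refine ℓ.contDiff.mul ((ContinuousMap.evalCLM ℝ (1 : I) : C(I, ℝ) →L[ℝ] ℝ).contDiff.comp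
      ((primitive (G := ℝ)).contDiff.comp ((contDiff_superposition hg).comp Q.contDiff)))
  refine ⟨w, Metric.ball x₀ ε, Metric.isOpen_ball, by simp [hε], hεU, hw, fun x hx => ?_⟩
  -- After substituting ν = ℓ(y) r the integrand depends only on the projection of y, which is
  -- constant along v; moving y along v changes only the upper limit.
  have hform : ∀ y, w y = ∫ ν in (0 : ℝ)..ℓ y, g (y - ℓ y • v + ν • v) := by
    intro y
    have h1 : primitive (superposition g hg.continuous (Q y)) 1 =
        ∫ r in (0 : ℝ)..1, g (y - ℓ y • v + (ℓ y * r) • v) := by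
      rw [primitive_apply, Set.Icc.coe_one]
      refine intervalIntegral.integral_congr fun r hr => ?_
      rw [Set.uIcc_of_le zero_le_one] at hr
      simp only [superposition_apply]
      rw [Set.projIcc_of_mem _ hr]
      change g (y + (r - 1) • ℓ y • v) = _
      congr 1
      module
    have h2 := intervalIntegral.mul_integral_comp_mul_left (a := 0) (b := 1)
      (f := fun ν => g (y - ℓ y • v + ν • v)) (c := ℓ y)
    simp only [w, h1, h2, mul_zero, mul_one]
  have h1 : ∀ s : ℝ, w (x + s • v) = ∫ ν in (0 : ℝ)..(ℓ x + s), g (x - ℓ x • v + ν • v) := by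
    intro s
    rw [hform]
    have : ℓ (x + s • v) = ℓ x + s := by simp [hv]
    rw [this]
    congr 1
    funext ν
    congr 1
    module
  have h2 : HasDerivAt (fun s : ℝ => w (x + s • v)) (g x) 0 := by
    simp only [h1]
    have hgc := hg.continuous
    have hc : Continuous fun ν : ℝ => g (x - ℓ x • v + ν • v) := by fun_prop
    have h3 := (hc.integral_hasStrictDerivAt 0 (ℓ x + 0)).hasDerivAt
    have h4 := HasDerivAt.comp (0 : ℝ) h3 ((hasDerivAt_id' (0 : ℝ)).const_add (ℓ x))
    simpa [Function.comp_def] using h4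
  have h5 : HasDerivAt (fun s : ℝ => w (x + s • v)) (fderiv ℝ w x v) 0 := by
    have h6 : HasDerivAt (fun s : ℝ => x + s • v) v 0 := by
      simpa using ((hasDerivAt_id' (0 : ℝ)).smul_const v).const_add x
    have h7 : HasFDerivAt w (fderiv ℝ w x) (x + (0 : ℝ) • v) := by
      simpa using (hw.differentiable (by simp) x).hasFDerivAt
    exact h7.comp_hasDerivAt 0 h6
  rw [h5.unique h2, hgk x hx]

end Primitive

/-! ### Determinants of derivations and the Fundamental Identity -/

section Determinants

variable {A : Type*} [CommRing A] [Algebra ℝ A] {ι : Type*} [Fintype ι] [DecidableEq ι]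

lemma derivation_prod (D : Derivation ℝ A A) (s : Finset ι) (f : ι → A) :
    D (∏ i ∈ s, f i) = ∑ k ∈ s, ∏ i ∈ s, Function.update f k (D (f k)) i := by
  induction s using Finset.induction_on with
  | empty => simp
  | insert a s ha ih =>
    rw [Finset.prod_insert ha, D.leibniz, ih, Finset.sum_insert ha, Finset.prod_insert ha,
      Function.update_self, smul_eq_mul, smul_eq_mul, Finset.mul_sum, add_comm]
    congr 1
    · rw [mul_comm]
      congr 1
      refine Finset.prod_congr rfl fun i hi => ?_
      rw [Function.update_of_ne]
      rintro rfl
      exact ha hi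
    · refine Finset.sum_congr rfl fun k hk => ?_
      rw [Finset.prod_insert ha, Function.update_of_ne]
      rintro rfl
      exact ha hk

lemma derivation_det (D : Derivation ℝ A A) (N : Matrix ι ι A) :
    D N.det = ∑ k, (N.updateRow k fun j => D (N k j)).det := by
  have h : ∀ N : Matrix ι ι A, N.det = ∑ σ : Equiv.Perm ι, (Equiv.Perm.sign σ : ℤ) •
      ∏ i, N i (σ i) := by
    intro N
    rw [← Matrix.det_transpose, Matrix.det_apply]
    rfl
  rw [h N, map_sum]
  simp only [h (Matrix.updateRow _ _ _)]
  rw [Finset.sum_comm]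
  refine Finset.sum_congr rfl fun σ _ => ?_
  rw [map_zsmul, derivation_prod, Finset.smul_sum]
  refine Finset.sum_congr rfl fun k _ => ?_
  congr 1
  refine Finset.prod_congr rfl fun i _ => ?_
  by_cases hi : i = k
  · subst hi
    simp
  · rw [Function.update_of_ne hi, Matrix.updateRow_ne hi]

lemma det_updateRow_eq_sum (N : Matrix ι ι A) (k : ι) (v : ι → A) :
    (N.updateRow k v).det = ∑ j, v j * (N.updateRow k (Pi.single j 1)).det := by
  have h : v = ∑ j, v j • (Pi.single j (1 : A) : ι → A) := by
    funext i
    simp [Pi.single_apply]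
  conv_lhs => rw [h]
  have := (Matrix.detRowAlternating (R := A) (n := ι)).toMultilinearMap.map_update_sum
    Finset.univ k (fun j => v j • (Pi.single j (1 : A) : ι → A)) N
  refine Eq.trans this (Finset.sum_congr rfl fun j _ => ?_)
  exact Matrix.det_updateRow_smul N k (v j) _

/-- Expanding along the new rows, with adjugate entries as coefficients, gives tr(N B adj N);
cyclicity of the trace and adj(N) N = det N finish. -/
lemma sum_det_updateRow_mul (N B : Matrix ι ι A) :
    ∑ k, (N.updateRow k ((N * B) k)).det = B.trace * N.det := by
  have h : ∑ k, (N.updateRow k ((N * B) k)).det = (N * B * N.adjugate).trace := by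
    simp only [Matrix.trace, Matrix.diag, Matrix.mul_apply (M := N * B)]
    refine Finset.sum_congr rfl fun k _ => ?_
    rw [det_updateRow_eq_sum]
    refine Finset.sum_congr rfl fun j _ => ?_
    rw [Matrix.adjugate_apply]
  rw [h, Matrix.mul_assoc, Matrix.trace_mul_comm, Matrix.mul_assoc, Matrix.adjugate_mul,
    Matrix.mul_smul, Matrix.mul_one, Matrix.trace_smul, smul_eq_mul, mul_comm]

lemma det_updateRow_swap (N : Matrix ι ι A) {k l : ι} (hkl : k ≠ l) (u v : ι → A) :
    ((N.updateRow l u).updateRow k v).det = - ((N.updateRow l v).updateRow k u).det := by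
  have := (Matrix.detRowAlternating (R := A) (n := ι)).map_swap
    ((N.updateRow l v).updateRow k u) hkl
  change Matrix.det _ = - Matrix.det _ at this
  rw [← this]
  congr 1
  funext i
  change _ = ((N.updateRow l v).updateRow k u) (Equiv.swap k l i)
  by_cases h1 : i = k
  · subst h1
    rw [Equiv.swap_apply_left, Matrix.updateRow_self, Matrix.updateRow_ne hkl.symm,
      Matrix.updateRow_self]
  · by_cases h2 : i = l
    · subst h2
      rw [Equiv.swap_apply_right, Matrix.updateRow_self, Matrix.updateRow_ne h1,
        Matrix.updateRow_self]
    · rw [Equiv.swap_apply_of_ne_of_ne h1 h2, Matrix.updateRow_ne h1, Matrix.updateRow_ne h1,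
        Matrix.updateRow_ne h2, Matrix.updateRow_ne h2]

/-- Symmetric coefficients meet determinants that are antisymmetric in the two unit rows, so the
terms (i, j) and (j, i) cancel. -/
lemma sum_symm_mul_det_updateRow (N : Matrix ι ι A) {k l : ι} (hkl : k ≠ l) (a : ι → ι → A)
    (ha : ∀ i j, a i j = a j i) :
    ∑ i, ((N.updateRow l (Pi.single i 1)).updateRow k (a i)).det = 0 := by
  have h : ∀ i, ((N.updateRow l (Pi.single i 1)).updateRow k (a i)).det =
      ∑ j, a i j * ((N.updateRow l (Pi.single i 1)).updateRow k (Pi.single j 1)).det :=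
    fun i => det_updateRow_eq_sum _ _ _
  simp only [h]
  rw [← Finset.sum_product']
  refine Finset.sum_involution (fun q _ => (q.2, q.1)) ?_ ?_ ?_ ?_
  · rintro ⟨i, j⟩ _
    simp only
    rw [det_updateRow_swap N hkl, ha i j]
    ring
  · rintro ⟨i, j⟩ _ hne heq
    apply hne
    simp only [Prod.mk.injEq] at heq
    rw [heq.1]
    have := Matrix.det_zero_of_row_eq (M := (N.updateRow l (Pi.single i 1)).updateRow k
      (Pi.single i (1 : A))) hkl (by simp [Matrix.updateRow_ne hkl.symm])
    simp [this]
  · rintro _ _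
    exact Finset.mem_univ _
  · rintro _ _
    rfl

lemma det_updateRow_one (i : ι) (v : ι → A) : ((1 : Matrix ι ι A).updateRow i v).det = v i := by
  rw [det_updateRow_eq_sum, Finset.sum_eq_single i]
  · have : (1 : Matrix ι ι A).updateRow i (Pi.single i 1) = 1 := by
      conv_rhs => rw [← Matrix.updateRow_eq_self (1 : Matrix ι ι A) i]
      congr 1
      funext j
      simp [Matrix.one_apply, Pi.single_apply, eq_comm]
    rw [this]
    simp
  · intro j _ hj
    rw [Matrix.det_zero_of_row_eq (i := i) (j := j) hj.symm, mul_zero]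
    funext l
    simp [Matrix.updateRow_ne hj, Matrix.one_apply, Pi.single_apply, eq_comm]
  · simp

lemma det_updateRow_updateRow_one {i j : ι} (hij : i ≠ j) (a b : ι → A) :
    (((1 : Matrix ι ι A).updateRow j a).updateRow i b).det = a j * b i - a i * b j := by
  have hone : ∀ i : ι, (1 : Matrix ι ι A).updateRow i (Pi.single i 1) = 1 := by
    intro i
    conv_rhs => rw [← Matrix.updateRow_eq_self (1 : Matrix ι ι A) i]
    congr 1
    funext j
    simp [Matrix.one_apply, Pi.single_apply, eq_comm]
  rw [det_updateRow_eq_sum, Fintype.sum_eq_add i j hij]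
  · rw [Matrix.updateRow_comm _ hij.symm, hone, det_updateRow_one, det_updateRow_swap _ hij, hone,
      det_updateRow_one]
    ring
  · rintro l ⟨hli, hlj⟩
    rw [Matrix.det_zero_of_row_eq (i := i) (j := l) hli.symm, mul_zero]
    funext q
    simp [Matrix.updateRow_ne hli, Matrix.updateRow_ne hlj, Matrix.one_apply, Pi.single_apply,
      eq_comm]

/-- The bracket `h det (D_j f_i)` defined by a family of derivations `D`. -/
def detBracket (D : ι → Derivation ℝ A A) (h : A) (f : ι → A) : A :=
  h * (Matrix.of fun i j => D j (f i)).det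

lemma of_update (D : ι → Derivation ℝ A A) (g : ι → A) (k : ι) (u : A) :
    (Matrix.of fun i j => D j (Function.update g k u i)) =
      (Matrix.of fun i j => D j (g i)).updateRow k (fun j => D j u) := by
  ext i j
  by_cases hi : i = k
  · subst hi
    simp
  · simp [hi]

/-- The brackets defined by commuting derivations satisfy the Fundamental Identity. -/
theorem detBracket_fundamental (D : ι → Derivation ℝ A A)
    (hD : ∀ i j u, D i (D j u) = D j (D i u)) (h : A) (l : ι) (F g : ι → A) :
    detBracket D h (Function.update F l (detBracket D h g)) =
      ∑ k, detBracket D h (Function.update g k (detBracket D h (Function.update F l (g k)))) := by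
  set N : Matrix ι ι A := Matrix.of fun i j => D j (F i) with hN
  set C : ι → A := fun j => (N.updateRow l (Pi.single j 1)).det with hC
  -- As a function of its slot l, the bracket is the derivation X = ∑ h C_j D_j whose coefficients
  -- C_j are cofactors of N.
  have hX : ∀ u, detBracket D h (Function.update F l u) = ∑ j, (h * C j) * D j u := by
    intro u
    rw [detBracket, of_update, det_updateRow_eq_sum, Finset.mul_sum]
    refine Finset.sum_congr rfl fun j _ => ?_
    rw [hC]
    ring
  set X : Derivation ℝ A A := ∑ j, (h * C j) • D j with hXdef
  have hXsum : ∀ u, X u = ∑ j, (h * C j) * D j u := by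
    intro u
    have := congrFun (map_sum (Derivation.coeFnAddMonoidHom (R := ℝ) (A := A) (M := A))
      (fun j => (h * C j) • D j) Finset.univ) u
    rw [Finset.sum_apply] at this
    exact this
  have hX' : ∀ u, detBracket D h (Function.update F l u) = X u := by
    intro u
    rw [hX, hXsum]
  -- The Piola identity: differentiating a row other than l produces second derivatives D_i D_j,
  -- symmetric in i and j, while row l is constant.
  have piola : ∑ j, D j (C j) = 0 := by
    simp only [hC, derivation_det]
    rw [Finset.sum_comm]
    refine Finset.sum_eq_zero fun k _ => ?_
    by_cases hk : k = l
    · subst hk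
      refine Finset.sum_eq_zero fun j _ => ?_
      rw [Matrix.updateRow_idem]
      refine Matrix.det_eq_zero_of_row_eq_zero k fun i => ?_
      simp only [Matrix.updateRow_self, Pi.single_apply]
      split_ifs <;> simp
    · have := sum_symm_mul_det_updateRow N hk (fun i j => D i (D j (F k)))
        (fun i j => hD i j _)
      refine Eq.trans (Finset.sum_congr rfl fun j _ => ?_) this
      congr 2
      funext i
      rw [Matrix.updateRow_ne hk]
      rfl
  set G : Matrix ι ι A := Matrix.of fun i j => D j (g i) with hG
  set B : Matrix ι ι A := Matrix.of fun i j => D j (h * C i) with hB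
  -- Commutation of the D_j lets X pass through D_j, up to the term in which D_j hits the
  -- coefficients of X, collected in the matrix B.
  have hrow : ∀ k, (fun j => D j (X (g k))) = (fun j => X (G k j)) + (G * B) k := by
    intro k
    funext j
    rw [Pi.add_apply, Matrix.mul_apply, hXsum, hXsum]
    simp only [map_sum, smul_eq_mul, Derivation.leibniz, hG, hB, Matrix.of_apply]
    rw [← Finset.sum_add_distrib]
    refine Finset.sum_congr rfl fun i _ => ?_
    rw [hD j i]
  have hdet : ∀ k, detBracket D h (Function.update g k (X (g k))) =
      h * (G.updateRow k fun j => X (G k j)).det + h * (G.updateRow k ((G * B) k)).det := by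
    intro k
    rw [detBracket, of_update, hrow k, Matrix.det_updateRow_add, mul_add]
  simp only [hX', hdet]
  rw [Finset.sum_add_distrib, ← Finset.mul_sum, ← Finset.mul_sum, ← derivation_det,
    sum_det_updateRow_mul, detBracket, X.leibniz]
  -- By the Piola identity, only derivatives of h survive in the trace of B. The right side thus
  -- becomes h X(det G) + X(h) det G, the Leibniz rule for X on the bracket of g.
  have hdiv : h * B.trace = X h := by
    rw [hXsum]
    simp only [Matrix.trace, Matrix.diag, hB, Matrix.of_apply, Derivation.leibniz, smul_eq_mul]
    rw [Finset.sum_add_distrib, ← Finset.mul_sum, piola, mul_zero, zero_add, Finset.mul_sum]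
    exact Finset.sum_congr rfl fun j _ => by ring
  rw [smul_eq_mul, smul_eq_mul, ← mul_assoc h, hdiv]
  ring

/-- The derivations defining a bracket that satisfies the Fundamental Identity commute, if they
are dual to the differentials of some elements. -/
theorem commute_of_fundamental (D : ι → Derivation ℝ A A) (h : A) (l : ι)
    (hFI : ∀ F g : ι → A, detBracket D h (Function.update F l (detBracket D h g)) =
      ∑ k, detBracket D h (Function.update g k (detBracket D h (Function.update F l (g k)))))
    (y : ι → A) (hy : ∀ i j, D i (y j) = if i = j then 1 else 0) (i j : ι) (w : A) :
    h * h * (D i (D j w) - D j (D i w)) = 0 := by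
  by_cases hij : i = j
  · subst hij
    simp
  have hone : (Matrix.of fun a b => D b (y a)) = (1 : Matrix ι ι A) := by
    ext a b
    simp [hy, Matrix.one_apply, eq_comm]
  have hupd : ∀ a u, detBracket D h (Function.update y a u) = h * D a u := by
    intro a u
    rw [detBracket, of_update, hone, det_updateRow_one]
  -- The identity has its free slot at l, while slot i is wanted. A transposition exchanges them at
  -- the cost of a sign s with s² = 1; s is 1 when i = l.
  set s : A := ((Equiv.Perm.sign (Equiv.swap i l) : ℤ) : A) with hs
  have hperm : ∀ (f : ι → A), detBracket D h (f ∘ Equiv.swap i l) = s * detBracket D h f := by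
    intro f
    have := Matrix.det_permute (Equiv.swap i l) (Matrix.of fun a b => D b (f a))
    rw [detBracket, detBracket, mul_left_comm, hs, ← this]
    rfl
  have hX : ∀ u, detBracket D h (Function.update (y ∘ Equiv.swap i l) l u) = s * (h * D i u) := by
    intro u
    rw [← hupd, ← hperm]
    congr 1
    funext a
    by_cases ha : a = l
    · subst ha
      simp
    · rw [Function.update_of_ne ha]
      simp only [Function.comp_apply]
      rw [Function.update_of_ne]
      intro h'
      rw [Equiv.swap_apply_eq_iff, Equiv.swap_apply_left] at h'
      exact ha h'
  have hs2 : s * s = 1 := by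
    rcases Int.units_eq_one_or (Equiv.Perm.sign (Equiv.swap i l)) with h' | h' <;> simp [hs, h']
  have hDs : ∀ b u, D b (s * u) = s * D b u := by
    intro b u
    rw [hs, ← zsmul_eq_mul, map_zsmul, zsmul_eq_mul]
  have hlin : ∀ (g : ι → A) k u, detBracket D h (Function.update g k (s * u)) =
      s * detBracket D h (Function.update g k u) := by
    intro g k u
    have h1 : (fun b => D b (s * u)) = s • fun b => D b u := by
      funext b
      simp [hDs]
    rw [detBracket, detBracket, of_update, of_update, h1, Matrix.det_updateRow_smul]
    ring
  have hFI' : ∀ g : ι → A, h * D i (detBracket D h g) =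
      ∑ k, detBracket D h (Function.update g k (h * D i (g k))) := by
    intro g
    have := hFI (y ∘ Equiv.swap i l) g
    simp only [hX, hlin] at this
    rw [← Finset.mul_sum] at this
    have h2 := congrArg (fun t => s * t) this
    simpa only [← mul_assoc, hs2, one_mul] using h2
  -- With w in slot j, every k other than i and j contributes a zero row, since D_i y_k = 0. In the
  -- two remaining terms the derivatives of h cancel, and h² times the commutator is left.
  have key := hFI' (Function.update y j w)
  rw [hupd, Fintype.sum_eq_add i j hij] at key
  · rw [Function.update_self, Function.update_idem, hupd, Function.update_of_ne hij, hy,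
      if_pos rfl, mul_one, detBracket, of_update, of_update, hone,
      det_updateRow_updateRow_one hij, (D i).leibniz, (D j).leibniz] at key
    simp only [smul_eq_mul] at key
    linear_combination key
  · rintro k ⟨hki, hkj⟩
    rw [Function.update_of_ne hkj, hy, if_neg (Ne.symm hki), mul_zero, detBracket, of_update,
      Matrix.det_eq_zero_of_row_eq_zero k, mul_zero]
    simp

end Determinants

/-! ### Decomposability of p-vectors in dimension p + 2 -/

section Decomposability

variable {E : Type*} [AddCommGroup E] [Module ℝ E] {p : ℕ}

/-- The functional `α ↦ P(y₁, …, α, …, y_p) / P(y₁, …, y_p)`, with `α` in slot `k`. -/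
def slotFunctional (P : E [⋀^Fin p]→ₗ[ℝ] ℝ) (y : Fin p → E) (k : Fin p) : E →ₗ[ℝ] ℝ :=
  (P y)⁻¹ • P.toMultilinearMap.toLinearMap y k

lemma slotFunctional_apply (P : E [⋀^Fin p]→ₗ[ℝ] ℝ) (y : Fin p → E) (k : Fin p) (a : E) :
    slotFunctional P y k a = (P y)⁻¹ * P (Function.update y k a) := rfl

lemma slotFunctional_self (P : E [⋀^Fin p]→ₗ[ℝ] ℝ) {y : Fin p → E} (hy : P y ≠ 0)
    (k j : Fin p) : slotFunctional P y k (y j) = if k = j then 1 else 0 := by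
  rw [slotFunctional_apply]
  split_ifs with h
  · subst h
    rw [Function.update_eq_self, inv_mul_cancel₀ hy]
  · rw [P.map_update_self _ h, mul_zero]

/-- The projection onto the span of `y₁, …, y_p` given by the slot functionals. -/
def slotProjection (P : E [⋀^Fin p]→ₗ[ℝ] ℝ) (y : Fin p → E) : E →ₗ[ℝ] E :=
  ∑ k, (slotFunctional P y k).smulRight (y k)

lemma slotProjection_apply (P : E [⋀^Fin p]→ₗ[ℝ] ℝ) (y : Fin p → E) (a : E) :
    slotProjection P y a = ∑ k, slotFunctional P y k a • y k := by
  simp [slotProjection]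

lemma slotFunctional_sub_slotProjection (P : E [⋀^Fin p]→ₗ[ℝ] ℝ) {y : Fin p → E}
    (hy : P y ≠ 0) (a : E) (k : Fin p) :
    slotFunctional P y k (a - slotProjection P y a) = 0 := by
  rw [map_sub, slotProjection_apply, map_sum]
  simp [slotFunctional_self P hy]

lemma slotProjection_self (P : E [⋀^Fin p]→ₗ[ℝ] ℝ) {y : Fin p → E} (hy : P y ≠ 0)
    (j : Fin p) : slotProjection P y (y j) = y j := by
  simp [slotProjection_apply, slotFunctional_self P hy]

lemma update_eq_add_of_sub (P : E [⋀^Fin p]→ₗ[ℝ] ℝ) (f : Fin p → E) (j : Fin p) (u v : E) :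
    P (Function.update f j u) = P (Function.update f j v) + P (Function.update f j (u - v)) := by
  rw [← P.map_update_add, add_sub_cancel]

/-- A `p`-vector that vanishes as soon as one argument is annihilated by its slot functionals is
decomposable. -/
lemma eq_det_of_annihilated (P : E [⋀^Fin p]→ₗ[ℝ] ℝ) {y : Fin p → E} (hy : P y ≠ 0)
    (hK : ∀ a, (∀ k, slotFunctional P y k a = 0) → ∀ f i, P (Function.update f i a) = 0)
    (α : Fin p → E) :
    P α = P y * (Matrix.of fun i k => slotFunctional P y k (α i)).det := by
  -- The arguments are replaced one by one by their projections to the span of y; each difference is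
  -- annihilated by all slot functionals, hence by P.
  have h1 : ∀ s : Finset (Fin p), P (s.piecewise (fun i => slotProjection P y (α i)) α) = P α := by
    intro s
    induction s using Finset.induction_on with
    | empty => simp
    | insert i s hi ih =>
      rw [Finset.piecewise_insert]
      rw [← ih]
      set f := s.piecewise (fun i => slotProjection P y (α i)) α with hf
      have hfi : f i = α i := Finset.piecewise_eq_of_notMem _ _ _ hi
      conv_rhs => rw [← Function.update_eq_self i f, hfi]
      rw [update_eq_add_of_sub P f i (α i) (slotProjection P y (α i)),
        hK _ (slotFunctional_sub_slotProjection P hy _), add_zero]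
  have h2 := h1 Finset.univ
  rw [Finset.piecewise_univ] at h2
  rw [← h2]
  let T : (Fin p → ℝ) →ₗ[ℝ] E := Fintype.linearCombination ℝ y
  -- Pulled back along the coordinates of the span of y, P is an alternating p-form on ℝ^p, hence a
  -- multiple of the determinant.
  have h3 := AlternatingMap.eq_smul_basis_det (Pi.basisFun ℝ (Fin p)) (P.compLinearMap T)
  have h4 := congrArg (fun Q => Q fun i k => slotFunctional P y k (α i)) h3
  simp only [AlternatingMap.compLinearMap_apply, AlternatingMap.smul_apply, smul_eq_mul] at h4
  have h5 : ∀ i, T (fun k => slotFunctional P y k (α i)) = slotProjection P y (α i) := by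
    intro i
    rw [slotProjection_apply]
    rfl
  have h6 : ∀ i, T (Pi.basisFun ℝ (Fin p) i) = y i := by
    intro i
    simp [T, Fintype.linearCombination_apply, Pi.single_apply]
  simp only [h5, h6] at h4
  rw [h4]
  congr 1
  rw [Module.Basis.det_apply, ← Matrix.det_transpose]
  rfl

/-- The identity first shows that P vanishes when one argument is a and another is some y_k. The
other arguments may then be projected to the kernel of `slotProjection`. Its rank is at least p, so
the kernel has dimension at most 2 < p and the p arguments are dependent. This is where p ≥ 3
enters. -/
lemma annihilated_of_quadratic_identity [FiniteDimensional ℝ E] (hE : Module.finrank ℝ E = p + 2)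
    (hp : 3 ≤ p) (P : E [⋀^Fin p]→ₗ[ℝ] ℝ) {y : Fin p → E} (hy : P y ≠ 0) {i₀ l : Fin p}
    (hil : i₀ ≠ l)
    (hW : ∀ (F g : Fin p → E) (a b : E),
      ∑ k, (P (Function.update g k a) *
          P (Function.update (Function.update F l (g k)) i₀ b)
        + P (Function.update g k b) *
          P (Function.update (Function.update F l (g k)) i₀ a)) = 0)
    (a : E) (ha : ∀ k, slotFunctional P y k a = 0) (f : Fin p → E) (i : Fin p) :
    P (Function.update f i a) = 0 := by
  have hzero : ∀ {a}, (∀ k, slotFunctional P y k a = 0) → ∀ k, P (Function.update y k a) = 0 := by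
    intro a ha k
    have := ha k
    rw [slotFunctional_apply] at this
    exact (mul_eq_zero.1 this).resolve_left (inv_ne_zero hy)
  -- Take g = y and b = y_j: the terms with a put into y vanish by the choice of a, the others by
  -- repetition of y_j, except for k = j.
  have h1 : ∀ a, (∀ k, slotFunctional P y k a = 0) → ∀ F j,
      P (Function.update (Function.update F l (y j)) i₀ a) = 0 := by
    intro a ha F j
    have h := hW F y a (y j)
    rw [Finset.sum_eq_single j] at h
    · rw [hzero ha, zero_mul, zero_add, Function.update_eq_self] at h
      exact (mul_eq_zero.1 h).resolve_left hy
    · intro k _ hk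
      rw [hzero ha, P.map_update_self _ hk]
      ring
    · simp
  -- A permutation taking i₀ to i and l to j frees the previous step from the two distinguished
  -- slots.
  have h2 : ∀ a, (∀ k, slotFunctional P y k a = 0) → ∀ (f : Fin p → E) i j, i ≠ j → ∀ k,
      f i = a → f j = y k → P f = 0 := by
    intro a ha f i j hij k hfi hfj
    set j' := Equiv.swap i₀ i j with hj'
    have hj0 : j' ≠ i₀ := by
      intro h
      rw [hj', Equiv.swap_apply_eq_iff, Equiv.swap_apply_left] at h
      exact hij h.symm
    set σ : Equiv.Perm (Fin p) := (Equiv.swap l j').trans (Equiv.swap i₀ i) with hσ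
    have hσi : σ i₀ = i := by
      rw [hσ, Equiv.trans_apply, Equiv.swap_apply_of_ne_of_ne hil hj0.symm, Equiv.swap_apply_left]
    have hσl : σ l = j := by
      rw [hσ, Equiv.trans_apply, Equiv.swap_apply_left, hj', Equiv.swap_apply_self]
    have h := h1 a ha (f ∘ σ) k
    have hl : (f ∘ σ) l = y k := by rw [Function.comp_apply, hσl, hfj]
    have hi : (f ∘ σ) i₀ = a := by rw [Function.comp_apply, hσi, hfi]
    rw [← hl, Function.update_eq_self, ← hi, Function.update_eq_self, P.map_perm] at h
    rcases Int.units_eq_one_or (Equiv.Perm.sign σ) with h' | h' <;> simpa [h'] using h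
  -- Subtracting the projection from an argument other than a changes it by a combination of the
  -- y_k, which does not affect P by the previous step.
  have h3 : ∀ s : Finset (Fin p), i ∉ s → P (Function.update (s.piecewise
      (fun j => f j - slotProjection P y (f j)) f) i a) = P (Function.update f i a) := by
    intro s
    induction s using Finset.induction_on with
    | empty => simp
    | insert j s hj ih =>
      intro hi
      rw [Finset.mem_insert, not_or] at hi
      rw [Finset.piecewise_insert, ← ih hi.2]
      set F := s.piecewise (fun j => f j - slotProjection P y (f j)) f with hF
      have hFj : F j = f j := Finset.piecewise_eq_of_notMem _ _ _ hj
      conv_rhs => rw [← Function.update_eq_self j F, hFj]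
      rw [Function.update_comm (Ne.symm hi.1), Function.update_comm (Ne.symm hi.1),
        update_eq_add_of_sub P _ j (f j) (f j - slotProjection P y (f j)), sub_sub_cancel,
        slotProjection_apply P y (f j), P.map_update_sum, left_eq_add]
      refine Finset.sum_eq_zero fun k _ => ?_
      rw [P.map_update_smul, h2 a ha _ i j hi.1 k, smul_zero]
      · rw [Function.update_of_ne hi.1, Function.update_self]
      · rw [Function.update_self]
  rw [← h3 (Finset.univ.erase i) (by simp)]
  set v := Function.update ((Finset.univ.erase i).piecewise
    (fun j => f j - slotProjection P y (f j)) f) i a with hv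
  have hker : ∀ j, v j ∈ LinearMap.ker (slotProjection P y) := by
    intro j
    rw [LinearMap.mem_ker, slotProjection_apply]
    refine Finset.sum_eq_zero fun k _ => ?_
    have : slotFunctional P y k (v j) = 0 := by
      by_cases hj : j = i
      · subst hj
        rw [hv, Function.update_self, ha]
      · rw [hv, Function.update_of_ne hj, Finset.piecewise_eq_of_mem _ _ _ (by simp [hj])]
        exact slotFunctional_sub_slotProjection P hy _ k
    rw [this, zero_smul]
  refine AlternatingMap.map_linearDependent P v fun hind => ?_
  have hyind : LinearIndependent ℝ y := by
    by_contra h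
    exact hy (AlternatingMap.map_linearDependent P y h)
  have c1 : p ≤ Module.finrank ℝ (LinearMap.range (slotProjection P y)) := by
    have hi : LinearIndependent ℝ (fun j => (⟨y j, ⟨y j, slotProjection_self P hy j⟩⟩ :
        LinearMap.range (slotProjection P y))) :=
      LinearIndependent.of_comp (LinearMap.range (slotProjection P y)).subtype hyind
    simpa using hi.fintype_card_le_finrank
  have c2 : p ≤ Module.finrank ℝ (LinearMap.ker (slotProjection P y)) := by
    have hi : LinearIndependent ℝ (fun j => (⟨v j, hker j⟩ :
        LinearMap.ker (slotProjection P y))) :=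
      LinearIndependent.of_comp (LinearMap.ker (slotProjection P y)).subtype hind
    simpa using hi.fintype_card_le_finrank
  have c3 := LinearMap.finrank_range_add_finrank_ker (slotProjection P y)
  omega

/-- With N = (y_i(X_j)) invertible, the hypothesis says that the row (a(X_j)) is killed by the
adjugate of N; hence a vanishes on every X_j. This replaces the dimension count when p = 2. -/
lemma annihilated_of_isWedgeOf {V : Type*} [AddCommGroup V] [Module ℝ V] [TopologicalSpace V]
    [IsTopologicalAddGroup V] [ContinuousSMul ℝ V]
    {P : (V →L[ℝ] ℝ) [⋀^Fin p]→ₗ[ℝ] ℝ} {X : Fin p → V} (hX : IsWedgeOf P X)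
    {y : Fin p → (V →L[ℝ] ℝ)} (hy : P y ≠ 0) (a : V →L[ℝ] ℝ)
    (ha : ∀ k, slotFunctional P y k a = 0) (f : Fin p → (V →L[ℝ] ℝ)) (i : Fin p) :
    P (Function.update f i a) = 0 := by
  set N : Matrix (Fin p) (Fin p) ℝ := Matrix.of fun i j => y i (X j) with hN
  have hdet : N.det ≠ 0 := by rw [hN, ← hX y]; exact hy
  have hupd : ∀ (g : Fin p → (V →L[ℝ] ℝ)) k, (Matrix.of fun i j => Function.update g k a i (X j)) =
      (Matrix.of fun i j => g i (X j)).updateRow k (fun j => a (X j)) := by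
    intro g k
    ext i j
    by_cases h : i = k
    · subst h; simp
    · simp [h]
  have h0 : ∀ k, (N.updateRow k (fun j => a (X j))).det = 0 := by
    intro k
    have := ha k
    rw [slotFunctional_apply, hX (Function.update y k a), hupd] at this
    exact (mul_eq_zero.1 this).resolve_left (inv_ne_zero hy)
  have h1 : Matrix.vecMul (fun j => a (X j)) N.adjugate = 0 := by
    funext k
    rw [Pi.zero_apply, ← h0 k, det_updateRow_eq_sum]
    simp only [Matrix.vecMul, dotProduct, Matrix.adjugate_apply]
  have h2 : (fun j => a (X j)) = 0 := by
    have := congrArg (fun v => Matrix.vecMul v N) h1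
    simp only [Matrix.vecMul_vecMul, Matrix.adjugate_mul, Matrix.zero_vecMul] at this
    rw [Matrix.vecMul_smul, Matrix.vecMul_one] at this
    exact (smul_eq_zero.1 this).resolve_left hdet
  rw [hX, hupd]
  refine Matrix.det_eq_zero_of_row_eq_zero i fun j => ?_
  rw [Matrix.updateRow_self]
  exact congrFun h2 j

end Decomposability

/-! ### Gauge transformations of the bracket -/

section Gauge

variable {n : ℕ} {M : Type*} [TopologicalSpace M] [ChartedSpace (EuclideanSpace ℝ (Fin n)) M]
  [IsManifold (𝓡 n) ∞ M] {U : Set M} {x : M}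

/-- The smooth sections of `L` over `U` are closed under the bracket. -/
def IsInvolutiveOn (U : Set M) (L : FibreFamily n M) : Prop :=
  ∀ e₁ e₂ : Sec n M, SmoothSec U e₁ → SmoothSec U e₂ →
    (∀ x ∈ U, e₁ x ∈ L x) → (∀ x ∈ U, e₂ x ∈ L x) → ∀ x ∈ U, bracket e₁ e₂ x ∈ L x

lemma IsInvolutiveOn.congr {L L' : FibreFamily n M} (h : IsInvolutiveOn U L)
    (hL : ∀ x ∈ U, L' x = L x) : IsInvolutiveOn U L' := by
  intro e₁ e₂ h₁ h₂ m₁ m₂ x hx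
  rw [hL x hx]
  exact h e₁ e₂ h₁ h₂ (fun y hy => hL y hy ▸ m₁ y hy) (fun y hy => hL y hy ▸ m₂ y hy) x hx

/-- The map `(X, μ) + (α, l) ↦ (X, μ - dρ(X)) + g (α + l dρ, l)` of `E¹`. -/
def gaugeMap (g ρ : M → ℝ) (e : Sec n M) : Sec n M := fun x =>
  (((e x).1.1, (e x).1.2 - dF n ρ x (e x).1.1),
    (g x • ((e x).2.1 + (e x).2.2 • dF n ρ x), g x * (e x).2.2))

lemma SmoothSec.gaugeMap {g ρ : M → ℝ} (hU : IsOpen U) (hg : SmoothFun n U g)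
    (hρ : SmoothFun n U ρ) {e : Sec n M} (he : SmoothSec U e) : SmoothSec U (gaugeMap g ρ e) :=
  ⟨he.1, he.2.1.sub (he.1.act hU hρ), SmoothCovField.smul hg
    (he.2.2.1.add (SmoothCovField.smul he.2.2.2 (smoothCovField_dF hρ))), hg.mul he.2.2.2⟩

/-- Leibniz rule with dg = g dρ. The closedness of dρ turns X(Yρ) - [X, Y]ρ into Y(Xρ). -/
lemma lieForm_gauge {g ρ l : M → ℝ} {α : CovField n M} {X Y : VField n M} (hU : IsOpen U)
    (hg : SmoothFun n U g) (hρ : SmoothFun n U ρ) (hl : SmoothFun n U l)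
    (hα : SmoothCovField U α) (hX : SmoothVField U X) (hY : SmoothVField U Y) (hx : x ∈ U)
    (hgρ : dF n g x = g x • dF n ρ x) :
    lieForm X (fun y => g y • (α y + l y • dF n ρ y)) x (Y x) =
      g x * (act X ρ x * (α x (Y x) + l x * act Y ρ x) + lieForm X α x (Y x)
        + act X l x * act Y ρ x + l x * act Y (act X ρ) x) := by
  have h1 : SmoothFun n U (evalForm α Y) := hα.evalForm hU hY
  have h2 : SmoothFun n U (act Y ρ) := hY.act hU hρ
  rw [lieForm_apply hU (SmoothCovField.smul hg (hα.add (SmoothCovField.smul hl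
    (smoothCovField_dF hρ)))) hX hY hx, lieForm_apply hU hα hX hY hx]
  have e1 : act X (evalForm (fun y => g y • (α y + l y • dF n ρ y)) Y) x =
      dF n (fun y => g y * (evalForm α Y y + l y * act Y ρ y)) x (X x) := rfl
  have e2 : (g x • (α x + l x • dF n ρ x)) (VectorField.mlieBracket (𝓡 n) X Y x) =
      g x * (α x (VectorField.mlieBracket (𝓡 n) X Y x) +
        l x * dF n ρ x (VectorField.mlieBracket (𝓡 n) X Y x)) := rfl
  rw [e1, e2, act_mlieBracket hU hX hY hρ hx,
    dF_mul (hg.mdifferentiableAt hU hx) ((h1.add (hl.mul h2)).mdifferentiableAt hU hx),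
    dF_add (h1.mdifferentiableAt hU hx) ((hl.mul h2).mdifferentiableAt hU hx),
    dF_mul (hl.mdifferentiableAt hU hx) (h2.mdifferentiableAt hU hx), hgρ]
  change g x * (act X (evalForm α Y) x + (l x * act X (act Y ρ) x + act Y ρ x * act X l x))
    + (evalForm α Y x + l x * act Y ρ x) * (g x * act X ρ x) - _ = _
  change g x * (act X (evalForm α Y) x + (l x * act X (act Y ρ) x + act Y ρ x * act X l x))
    + (α x (Y x) + l x * act Y ρ x) * (g x * act X ρ x) - _ = _
  ring

/-- The vector part is untouched; the function part is X₁X₂ρ - X₂X₁ρ = [X₁, X₂]ρ; in the dual parts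
the extra terms are products with dρ, and they match because dg = g dρ. So the gauge map is
compatible with the bracket without any condition on the sections beyond smoothness. -/
lemma gaugeMap_bracket {g ρ : M → ℝ} (hU : IsOpen U) (hg : SmoothFun n U g)
    (hρ : SmoothFun n U ρ) (hgρ : ∀ x ∈ U, dF n g x = g x • dF n ρ x) {e₁ e₂ : Sec n M}
    (h₁ : SmoothSec U e₁) (h₂ : SmoothSec U e₂) (hx : x ∈ U) :
    bracket (gaugeMap g ρ e₁) (gaugeMap g ρ e₂) x = gaugeMap g ρ (bracket e₁ e₂) x := by
  obtain ⟨hX₁, hf₁, hα₁, hg₁⟩ := h₁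
  obtain ⟨hX₂, hf₂, hα₂, hg₂⟩ := h₂
  set X₁ : VField n M := fun x => (e₁ x).1.1 with hX₁d
  set f₁ : M → ℝ := fun x => (e₁ x).1.2 with hf₁d
  set α₁ : CovField n M := fun x => (e₁ x).2.1 with hα₁d
  set g₁ : M → ℝ := fun x => (e₁ x).2.2 with hg₁d
  set X₂ : VField n M := fun x => (e₂ x).1.1 with hX₂d
  set f₂ : M → ℝ := fun x => (e₂ x).1.2 with hf₂d
  set α₂ : CovField n M := fun x => (e₂ x).2.1 with hα₂d
  set g₂ : M → ℝ := fun x => (e₂ x).2.2 with hg₂d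
  have s₁ : SmoothFun n U (act X₁ ρ) := hX₁.act hU hρ
  have s₂ : SmoothFun n U (act X₂ ρ) := hX₂.act hU hρ
  have d1 : ∀ v, dF n (fun y => f₁ y - act X₁ ρ y) x v = dF n f₁ x v - dF n (act X₁ ρ) x v := by
    intro v
    rw [dF_sub (hf₁.mdifferentiableAt hU hx) (s₁.mdifferentiableAt hU hx)]
    rfl
  have d2 : ∀ v, dF n (fun y => f₂ y - act X₂ ρ y) x v = dF n f₂ x v - dF n (act X₂ ρ) x v := by
    intro v
    rw [dF_sub (hf₂.mdifferentiableAt hU hx) (s₂.mdifferentiableAt hU hx)]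
    rfl
  have d3 : ∀ v, dF n (fun y => g y * g₁ y) x v = g x * dF n g₁ x v
      + g₁ x * (g x * dF n ρ x v) := by
    intro v
    rw [dF_mul (hg.mdifferentiableAt hU hx) (hg₁.mdifferentiableAt hU hx), hgρ x hx]
    rfl
  have d4 : ∀ v, dF n (fun y => g y * g₂ y) x v = g x * dF n g₂ x v
      + g₂ x * (g x * dF n ρ x v) := by
    intro v
    rw [dF_mul (hg.mdifferentiableAt hU hx) (hg₂.mdifferentiableAt hU hx), hgρ x hx]
    rfl
  have p1 : bracket (gaugeMap g ρ e₁) (gaugeMap g ρ e₂) x =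
    ((VectorField.mlieBracket (𝓡 n) X₁ X₂ x,
        dF n (fun y => f₂ y - act X₂ ρ y) x (X₁ x) - dF n (fun y => f₁ y - act X₁ ρ y) x (X₂ x)),
     (lieForm X₁ (fun y => g y • (α₂ y + g₂ y • dF n ρ y)) x
        - lieForm X₂ (fun y => g y • (α₁ y + g₁ y • dF n ρ y)) x
        + (1 / 2 : ℝ) • dF n (fun y => g y * (evalForm α₁ X₂ y + g₁ y * act X₂ ρ y)
            - g y * (evalForm α₂ X₁ y + g₂ y * act X₁ ρ y)) x
        + (f₁ x - act X₁ ρ x) • (g x • (α₂ x + g₂ x • dF n ρ x))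
        - (f₂ x - act X₂ ρ x) • (g x • (α₁ x + g₁ x • dF n ρ x))
        + (1 / 2 : ℝ) • ((g x * g₂ x) • dF n (fun y => f₁ y - act X₁ ρ y) x
            - (g x * g₁ x) • dF n (fun y => f₂ y - act X₂ ρ y) x
            - (f₁ x - act X₁ ρ x) • dF n (fun y => g y * g₂ y) x
            + (f₂ x - act X₂ ρ x) • dF n (fun y => g y * g₁ y) x),
      dF n (fun y => g y * g₂ y) x (X₁ x) - dF n (fun y => g y * g₁ y) x (X₂ x)
        + (1 / 2) * (g x * (evalForm α₁ X₂ x + g₁ x * act X₂ ρ x)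
            - g x * (evalForm α₂ X₁ x + g₂ x * act X₁ ρ x)
            - (f₂ x - act X₂ ρ x) * (g x * g₁ x) + (f₁ x - act X₁ ρ x) * (g x * g₂ x)))) := rfl
  have p2 : gaugeMap g ρ (bracket e₁ e₂) x =
    ((VectorField.mlieBracket (𝓡 n) X₁ X₂ x, act X₁ f₂ x - act X₂ f₁ x
        - dF n ρ x (VectorField.mlieBracket (𝓡 n) X₁ X₂ x)),
     (g x • ((lieForm X₁ α₂ x - lieForm X₂ α₁ x
        + (1 / 2 : ℝ) • dF n (fun y => evalForm α₁ X₂ y - evalForm α₂ X₁ y) x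
        + f₁ x • α₂ x - f₂ x • α₁ x
        + (1 / 2 : ℝ) • (g₂ x • dF n f₁ x - g₁ x • dF n f₂ x
            - f₁ x • dF n g₂ x + f₂ x • dF n g₁ x))
        + (act X₁ g₂ x - act X₂ g₁ x
        + (1 / 2) * (evalForm α₁ X₂ x - evalForm α₂ X₁ x - f₂ x * g₁ x + f₁ x * g₂ x))
          • dF n ρ x),
      g x * (act X₁ g₂ x - act X₂ g₁ x
        + (1 / 2) * (evalForm α₁ X₂ x - evalForm α₂ X₁ x - f₂ x * g₁ x + f₁ x * g₂ x)))) := rfl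
  rw [p1, p2]
  refine Prod.ext (Prod.ext rfl ?_) (Prod.ext ?_ ?_)
  · change dF n (fun y => f₂ y - act X₂ ρ y) x (X₁ x) - dF n (fun y => f₁ y - act X₁ ρ y) x (X₂ x)
      = _
    rw [d1, d2, act_mlieBracket hU hX₁ hX₂ hρ hx]
    change act X₁ f₂ x - act X₁ (act X₂ ρ) x - (act X₂ f₁ x - act X₂ (act X₁ ρ) x) = _
    ring
  -- The covector part is compared on a vector v extended to a local field Y, so that the formulas
  -- for Lie derivatives along fields apply.
  · refine ContinuousLinearMap.ext fun v => ?_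
    set W : Set M := U ∩ (chartAt (EuclideanSpace ℝ (Fin n)) x).source with hWd
    have hW : IsOpen W := hU.inter (chartAt (EuclideanSpace ℝ (Fin n)) x).open_source
    have hxW : x ∈ W := ⟨hx, mem_chart_source _ x⟩
    have hWU : W ⊆ U := Set.inter_subset_left
    set Y : VField n M := extendVector x v with hYd
    have hYs : SmoothVField W Y := (smoothVField_extendVector x v).mono Set.inter_subset_right
    have hYx : Y x = v := extendVector_self x v
    rw [← hYx]
    have a12 : SmoothFun n U (evalForm α₁ X₂) := hα₁.evalForm hU hX₂
    have a21 : SmoothFun n U (evalForm α₂ X₁) := hα₂.evalForm hU hX₁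
    have m : ∀ {F : M → ℝ}, SmoothFun n U F → MDifferentiableAt (𝓡 n) 𝓘(ℝ, ℝ) F x :=
      fun hF => hF.mdifferentiableAt hU hx
    have l1 := lieForm_gauge hW (hg.mono hWU) (hρ.mono hWU) (hg₂.mono hWU) (hα₂.mono hWU)
      (hX₁.mono hWU) hYs hxW (hgρ x hx)
    have l2 := lieForm_gauge hW (hg.mono hWU) (hρ.mono hWU) (hg₁.mono hWU) (hα₁.mono hWU)
      (hX₂.mono hWU) hYs hxW (hgρ x hx)
    have d5 : dF n (fun y => g y * (evalForm α₁ X₂ y + g₁ y * act X₂ ρ y)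
            - g y * (evalForm α₂ X₁ y + g₂ y * act X₁ ρ y)) x (Y x) =
        (g x * (dF n (evalForm α₁ X₂) x (Y x) + (g₁ x * dF n (act X₂ ρ) x (Y x)
          + act X₂ ρ x * dF n g₁ x (Y x)))
          + (evalForm α₁ X₂ x + g₁ x * act X₂ ρ x) * (g x * dF n ρ x (Y x)))
        - (g x * (dF n (evalForm α₂ X₁) x (Y x) + (g₂ x * dF n (act X₁ ρ) x (Y x)
          + act X₁ ρ x * dF n g₂ x (Y x)))
          + (evalForm α₂ X₁ x + g₂ x * act X₁ ρ x) * (g x * dF n ρ x (Y x))) := by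
      rw [dF_sub (m (hg.mul (a12.add (hg₁.mul s₂)))) (m (hg.mul (a21.add (hg₂.mul s₁)))),
        dF_mul (m hg) (m (a12.add (hg₁.mul s₂))), dF_mul (m hg) (m (a21.add (hg₂.mul s₁))),
        dF_add (m a12) (m (hg₁.mul s₂)), dF_add (m a21) (m (hg₂.mul s₁)),
        dF_mul (m hg₁) (m s₂), dF_mul (m hg₂) (m s₁), hgρ x hx]
      rfl
    have d6 : dF n (fun y => evalForm α₁ X₂ y - evalForm α₂ X₁ y) x (Y x) =
        dF n (evalForm α₁ X₂) x (Y x) - dF n (evalForm α₂ X₁) x (Y x) := by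
      rw [dF_sub (m a12) (m a21)]
      rfl
    change lieForm X₁ (fun y => g y • (α₂ y + g₂ y • dF n ρ y)) x (Y x)
        - lieForm X₂ (fun y => g y • (α₁ y + g₁ y • dF n ρ y)) x (Y x)
        + (1 / 2 : ℝ) * dF n (fun y => g y * (evalForm α₁ X₂ y + g₁ y * act X₂ ρ y)
            - g y * (evalForm α₂ X₁ y + g₂ y * act X₁ ρ y)) x (Y x)
        + (f₁ x - act X₁ ρ x) * (g x * (α₂ x (Y x) + g₂ x * dF n ρ x (Y x)))
        - (f₂ x - act X₂ ρ x) * (g x * (α₁ x (Y x) + g₁ x * dF n ρ x (Y x)))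
        + (1 / 2 : ℝ) * ((g x * g₂ x) * dF n (fun y => f₁ y - act X₁ ρ y) x (Y x)
            - (g x * g₁ x) * dF n (fun y => f₂ y - act X₂ ρ y) x (Y x)
            - (f₁ x - act X₁ ρ x) * dF n (fun y => g y * g₂ y) x (Y x)
            + (f₂ x - act X₂ ρ x) * dF n (fun y => g y * g₁ y) x (Y x)) =
      (g x * ((lieForm X₁ α₂ x (Y x) - lieForm X₂ α₁ x (Y x)
        + (1 / 2 : ℝ) * dF n (fun y => evalForm α₁ X₂ y - evalForm α₂ X₁ y) x (Y x)
        + f₁ x * α₂ x (Y x) - f₂ x * α₁ x (Y x)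
        + (1 / 2 : ℝ) * (g₂ x * dF n f₁ x (Y x) - g₁ x * dF n f₂ x (Y x)
            - f₁ x * dF n g₂ x (Y x) + f₂ x * dF n g₁ x (Y x)))
        + (act X₁ g₂ x - act X₂ g₁ x
        + (1 / 2) * (evalForm α₁ X₂ x - evalForm α₂ X₁ x - f₂ x * g₁ x + f₁ x * g₂ x))
          * dF n ρ x (Y x)))
    rw [l1, l2, d5, d6, d1, d2, d3, d4]
    simp only [act]
    ring
  · change dF n (fun y => g y * g₂ y) x (X₁ x) - dF n (fun y => g y * g₁ y) x (X₂ x)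
        + (1 / 2) * (g x * (evalForm α₁ X₂ x + g₁ x * act X₂ ρ x)
            - g x * (evalForm α₂ X₁ x + g₂ x * act X₁ ρ x)
            - (f₂ x - act X₂ ρ x) * (g x * g₁ x) + (f₁ x - act X₁ ρ x) * (g x * g₂ x))
      = g x * (act X₁ g₂ x - act X₂ g₁ x
        + (1 / 2) * (evalForm α₁ X₂ x - evalForm α₂ X₁ x - f₂ x * g₁ x + f₁ x * g₂ x))
    rw [d3, d4]
    simp only [act]
    ring

lemma interiorProd_smul {V : Type*} [AddCommGroup V] [Module ℝ V] [TopologicalSpace V]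
    [ContinuousConstSMul ℝ V]
    (c : ℝ) (β : V [⋀^Fin 2]→L[ℝ] ℝ) (v : V) :
    interiorProd (c • β) v = c • interiorProd β v := by
  ext w
  simp [interiorProd_apply]

/-- Where g ≠ 0, a section lies in the original family exactly when its gauge transform lies in the
transformed one; compatibility with brackets does the rest. -/
lemma IsInvolutiveOn.of_gauge {g ρ : M → ℝ} {β : FormField n M 2} {η : CovField n M}
    (hU : IsOpen U) (hg : SmoothFun n U g) (hρ : SmoothFun n U ρ) (hg0 : ∀ x ∈ U, g x ≠ 0)
    (hgρ : ∀ x ∈ U, dF n g x = g x • dF n ρ x)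
    (h : IsInvolutiveOn U (graphFamily (fun x => g x • β x) (fun x => η x + dF n ρ x))) :
    IsInvolutiveOn U (graphFamily β η) := by
  have key : ∀ e : Sec n M, ∀ x ∈ U, gaugeMap g ρ e x ∈
      graphFamily (fun x => g x • β x) (fun x => η x + dF n ρ x) x ↔ e x ∈ graphFamily β η x := by
    intro e x hx
    change gaugeMap g ρ e x ∈ graphFibre (g x • β x) (η x + dF n ρ x) ↔
      e x ∈ graphFibre (β x) (η x)
    rw [mem_graphFibre, mem_graphFibre, interiorProd_smul]
    change ((e x).1.2 - dF n ρ x (e x).1.1 = -(η x (e x).1.1 + dF n ρ x (e x).1.1) ∧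
      g x • ((e x).2.1 + (e x).2.2 • dF n ρ x) = g x • interiorProd (β x) (e x).1.1
        + (g x * (e x).2.2) • (η x + dF n ρ x)) ↔ _
    refine and_congr ⟨fun h => by linarith, fun h => by linarith⟩ ?_
    rw [mul_smul, ← smul_add, (smul_right_injective _ (hg0 x hx)).eq_iff, smul_add, ← add_assoc,
      add_left_inj]
  intro e₁ e₂ h₁ h₂ m₁ m₂ x hx
  rw [← key _ x hx, ← gaugeMap_bracket hU hg hρ hgρ h₁ h₂ hx]
  exact h _ _ (h₁.gaugeMap hU hg hρ) (h₂.gaugeMap hU hg hρ)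
    (fun y hy => (key e₁ y hy).2 (m₁ y hy)) (fun y hy => (key e₂ y hy).2 (m₂ y hy)) x hx

end Gauge

/-! ### Frames of the subspaces L_(β, η) -/

section Frames

variable {V : Type*} [AddCommGroup V] [Module ℝ V] [TopologicalSpace V]
  [IsTopologicalAddGroup V] [ContinuousSMul ℝ V]

/-- The vector X and the scalar t are free parameters of the fibre; the other two components are
functions of them. -/
lemma graphFibre_ext {β : V [⋀^Fin 2]→L[ℝ] ℝ} {η : V →L[ℝ] ℝ} {a b : Fibre V}
    (ha : a ∈ graphFibre β η) (hb : b ∈ graphFibre β η) (h1 : a.1.1 = b.1.1)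
    (h2 : a.2.2 = b.2.2) : a = b := by
  rw [mem_graphFibre] at ha hb
  refine Prod.ext (Prod.ext h1 ?_) (Prod.ext ?_ h2)
  · rw [ha.1, hb.1, h1]
  · rw [ha.2, hb.2, h1, h2]

/-- The frame of `graphFibre β η` given by a frame of `V`. -/
def graphFrame {n : ℕ} (β : V [⋀^Fin 2]→L[ℝ] ℝ) (η : V →L[ℝ] ℝ) (c : Fin n → V) :
    Fin (n + 1) → Fibre V :=
  Fin.cons ((0, 0), (η, 1)) fun i => ((c i, -η (c i)), (interiorProd β (c i), 0))

lemma graphFrame_mem {n : ℕ} (β : V [⋀^Fin 2]→L[ℝ] ℝ) (η : V →L[ℝ] ℝ) (c : Fin n → V)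
    (i : Fin (n + 1)) : graphFrame β η c i ∈ graphFibre β η := by
  refine Fin.cases ?_ (fun i => ?_) i
  · rw [mem_graphFibre]
    refine ⟨by simp [graphFrame], ?_⟩
    ext w
    have : β ![0, w] = 0 := β.map_coord_zero 0 rfl
    simp [graphFrame, interiorProd_apply, this]
  · rw [mem_graphFibre]
    simp [graphFrame]

lemma sum_graphFrame_fst {n : ℕ} (β : V [⋀^Fin 2]→L[ℝ] ℝ) (η : V →L[ℝ] ℝ) (c : Fin n → V)
    (r : Fin (n + 1) → ℝ) : (∑ i, r i • graphFrame β η c i).1.1 = ∑ i : Fin n, r i.succ • c i := by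
  rw [Fin.sum_univ_succ]
  simp [graphFrame, Prod.fst_sum]

lemma sum_graphFrame_snd {n : ℕ} (β : V [⋀^Fin 2]→L[ℝ] ℝ) (η : V →L[ℝ] ℝ) (c : Fin n → V)
    (r : Fin (n + 1) → ℝ) : (∑ i, r i • graphFrame β η c i).2.2 = r 0 := by
  rw [Fin.sum_univ_succ]
  simp [graphFrame, Prod.snd_sum]

lemma linearIndependent_graphFrame {n : ℕ} (β : V [⋀^Fin 2]→L[ℝ] ℝ) (η : V →L[ℝ] ℝ)
    {c : Fin n → V} (hc : LinearIndependent ℝ c) : LinearIndependent ℝ (graphFrame β η c) := by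
  rw [Fintype.linearIndependent_iff] at hc ⊢
  intro r hr i
  have h1 := sum_graphFrame_fst β η c r
  have h2 := sum_graphFrame_snd β η c r
  rw [hr] at h1 h2
  refine Fin.cases h2.symm (fun i => hc (fun i => r i.succ) h1.symm i) i

lemma span_graphFrame {n : ℕ} (β : V [⋀^Fin 2]→L[ℝ] ℝ) (η : V →L[ℝ] ℝ)
    {c : Fin n → V} (hc : ∀ v, ∃ r : Fin n → ℝ, ∑ i, r i • c i = v) :
    Submodule.span ℝ (Set.range (graphFrame β η c)) = graphFibre β η := by
  refine le_antisymm (Submodule.span_le.2 ?_) fun a ha => ?_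
  · rintro _ ⟨i, rfl⟩
    exact graphFrame_mem β η c i
  · obtain ⟨r, hr⟩ := hc a.1.1
    have h : a = ∑ i, (Fin.cons a.2.2 r : Fin (n + 1) → ℝ) i • graphFrame β η c i := by
      refine graphFibre_ext ha (Submodule.sum_mem _ fun i _ =>
        Submodule.smul_mem _ _ (graphFrame_mem β η c i)) ?_ ?_
      · rw [sum_graphFrame_fst, ← hr]
        simp
      · rw [sum_graphFrame_snd]
        simp
    rw [h]
    exact Submodule.sum_mem _ fun i _ => Submodule.smul_mem _ _ (Submodule.subset_span ⟨i, rfl⟩)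

end Frames

/-! ### Dirac structures attached to 2-forms -/

section Dirac

variable {n : ℕ} {M : Type*} [TopologicalSpace M] [ChartedSpace (EuclideanSpace ℝ (Fin n)) M]
  [IsManifold (𝓡 n) ∞ M] {U : Set M} {x : M}

lemma SmoothForm.interiorProd {β : FormField n M 2} (hβ : SmoothForm U β)
    {X : VField n M} (hX : SmoothVField U X) :
    SmoothCovField U (fun x => NambuDirac.interiorProd (β x) (X x)) := by
  intro W hW hWU Y hY
  simp only [interiorProd_apply]
  refine (hβ W hW hWU ![X, Y] ?_).congr fun x _ => ?_
  · intro i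
    fin_cases i
    · exact hX.mono hWU
    · exact hY
  · congr 1
    funext i
    fin_cases i <;> rfl

lemma SmoothForm.smul {k : ℕ} {f : M → ℝ} {β : FormField n M k} (hf : SmoothFun n U f)
    (hβ : SmoothForm U β) : SmoothForm U (fun x => f x • β x) :=
  fun W hW hWU X hX => (hf.mono hWU).mul (hβ W hW hWU X hX)

lemma smoothForm_wedge {k : ℕ} {θ : Fin k → CovField n M} (hθ : ∀ i, SmoothCovField U (θ i)) :
    SmoothForm U (fun x => wedge fun i => θ i x) :=
  fun W hW hWU X hX => SmoothFun.det fun i j => hθ j W hW hWU (X i) (hX i)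

lemma SmoothForm.congr {k : ℕ} {β γ : FormField n M k} (hβ : SmoothForm U β)
    (h : ∀ x ∈ U, γ x = β x) : SmoothForm U γ :=
  fun W hW hWU X hX => (hβ W hW hWU X hX).congr fun x hx => by rw [h x (hWU hx)]

lemma smoothForm_wedge_pair {θ₁ θ₂ : CovField n M} (h₁ : SmoothCovField U θ₁)
    (h₂ : SmoothCovField U θ₂) : SmoothForm U (fun x => wedge ![θ₁ x, θ₂ x]) := by
  refine (smoothForm_wedge (θ := ![θ₁, θ₂]) fun i => ?_).congr fun x _ => ?_
  · fin_cases i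
    · exact h₁
    · exact h₂
  · congr 1
    funext i
    fin_cases i <;> rfl

lemma smoothVField_zero (U : Set M) : SmoothVField U (fun _ => 0 : VField n M) :=
  (SmoothVField.sum (s := (∅ : Finset ℕ)) (X := fun _ _ => 0) (by simp)).congr fun x _ => by simp

lemma isSubbundleOn_graphFamily {β : FormField n M 2} {η : CovField n M} (hU : IsOpen U)
    (hβ : SmoothForm U β) (hη : SmoothCovField U η) : IsSubbundleOn U (graphFamily β η) := by
  intro x hx
  have hφ := chartAt_mem (n := n) x
  set φ := chartAt (EuclideanSpace ℝ (Fin n)) x with hφd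
  refine ⟨U ∩ φ.source, hU.inter φ.open_source, ⟨hx, mem_chart_source _ x⟩,
    Set.inter_subset_left, n + 1,
    fun i y => graphFrame (β y) (η y) (fun j => coordVector φ j y) i, fun i => ?_, fun y hy => ?_⟩
  · have hβ' : SmoothForm (U ∩ φ.source) β := fun W hW hWU => hβ W hW (hWU.trans
      Set.inter_subset_left)
    have hη' := hη.mono (Set.inter_subset_left (s := U) (t := φ.source))
    refine Fin.cases ?_ (fun i => ?_) i
    · exact ⟨smoothVField_zero _, smoothFun_const _ 0, hη', smoothFun_const _ 1⟩
    · have hc := (smoothVField_coordVector hφ i).mono (Set.inter_subset_right (s := U))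
      exact ⟨hc, (hη'.evalForm (hU.inter φ.open_source) hc).neg, hβ'.interiorProd hc,
        smoothFun_const _ 0⟩
  · exact ⟨linearIndependent_graphFrame _ _ (coordVector_linearIndependent hφ hy.2),
      span_graphFrame _ _ fun v => ⟨_, sum_coordVector hφ hy.2 v⟩⟩

lemma isDiracOn_graphFamily {β : FormField n M 2} {η : CovField n M} (hU : IsOpen U)
    (hβ : SmoothForm U β) (hη : SmoothCovField U η)
    (h : IsInvolutiveOn U (graphFamily β η)) : IsDiracOn U (graphFamily β η) :=
  ⟨isSubbundleOn_graphFamily hU hβ hη, fun x _ => maximal_isIsotropic_graphFibre (β x) (η x), h⟩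

lemma wedge_pair {V : Type*} [AddCommGroup V] [Module ℝ V] [TopologicalSpace V]
    (a b : V →L[ℝ] ℝ) (v w : V) : wedge ![a, b] ![v, w] = a v * b w - a w * b v := by
  rw [wedge_apply, Matrix.det_fin_two]
  simp [mul_comm]

lemma dF_logAbs_eq {f : M → ℝ} (hU : IsOpen U) (hf : SmoothFun n U f)
    (h0 : ∀ x ∈ U, f x ≠ 0) (hx : x ∈ U) : dF n f x = f x • dLogAbs n f x := by
  rw [dLogAbs, dF_logAbs (hf.mdifferentiableAt hU hx) (h0 x hx), smul_smul,
    mul_inv_cancel₀ (h0 x hx), one_smul]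

lemma dLogAbs_inv {f : M → ℝ} : dLogAbs n (fun y => (f y)⁻¹) x = - dLogAbs n f x := by
  rw [dLogAbs, dLogAbs, ← dF_neg]
  simp only [abs_inv, Real.log_inv]

/-- The gauge by 1/f, for which ρ = ln |1/f| = -ln |f|. -/
lemma IsInvolutiveOn.of_gauge_inv {f : M → ℝ} {β : FormField n M 2} {η : CovField n M}
    (hU : IsOpen U) (hf : SmoothFun n U f) (h0 : ∀ x ∈ U, f x ≠ 0)
    (h : IsInvolutiveOn U (graphFamily (fun x => (f x)⁻¹ • β x) (fun x => η x - dLogAbs n f x))) :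
    IsInvolutiveOn U (graphFamily β η) := by
  have h0' : ∀ x ∈ U, (f x)⁻¹ ≠ 0 := fun x hx => inv_ne_zero (h0 x hx)
  refine IsInvolutiveOn.of_gauge (g := fun x => (f x)⁻¹) (ρ := fun x => Real.log |(f x)⁻¹|) hU
    (hf.inv h0) ((hf.inv h0).logAbs h0') h0'
    (fun x hx => dF_logAbs_eq hU (hf.inv h0) h0' hx) (h.congr fun x hx => ?_)
  change graphFibre _ (η x + dLogAbs n (fun y => (f y)⁻¹) x) = graphFibre _ (η x - dLogAbs n f x)
  rw [dLogAbs_inv, sub_eq_add_neg]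

/-- For η = 0 the function parts vanish, and the covector part of the bracket is L_{X₁} i_{X₂}ω -
L_{X₂} i_{X₁}ω + d(ω(X₁, X₂)), which is i_{[X₁, X₂]}ω because ω = dz ∧ dw is closed. Here it is
checked on a test field Y, with closedness entering as `act_mlieBracket` for z and w. -/
lemma isInvolutiveOn_wedge_dF {z w : M → ℝ} (hU : IsOpen U) (hz : SmoothFun n U z)
    (hw : SmoothFun n U w) :
    IsInvolutiveOn U (graphFamily (fun x => wedge ![dF n z x, dF n w x]) (fun _ => 0)) := by
  intro e₁ e₂ h₁ h₂ m₁ m₂ x hx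
  obtain ⟨hX₁, hf₁, hα₁, hg₁⟩ := h₁
  obtain ⟨hX₂, hf₂, hα₂, hg₂⟩ := h₂
  set X₁ : VField n M := fun x => (e₁ x).1.1 with hX₁d
  set f₁ : M → ℝ := fun x => (e₁ x).1.2 with hf₁d
  set α₁ : CovField n M := fun x => (e₁ x).2.1 with hα₁d
  set g₁ : M → ℝ := fun x => (e₁ x).2.2 with hg₁d
  set X₂ : VField n M := fun x => (e₂ x).1.1 with hX₂d
  set f₂ : M → ℝ := fun x => (e₂ x).1.2 with hf₂d
  set α₂ : CovField n M := fun x => (e₂ x).2.1 with hα₂d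
  set g₂ : M → ℝ := fun x => (e₂ x).2.2 with hg₂d
  have hm : ∀ {e : Sec n M}, (∀ y ∈ U, e y ∈ graphFamily
      (fun x => wedge ![dF n z x, dF n w x]) (fun _ => 0) y) → ∀ y ∈ U,
      (e y).1.2 = 0 ∧ ∀ v, (e y).2.1 v =
        dF n z y (e y).1.1 * dF n w y v - dF n z y v * dF n w y (e y).1.1 := by
    intro e he y hy
    have := mem_graphFibre.1 (he y hy)
    refine ⟨by rw [this.1]; simp, fun v => ?_⟩
    rw [this.2, smul_zero, add_zero, interiorProd_apply, wedge_pair]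
  have v₁ : ∀ y ∈ U, f₁ y = 0 ∧ ∀ v, α₁ y v =
      act X₁ z y * dF n w y v - dF n z y v * act X₁ w y := hm m₁
  have v₂ : ∀ y ∈ U, f₂ y = 0 ∧ ∀ v, α₂ y v =
      act X₂ z y * dF n w y v - dF n z y v * act X₂ w y := hm m₂
  have hev : ∀ {F G : M → ℝ}, (∀ y ∈ U, F y = G y) → dF n F x = dF n G x := fun h =>
    dF_congr (Filter.eventuallyEq_of_mem (hU.mem_nhds hx) h)
  have df₁ : dF n f₁ x = 0 := (hev fun y hy => (v₁ y hy).1).trans (dF_const 0)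
  have df₂ : dF n f₂ x = 0 := (hev fun y hy => (v₂ y hy).1).trans (dF_const 0)
  have hf₁0 : f₁ x = 0 := (v₁ x hx).1
  have hf₂0 : f₂ x = 0 := (v₂ x hx).1
  change bracket e₁ e₂ x ∈ graphFibre _ _
  rw [mem_graphFibre]
  constructor
  · change dF n f₂ x (X₁ x) - dF n f₁ x (X₂ x) = -(0 : ℝ)
    rw [df₁, df₂]
    simp
  refine ContinuousLinearMap.ext fun v => ?_
  set W : Set M := U ∩ (chartAt (EuclideanSpace ℝ (Fin n)) x).source with hWd
  have hW : IsOpen W := hU.inter (chartAt (EuclideanSpace ℝ (Fin n)) x).open_source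
  have hxW : x ∈ W := ⟨hx, mem_chart_source _ x⟩
  have hWU : W ⊆ U := Set.inter_subset_left
  set Y : VField n M := extendVector x v with hYd
  have hY : SmoothVField W Y := (smoothVField_extendVector x v).mono Set.inter_subset_right
  have hYx : Y x = v := extendVector_self x v
  rw [← hYx]
  have hev' : ∀ {F G : M → ℝ}, (∀ y ∈ W, F y = G y) → dF n F x = dF n G x := fun h =>
    dF_congr (Filter.eventuallyEq_of_mem (hW.mem_nhds hxW) h)
  have hprod : ∀ {A B C D : M → ℝ}, SmoothFun n W A → SmoothFun n W B → SmoothFun n W C →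
      SmoothFun n W D → ∀ v, dF n (fun y => A y * B y - C y * D y) x v =
      A x * dF n B x v + B x * dF n A x v - (C x * dF n D x v + D x * dF n C x v) := by
    intro A B C D hA hB hC hD v
    rw [dF_sub ((hA.mul hB).mdifferentiableAt hW hxW) ((hC.mul hD).mdifferentiableAt hW hxW),
      dF_mul (hA.mdifferentiableAt hW hxW) (hB.mdifferentiableAt hW hxW),
      dF_mul (hC.mdifferentiableAt hW hxW) (hD.mdifferentiableAt hW hxW)]
    rfl
  have s : ∀ {X : VField n M} {f : M → ℝ}, SmoothVField W X → SmoothFun n U f →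
      SmoothFun n W (act X f) := fun hX hf => SmoothVField.act hW hX (hf.mono hWU)
  have hX₁' := hX₁.mono hWU
  have hX₂' := hX₂.mono hWU
  have l1 : lieForm X₁ α₂ x (Y x) = dF n (fun y => act X₂ z y * act Y w y - act Y z y * act X₂ w y)
      x (X₁ x) - α₂ x (VectorField.mlieBracket (𝓡 n) X₁ Y x) := by
    rw [lieForm_apply hW (hα₂.mono hWU) hX₁' hY hxW]
    congr 1
    exact congrArg (fun A => A (X₁ x)) (hev' (F := evalForm α₂ Y)
      (G := fun y => act X₂ z y * act Y w y - act Y z y * act X₂ w y)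
      fun y hy => (v₂ y (hWU hy)).2 (Y y))
  have l2 : lieForm X₂ α₁ x (Y x) = dF n (fun y => act X₁ z y * act Y w y - act Y z y * act X₁ w y)
      x (X₂ x) - α₁ x (VectorField.mlieBracket (𝓡 n) X₂ Y x) := by
    rw [lieForm_apply hW (hα₁.mono hWU) hX₂' hY hxW]
    congr 1
    exact congrArg (fun A => A (X₂ x)) (hev' (F := evalForm α₁ Y)
      (G := fun y => act X₁ z y * act Y w y - act Y z y * act X₁ w y)
      fun y hy => (v₁ y (hWU hy)).2 (Y y))
  -- Both evaluations are ω(X₁, X₂) up to sign; the resulting factor 2 cancels the 1/2 of the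
  -- bracket.
  have l3 : dF n (fun y => evalForm α₁ X₂ y - evalForm α₂ X₁ y) x (Y x) =
      2 * dF n (fun y => act X₁ z y * act X₂ w y - act X₂ z y * act X₁ w y) x (Y x) := by
    have := hev' (F := fun y => evalForm α₁ X₂ y - evalForm α₂ X₁ y) (G := fun y =>
      (act X₁ z y * act X₂ w y - act X₂ z y * act X₁ w y)
        + (act X₁ z y * act X₂ w y - act X₂ z y * act X₁ w y)) (fun y hy => by
        change α₁ y (X₂ y) - α₂ y (X₁ y) = _
        rw [(v₁ y (hWU hy)).2 (X₂ y), (v₂ y (hWU hy)).2 (X₁ y)]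
        simp only [act]
        ring)
    rw [this]
    have hs : SmoothFun n W (fun y => act X₁ z y * act X₂ w y - act X₂ z y * act X₁ w y) :=
      ((s hX₁' hz).mul (s hX₂' hw)).sub ((s hX₂' hz).mul (s hX₁' hw))
    rw [dF_add (hs.mdifferentiableAt hW hxW) (hs.mdifferentiableAt hW hxW), two_mul]
    rfl
  rw [hprod (s hX₂' hz) (s hY hw) (s hY hz) (s hX₂' hw), (v₂ x hx).2] at l1
  rw [hprod (s hX₁' hz) (s hY hw) (s hY hz) (s hX₁' hw), (v₁ x hx).2] at l2
  rw [hprod (s hX₁' hz) (s hX₂' hw) (s hX₂' hz) (s hX₁' hw)] at l3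
  have b : ∀ {X Z : VField n M} {f : M → ℝ}, SmoothVField W X → SmoothVField W Z →
      SmoothFun n U f → dF n f x (VectorField.mlieBracket (𝓡 n) X Z x)
        = act X (act Z f) x - act Z (act X f) x :=
    fun hX hZ hf => act_mlieBracket hW hX hZ (hf.mono hWU) hxW
  change lieForm X₁ α₂ x (Y x) - lieForm X₂ α₁ x (Y x)
        + (1 / 2 : ℝ) * dF n (fun y => evalForm α₁ X₂ y - evalForm α₂ X₁ y) x (Y x)
        + f₁ x * α₂ x (Y x) - f₂ x * α₁ x (Y x)
        + (1 / 2 : ℝ) * (g₂ x * dF n f₁ x (Y x) - g₁ x * dF n f₂ x (Y x)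
            - f₁ x * dF n g₂ x (Y x) + f₂ x * dF n g₁ x (Y x)) =
    interiorProd (wedge ![dF n z x, dF n w x]) (VectorField.mlieBracket (𝓡 n) X₁ X₂ x) (Y x)
      + _ * (0 : ℝ)
  have z0 : (0 : TangentSpace (𝓡 n) x →L[ℝ] ℝ) (Y x) = 0 := rfl
  rw [interiorProd_apply, wedge_pair, df₁, df₂, hf₁0, hf₂0, l1, l2, l3, z0,
    b hX₁' hX₂' hz, b hX₁' hX₂' hw, b hX₁' hY hz, b hX₁' hY hw, b hX₂' hY hz, b hX₂' hY hw]
  simp only [act]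
  ring

/-- The family attached to `f dz ∧ dw` and `d ln |f|` is a Dirac structure. -/
lemma isDiracOn_smul_wedge_dF {f z w : M → ℝ} (hU : IsOpen U) (hf : SmoothFun n U f)
    (h0 : ∀ x ∈ U, f x ≠ 0) (hz : SmoothFun n U z) (hw : SmoothFun n U w)
    {β : FormField n M 2} (hβ : ∀ x ∈ U, β x = f x • wedge ![dF n z x, dF n w x]) :
    IsDiracOn U (graphFamily β (dLogAbs n f)) := by
  have hβs : SmoothForm U β := (SmoothForm.smul hf (smoothForm_wedge_pair
    (smoothCovField_dF hz) (smoothCovField_dF hw))).congr hβ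
  refine isDiracOn_graphFamily hU hβs (smoothCovField_dF (hf.logAbs h0)) ?_
  refine IsInvolutiveOn.of_gauge_inv hU hf h0 ?_
  refine (isInvolutiveOn_wedge_dF hU hz hw).congr fun x hx => ?_
  change graphFibre ((f x)⁻¹ • β x) (dLogAbs n f x - dLogAbs n f x) = graphFibre _ 0
  rw [hβ x hx, smul_smul, inv_mul_cancel₀ (h0 x hx), one_smul, sub_self]

lemma dLogAbs_mul {f g : M → ℝ} (hU : IsOpen U) (hf : SmoothFun n U f) (hg : SmoothFun n U g)
    (hf0 : ∀ x ∈ U, f x ≠ 0) (hg0 : ∀ x ∈ U, g x ≠ 0) (hx : x ∈ U) :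
    dLogAbs n (fun y => f y * g y) x = dLogAbs n f x + dLogAbs n g x := by
  refine Eq.trans ?_ (dF_add ((hf.logAbs hf0).mdifferentiableAt hU hx)
    ((hg.logAbs hg0).mdifferentiableAt hU hx))
  refine dF_congr (Filter.eventuallyEq_of_mem (hU.mem_nhds hx) fun y hy => ?_)
  simp only [abs_mul]
  exact Real.log_mul (abs_ne_zero.2 (hf0 y hy)) (abs_ne_zero.2 (hg0 y hy))

/-- Rescaling the 2-form of a Dirac structure `L_(β, d ln |f|)` by `g` gives the Dirac structure
`L_(g β, d ln |f g|)`. -/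
lemma isDiracOn_smul {f g : M → ℝ} {β : FormField n M 2} (hU : IsOpen U) (hf : SmoothFun n U f)
    (hg : SmoothFun n U g) (hf0 : ∀ x ∈ U, f x ≠ 0) (hg0 : ∀ x ∈ U, g x ≠ 0)
    (hβ : SmoothForm U β) (h : IsInvolutiveOn U (graphFamily β (dLogAbs n f))) :
    IsDiracOn U (graphFamily (fun x => g x • β x) (dLogAbs n (fun x => f x * g x))) := by
  refine isDiracOn_graphFamily hU (hβ.smul hg) (smoothCovField_dF ((hf.mul hg).logAbs
    fun x hx => mul_ne_zero (hf0 x hx) (hg0 x hx))) ?_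
  refine IsInvolutiveOn.of_gauge_inv hU hg hg0 (h.congr fun x hx => ?_)
  change graphFibre ((g x)⁻¹ • g x • β x) (dLogAbs n (fun y => f y * g y) x - dLogAbs n g x) =
    graphFibre (β x) (dLogAbs n f x)
  rw [smul_smul, inv_mul_cancel₀ (hg0 x hx), one_smul, dLogAbs_mul hU hf hg hf0 hg0 hx,
    add_sub_cancel_right]

end Dirac

/-! ### Global extensions by cutoff functions -/

section Cutoff

variable {n : ℕ} {M : Type*} [TopologicalSpace M] [ChartedSpace (EuclideanSpace ℝ (Fin n)) M]
  [IsManifold (𝓡 n) ∞ M] {U W : Set M} {x : M}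

lemma exists_cutoff [T2Space M] (hW : IsOpen W) (hx : x ∈ W) :
    ∃ χ : M → ℝ, SmoothFun n Set.univ χ ∧ χ =ᶠ[𝓝 x] 1 ∧ tsupport χ ⊆ W := by
  obtain ⟨b, -, hb⟩ := (SmoothBumpFunction.nhds_basis_tsupport (I := 𝓡 n) x).mem_iff.1
    (hW.mem_nhds hx)
  exact ⟨b, b.contMDiff.contMDiffOn, b.eventuallyEq_one, hb⟩

lemma SmoothFun.cutoff {χ f : M → ℝ} (hχ : SmoothFun n Set.univ χ) (hs : tsupport χ ⊆ W)
    (hW : IsOpen W) (hf : SmoothFun n W f) : SmoothFun n Set.univ (fun x => χ x * f x) := by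
  refine smoothFun_of_local fun x _ => ?_
  by_cases hx : x ∈ W
  · refine ⟨W, hW, hx, ?_⟩
    rw [Set.univ_inter]
    exact (hχ.mono (Set.subset_univ _)).mul hf
  · refine ⟨(tsupport χ)ᶜ, (isClosed_tsupport χ).isOpen_compl, fun h => hx (hs h), ?_⟩
    refine (smoothFun_const _ 0).congr fun y hy => ?_
    rw [image_eq_zero_of_notMem_tsupport hy.2, zero_mul]

lemma SmoothVField.cutoff {χ : M → ℝ} {X : VField n M} (hχ : SmoothFun n Set.univ χ)
    (hs : tsupport χ ⊆ W) (hW : IsOpen W) (hX : SmoothVField W X) :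
    SmoothVField Set.univ (fun x => χ x • X x) := by
  refine contMDiffOn_of_locally_contMDiffOn fun x _ => ?_
  by_cases hx : x ∈ W
  · refine ⟨W, hW, hx, ?_⟩
    rw [Set.univ_inter]
    exact SmoothVField.smul (hχ.mono (Set.subset_univ _)) hX
  · refine ⟨(tsupport χ)ᶜ, (isClosed_tsupport χ).isOpen_compl, fun h => hx (hs h), ?_⟩
    refine (smoothVField_zero (n := n) (M := M) _).congr fun y hy => ?_
    rw [image_eq_zero_of_notMem_tsupport hy.2, zero_smul]

lemma exists_smoothFun_univ [T2Space M] {f : M → ℝ} (hW : IsOpen W) (hf : SmoothFun n W f)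
    (hx : x ∈ W) : ∃ F : M → ℝ, SmoothFun n Set.univ F ∧ F =ᶠ[𝓝 x] f := by
  obtain ⟨χ, hχ, h1, hs⟩ := exists_cutoff (n := n) hW hx
  refine ⟨fun x => χ x * f x, hχ.cutoff hs hW hf, h1.mono fun y hy => ?_⟩
  simp only [hy, Pi.one_apply, one_mul]

/-- The extension is kept as an explicit multiple of X that vanishes off W, so linear conditions
satisfied by X on W hold for it on all of M. -/
lemma exists_smoothVField_univ [T2Space M] {X : VField n M} (hW : IsOpen W)
    (hX : SmoothVField W X) (hx : x ∈ W) :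
    ∃ χ : M → ℝ, SmoothVField Set.univ (fun y => χ y • X y) ∧
      (∀ᶠ y in 𝓝 x, χ y = 1) ∧ ∀ y ∉ W, χ y = 0 := by
  obtain ⟨χ, hχ, h1, hs⟩ := exists_cutoff (n := n) hW hx
  exact ⟨χ, SmoothVField.cutoff hχ hs hW hX, h1,
    fun y hy => image_eq_zero_of_notMem_tsupport fun h => hy (hs h)⟩

end Cutoff

/-! ### The last slot of a list of functions -/

section WithLast

variable {A : Type*} {p : ℕ}

/-- Turns `withLast` into an update at the index p - 1, the form in which the algebraic lemmas are
stated; c is a filler that gets overwritten. -/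
lemma withLast_eq_update (hp : 0 < p) (a : Fin (p - 1) → A) (b c : A) :
    withLast a b = Function.update (withLast a c) (⟨p - 1, by omega⟩ : Fin p) b := by
  funext i
  by_cases h : i.val < p - 1
  · rw [Function.update_of_ne (by rintro rfl; simp at h)]
    simp [withLast, h]
  · have : i = ⟨p - 1, by omega⟩ := Fin.ext (by have := i.isLt; simp; omega)
    rw [this]
    simp [withLast]

lemma update_eq_withLast (hp : 0 < p) (F : Fin p → A) (b : A) :
    Function.update F (⟨p - 1, by omega⟩ : Fin p) b =
      withLast (fun i : Fin (p - 1) => F ⟨i.val, by omega⟩) b := by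
  rw [withLast_eq_update hp _ b b]
  funext i
  by_cases h : i = ⟨p - 1, by omega⟩
  · subst h; simp
  · rw [Function.update_of_ne h, Function.update_of_ne h]
    have h2 : i.val < p - 1 := by
      have := i.isLt
      have : i.val ≠ p - 1 := fun h' => h (Fin.ext h')
      omega
    simp [withLast, h2]

end WithLast

/-! ### Locality of Nambu brackets and the quadratic identity -/

section Brackets

variable {n p : ℕ} {M : Type*} [TopologicalSpace M]
  [ChartedSpace (EuclideanSpace ℝ (Fin n)) M] [IsManifold (𝓡 n) ∞ M] {U W : Set M} {x : M}
  {P : MultiField n M p}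

lemma nambuBracket_congr {f g : Fin p → M → ℝ} (h : ∀ i, f i =ᶠ[𝓝 x] g i) :
    nambuBracket P f x = nambuBracket P g x := by
  rw [nambuBracket, nambuBracket]
  congr 1
  funext i
  exact dF_congr (h i)

lemma nambuBracket_eventuallyEq {f g : Fin p → M → ℝ} (h : ∀ i, f i =ᶠ[𝓝 x] g i) :
    nambuBracket P f =ᶠ[𝓝 x] nambuBracket P g := by
  filter_upwards [eventually_all.2 fun i => (h i).eventuallyEq_nhds] with y hy
  exact nambuBracket_congr hy

lemma eventuallyEq_update {f g : Fin p → M → ℝ} (h : ∀ i, f i =ᶠ[𝓝 x] g i) (k : Fin p)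
    {u v : M → ℝ} (huv : u =ᶠ[𝓝 x] v) (i : Fin p) :
    Function.update f k u i =ᶠ[𝓝 x] Function.update g k v i := by
  by_cases hi : i = k
  · subst hi; simpa
  · simpa [hi] using h i

/-- The Fundamental Identity at `x`, with an arbitrary entry in the last slot of `F`. -/
def FundamentalAt (P : MultiField n M p) (l : Fin p) (F g : Fin p → M → ℝ) (x : M) : Prop :=
  nambuBracket P (Function.update F l (nambuBracket P g)) x = ∑ k : Fin p,
    nambuBracket P (Function.update g k (nambuBracket P (Function.update F l (g k)))) x

lemma FundamentalAt.congr {l : Fin p} {F F' g g' : Fin p → M → ℝ} (h : FundamentalAt P l F g x)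
    (hF : ∀ i, F' i =ᶠ[𝓝 x] F i) (hg : ∀ i, g' i =ᶠ[𝓝 x] g i) : FundamentalAt P l F' g' x := by
  rw [FundamentalAt] at h ⊢
  rw [nambuBracket_congr (eventuallyEq_update hF l (nambuBracket_eventuallyEq hg)), h]
  refine Finset.sum_congr rfl fun k _ => (nambuBracket_congr (eventuallyEq_update hg k
    (nambuBracket_eventuallyEq (eventuallyEq_update hF l (hg k))))).symm

lemma isNambuOn_iff (hp : 0 < p) : IsNambuOn U P ↔ SmoothMultiField U P ∧
    ∀ F g : Fin p → M → ℝ, (∀ i, SmoothFun n U (F i)) → (∀ i, SmoothFun n U (g i)) →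
      ∀ x ∈ U, FundamentalAt P ⟨p - 1, by omega⟩ F g x := by
  refine and_congr_right fun _ => ⟨fun h F g hF hg x hx => ?_, fun h f g hf hg x hx => ?_⟩
  · rw [FundamentalAt]
    simp only [update_eq_withLast hp]
    exact h _ g (fun i => hF _) hg x hx
  -- The zero function only fills the last slot, which the identity overwrites.
  · have := h (withLast f (fun _ => 0)) g (fun i => ?_) hg x hx
    · rw [FundamentalAt] at this
      simpa only [← withLast_eq_update hp] using this
    · rw [withLast]
      split_ifs
      · exact hf _
      · exact smoothFun_const _ 0

lemma SmoothMultiField.mono (h : SmoothMultiField U P) (hW : W ⊆ U) : SmoothMultiField W P :=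
  fun V hV hVW f hf => h V hV (hVW.trans hW) f hf

/-- Functions smooth on W need not extend to M, but their germs at x do, and both sides of the
Fundamental Identity at x depend only on germs. -/
lemma IsNambuOn.restrict [T2Space M] (hp : 0 < p) (h : IsNambuOn Set.univ P) (hW : IsOpen W) :
    IsNambuOn W P := by
  rw [isNambuOn_iff hp] at h ⊢
  refine ⟨h.1.mono (Set.subset_univ _), fun F g hF hg x hx => ?_⟩
  choose F' hF' hFF' using fun i => exists_smoothFun_univ hW (hF i) hx
  choose g' hg' hgg' using fun i => exists_smoothFun_univ hW (hg i) hx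
  exact (h.2 F' g' hF' hg' x trivial).congr (fun i => (hFF' i).symm) fun i => (hgg' i).symm

lemma isNambuOn_of_local (hp : 0 < p)
    (h : ∀ x ∈ U, ∃ W, IsOpen W ∧ x ∈ W ∧ W ⊆ U ∧ IsNambuOn W P) : IsNambuOn U P := by
  rw [isNambuOn_iff hp]
  constructor
  · intro V hV hVU f hf
    refine smoothFun_of_local fun x hx => ?_
    obtain ⟨W, hW, hxW, -, hPW⟩ := h x (hVU hx)
    exact ⟨W, hW, hxW, hPW.1 _ (hV.inter hW) Set.inter_subset_right f
      fun i => (hf i).mono Set.inter_subset_left⟩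
  · intro F g hF hg x hx
    obtain ⟨W, hW, hxW, hWU, hPW⟩ := h x hx
    exact ((isNambuOn_iff hp).1 hPW).2 F g (fun i => (hF i).mono hWU) (fun i => (hg i).mono hWU)
      x hxW

lemma nambuBracket_update (f : Fin p → M → ℝ) (k : Fin p) (u : M → ℝ) (x : M) :
    nambuBracket P (Function.update f k u) x =
      P x (Function.update (fun i => dF n (f i) x) k (dF n u x)) := by
  rw [nambuBracket]
  congr 1
  funext i
  by_cases hi : i = k
  · subst hi; simp
  · simp [hi]

/-- A function whose differential at `x` is `α` and that vanishes at `x`. -/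
def linearFun (x : M) (α : TangentSpace (𝓡 n) x →L[ℝ] ℝ) : M → ℝ := fun y =>
  ∑ i, α (coordVector (chartAt (EuclideanSpace ℝ (Fin n)) x) i x) *
    (chartAt (EuclideanSpace ℝ (Fin n)) x y i - chartAt (EuclideanSpace ℝ (Fin n)) x x i)

lemma linearFun_self (x : M) (α : TangentSpace (𝓡 n) x →L[ℝ] ℝ) : linearFun x α x = 0 := by
  simp [linearFun]

lemma smoothFun_linearFun (x : M) (α : TangentSpace (𝓡 n) x →L[ℝ] ℝ) :
    SmoothFun n (chartAt (EuclideanSpace ℝ (Fin n)) x).source (linearFun x α) :=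
  SmoothFun.sum fun i _ => (smoothFun_const _ _).mul
    ((smoothFun_coord (chartAt_mem x) i).sub (smoothFun_const _ _))

lemma SmoothFun.dF_sum {ι : Type*} {s : Finset ι} {F : ι → M → ℝ} (hU : IsOpen U) (hx : x ∈ U)
    (hF : ∀ i ∈ s, SmoothFun n U (F i)) :
    dF n (fun y => ∑ i ∈ s, F i y) x = ∑ i ∈ s, dF n (F i) x := by
  classical
  induction s using Finset.induction_on with
  | empty => simpa using dF_const 0
  | insert a s ha ih =>
    have h1 := hF a (Finset.mem_insert_self a s)
    have h2 : ∀ i ∈ s, SmoothFun n U (F i) := fun i hi => hF i (Finset.mem_insert_of_mem hi)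
    rw [Finset.sum_insert ha, ← ih h2, ← dF_add (h1.mdifferentiableAt hU hx)
      ((SmoothFun.sum h2).mdifferentiableAt hU hx)]
    simp only [Finset.sum_insert ha]

lemma dF_linearFun (x : M) (α : TangentSpace (𝓡 n) x →L[ℝ] ℝ) :
    dF n (linearFun x α) x = α := by
  have hφ := chartAt_mem (n := n) x
  have hx := mem_chart_source (EuclideanSpace ℝ (Fin n)) x
  set φ := chartAt (EuclideanSpace ℝ (Fin n)) x with hφd
  have hd : ∀ i, dF n (fun y => α (coordVector φ i x) * (φ y i - φ x i)) x =
      α (coordVector φ i x) • dF n (fun y => φ y i) x := by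
    intro i
    have h1 := (smoothFun_coord hφ i).mdifferentiableAt φ.open_source hx
    have h2 := (smoothFun_const (n := n) φ.source (φ x i)).mdifferentiableAt φ.open_source hx
    have h3 := (smoothFun_const (n := n) φ.source
      (α (coordVector φ i x))).mdifferentiableAt φ.open_source hx
    have h4 := ((smoothFun_coord hφ i).sub (smoothFun_const φ.source
      (φ x i))).mdifferentiableAt φ.open_source hx
    rw [dF_mul h3 h4, dF_sub h1 h2, dF_const, dF_const, sub_zero, smul_zero, add_zero]
  have h := SmoothFun.dF_sum (n := n) (s := Finset.univ)
    (F := fun i y => α (coordVector φ i x) * (φ y i - φ x i)) φ.open_source hx fun i _ =>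
    (smoothFun_const φ.source (α (coordVector φ i x))).mul
      ((smoothFun_coord hφ i).sub (smoothFun_const φ.source (φ x i)))
  refine Eq.trans h ?_
  simp only [hd]
  refine ContinuousLinearMap.ext fun v => ?_
  conv_rhs => rw [← sum_coordVector hφ hx v, map_sum]
  rw [sum_apply]
  refine Finset.sum_congr rfl fun i _ => ?_
  rw [map_smul]
  exact mul_comm _ _

/-- The quadratic identity satisfied by a Nambu structure at every point. -/
lemma IsNambuOn.quadratic_identity [T2Space M] (hp : 0 < p) (h : IsNambuOn Set.univ P) (x : M)
    {i₀ : Fin p} (hi : i₀ ≠ ⟨p - 1, by omega⟩) (F g : Fin p → (TangentSpace (𝓡 n) x →L[ℝ] ℝ))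
    (a b : TangentSpace (𝓡 n) x →L[ℝ] ℝ) :
    ∑ k, (P x (Function.update g k a) *
          P x (Function.update (Function.update F ⟨p - 1, by omega⟩ (g k)) i₀ b)
        + P x (Function.update g k b) *
          P x (Function.update (Function.update F ⟨p - 1, by omega⟩ (g k)) i₀ a)) = 0 := by
  set l : Fin p := ⟨p - 1, by omega⟩ with hl
  set W := (chartAt (EuclideanSpace ℝ (Fin n)) x).source with hWd
  have hW : IsOpen W := (chartAt (EuclideanSpace ℝ (Fin n)) x).open_source
  have hx : x ∈ W := mem_chart_source _ x
  have hPW := (isNambuOn_iff hp).1 (h.restrict hp hW)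
  have hs := smoothFun_linearFun (n := n) x
  have hm : ∀ α, MDifferentiableAt (𝓡 n) 𝓘(ℝ, ℝ) (linearFun x α) x := fun α =>
    (hs α).mdifferentiableAt hW hx
  set A := linearFun x a with hA
  set B := linearFun x b with hB
  have hupd : ∀ u, SmoothFun n W u → ∀ i, SmoothFun n W
      (Function.update (fun i => linearFun x (F i)) i₀ u i) := by
    intro u hu i
    by_cases hi' : i = i₀
    · subst hi'; simpa
    · simpa [hi'] using hs (F i)
  have hupd2 : ∀ u, SmoothFun n W u → ∀ k i, SmoothFun n W
      (Function.update (Function.update (fun i => linearFun x (F i)) i₀ u) l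
        (linearFun x (g k)) i) := by
    intro u hu k i
    by_cases hi' : i = l
    · subst hi'; simpa using hs (g k)
    · simpa [hi'] using hupd u hu i
  -- The Fundamental Identity with the product A B in slot i₀, where A and B vanish at x and have
  -- differentials a and b.
  have key := hPW.2 (Function.update (fun i => linearFun x (F i)) i₀ (fun y => A y * B y))
    (fun i => linearFun x (g i)) (hupd _ ((hs a).mul (hs b))) (fun i => hs (g i)) x hx
  have hAB : dF n (fun y => A y * B y) x = 0 := by
    rw [dF_mul (hm a) (hm b), linearFun_self, linearFun_self, zero_smul, zero_smul,
      add_zero]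
  rw [FundamentalAt, Function.update_comm hi, nambuBracket_update, hAB,
    AlternatingMap.map_coord_zero (P x) i₀ (Function.update_self _ _ _)] at key
  rw [key]
  refine Finset.sum_congr rfl fun k _ => ?_
  have hbr : ∀ u, SmoothFun n W u → SmoothFun n W (nambuBracket P (Function.update
      (Function.update (fun i => linearFun x (F i)) i₀ u) l (linearFun x (g k)))) :=
    fun u hu => hPW.1 W hW subset_rfl _ (hupd2 u hu k)
  -- The inner brackets on the right are A{…, B, …} + B{…, A, …}. Their differentials at x involve
  -- only a, b and values of P, so no derivative of P survives.
  have hH : ∀ y ∈ W, nambuBracket P (Function.update (Function.update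
      (fun i => linearFun x (F i)) i₀ fun y => A y * B y) l (linearFun x (g k))) y =
      A y * nambuBracket P (Function.update
        (Function.update (fun i => linearFun x (F i)) i₀ B) l (linearFun x (g k))) y +
      B y * nambuBracket P (Function.update
        (Function.update (fun i => linearFun x (F i)) i₀ A) l (linearFun x (g k))) y := by
    intro y hy
    rw [Function.update_comm hi, nambuBracket_update, Function.update_comm hi,
      nambuBracket_update, Function.update_comm hi, nambuBracket_update,
      dF_mul ((hs a).mdifferentiableAt hW hy) ((hs b).mdifferentiableAt hW hy),
      AlternatingMap.map_update_add, AlternatingMap.map_update_smul,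
      AlternatingMap.map_update_smul]
    rfl
  have hval : ∀ c, nambuBracket P (Function.update (Function.update
      (fun i => linearFun x (F i)) i₀ (linearFun x c)) l (linearFun x (g k))) x =
      P x (Function.update (Function.update F l (g k)) i₀ c) := by
    intro c
    rw [Function.update_comm hi, nambuBracket_update, dF_linearFun]
    congr 2
    funext i
    by_cases hi' : i = l
    · subst hi'; simp [dF_linearFun]
    · simp [hi', dF_linearFun]
  rw [nambuBracket_update, dF_congr (Filter.eventuallyEq_of_mem (hW.mem_nhds hx) hH),
    dF_add (((hs a).mul (hbr B (hs b))).mdifferentiableAt hW hx)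
      (((hs b).mul (hbr A (hs a))).mdifferentiableAt hW hx),
    dF_mul (hm a) ((hbr B (hs b)).mdifferentiableAt hW hx),
    dF_mul (hm b) ((hbr A (hs a)).mdifferentiableAt hW hx), hval, hval, hA, hB, linearFun_self,
    linearFun_self, zero_smul, zero_smul, zero_add, zero_add, dF_linearFun, dF_linearFun,
    AlternatingMap.map_update_add, AlternatingMap.map_update_smul,
    AlternatingMap.map_update_smul]
  simp only [dF_linearFun, smul_eq_mul]
  ring

end Brackets

/-! ### Smooth functions as an algebra with derivations -/

section Derivations

variable {n p : ℕ} {M : Type*} [TopologicalSpace M]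
  [ChartedSpace (EuclideanSpace ℝ (Fin n)) M] [IsManifold (𝓡 n) ∞ M] {U W : Set M} {x : M}
  {P : MultiField n M p}

open scoped Classical in
/-- The extension by zero of a function defined on `W`. -/
def zeroExtend {W : Set M} (f : W → ℝ) : M → ℝ := fun x => if h : x ∈ W then f ⟨x, h⟩ else 0

lemma zeroExtend_of_mem {f : W → ℝ} (hx : x ∈ W) : zeroExtend f x = f ⟨x, hx⟩ := by
  simp [zeroExtend, hx]

variable (n) in
/-- The algebra of smooth functions on `W`. -/
def smoothAlgebra (W : Set M) : Subalgebra ℝ (W → ℝ) where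
  carrier := {f | SmoothFun n W (zeroExtend f)}
  mul_mem' hf hg := (SmoothFun.mul hf hg).congr fun x hx => by simp [zeroExtend_of_mem hx]
  add_mem' hf hg := (SmoothFun.add hf hg).congr fun x hx => by simp [zeroExtend_of_mem hx]
  algebraMap_mem' c := (smoothFun_const W c).congr fun x hx => by
    simp [zeroExtend_of_mem hx, Pi.algebraMap_apply]

/-- The restriction to `W` of a function that is smooth on `W`. -/
def SmoothFun.toAlgebra {f : M → ℝ} (hf : SmoothFun n W f) : smoothAlgebra n W :=
  ⟨fun x => f x, hf.congr fun x hx => by simp [zeroExtend_of_mem hx]⟩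

/-- A function on `M` that agrees on `W` with a given element of the algebra. -/
def algFun (f : smoothAlgebra n W) : M → ℝ := zeroExtend f.1

lemma smoothFun_algFun (f : smoothAlgebra n W) : SmoothFun n W (algFun f) := f.2

lemma algFun_of_mem (f : smoothAlgebra n W) (hx : x ∈ W) : algFun f x = f.1 ⟨x, hx⟩ :=
  zeroExtend_of_mem hx

lemma algFun_toAlgebra {f : M → ℝ} (hf : SmoothFun n W f) (hx : x ∈ W) :
    algFun hf.toAlgebra x = f x := algFun_of_mem _ hx

lemma algFun_ext {f g : smoothAlgebra n W} (h : ∀ x ∈ W, algFun f x = algFun g x) : f = g := by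
  refine Subtype.ext (funext fun x => ?_)
  have := h x x.2
  rwa [algFun_of_mem f x.2, algFun_of_mem g x.2] at this

/-- The derivation of the algebra of smooth functions defined by a vector field. -/
def vfieldDerivation (hW : IsOpen W) {X : VField n M} (hX : SmoothVField W X) :
    Derivation ℝ (smoothAlgebra n W) (smoothAlgebra n W) :=
  have hm : ∀ (f : smoothAlgebra n W), ∀ x ∈ W, MDifferentiableAt (𝓡 n) 𝓘(ℝ, ℝ) (algFun f) x :=
    fun f _ hx => (smoothFun_algFun f).mdifferentiableAt hW hx
  Derivation.mk'
    { toFun := fun f => (hX.act hW (smoothFun_algFun f)).toAlgebra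
      map_add' := fun f g => algFun_ext fun x hx => by
        rw [algFun_of_mem _ hx]
        change dF n (algFun (f + g)) x (X x) =
          algFun ((hX.act hW (smoothFun_algFun f)).toAlgebra
            + (hX.act hW (smoothFun_algFun g)).toAlgebra) x
        rw [algFun_of_mem _ hx]
        change _ = dF n (algFun f) x (X x) + dF n (algFun g) x (X x)
        have : dF n (algFun (f + g)) x = dF n (algFun f) x + dF n (algFun g) x := by
          rw [← dF_add (hm f x hx) (hm g x hx)]
          refine dF_congr (Filter.eventuallyEq_of_mem (hW.mem_nhds hx) fun y hy => ?_)
          simp only [algFun_of_mem _ hy]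
          rfl
        rw [this]
        rfl
      map_smul' := fun c f => algFun_ext fun x hx => by
        rw [algFun_of_mem _ hx]
        change dF n (algFun (c • f)) x (X x) =
          algFun (c • (hX.act hW (smoothFun_algFun f)).toAlgebra) x
        rw [algFun_of_mem _ hx]
        change _ = c * dF n (algFun f) x (X x)
        have : dF n (algFun (c • f)) x = c • dF n (algFun f) x := by
          have h1 := (smoothFun_const (n := n) W c).mdifferentiableAt hW hx
          have h2 := dF_mul h1 (hm f x hx)
          rw [dF_const, smul_zero, add_zero] at h2
          rw [← h2]
          refine dF_congr (Filter.eventuallyEq_of_mem (hW.mem_nhds hx) fun y hy => ?_)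
          simp only [algFun_of_mem _ hy]
          rfl
        rw [this]
        rfl }
    fun f g => algFun_ext fun x hx => by
      rw [algFun_of_mem _ hx, algFun_of_mem _ hx]
      change dF n (algFun (f * g)) x (X x) = f.1 ⟨x, hx⟩ * dF n (algFun g) x (X x)
        + g.1 ⟨x, hx⟩ * dF n (algFun f) x (X x)
      have : dF n (algFun (f * g)) x = algFun f x • dF n (algFun g) x
          + algFun g x • dF n (algFun f) x := by
        rw [← dF_mul (hm f x hx) (hm g x hx)]
        refine dF_congr (Filter.eventuallyEq_of_mem (hW.mem_nhds hx) fun y hy => ?_)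
        simp only [algFun_of_mem _ hy]
        rfl
      rw [this, algFun_of_mem f hx, algFun_of_mem g hx]
      rfl

lemma algFun_vfieldDerivation (hW : IsOpen W) {X : VField n M} (hX : SmoothVField W X)
    (f : smoothAlgebra n W) (hx : x ∈ W) :
    algFun (vfieldDerivation hW hX f) x = act X (algFun f) x :=
  algFun_toAlgebra (hX.act hW (smoothFun_algFun f)) hx

/-- Evaluation at a point of `W`. -/
def evalAlgebra (hx : x ∈ W) : smoothAlgebra n W →+* ℝ :=
  (Pi.evalRingHom (fun _ : W => ℝ) ⟨x, hx⟩).comp (smoothAlgebra n W).val.toRingHom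

lemma evalAlgebra_apply (hx : x ∈ W) (f : smoothAlgebra n W) : evalAlgebra hx f = algFun f x :=
  (algFun_of_mem f hx).symm

/-- Evaluation at a point is a ring homomorphism, so it commutes with the determinant. -/
lemma algFun_detBracket (hW : IsOpen W) {Y : Fin p → VField n M}
    (hY : ∀ j, SmoothVField W (Y j)) {h : M → ℝ} (hh : SmoothFun n W h)
    (hP : ∀ x ∈ W, P x = h x • wedgeVec (fun j => Y j x)) (f : Fin p → smoothAlgebra n W)
    (hx : x ∈ W) :
    algFun (detBracket (fun j => vfieldDerivation hW (hY j)) hh.toAlgebra f) x =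
      nambuBracket P (fun i => algFun (f i)) x := by
  rw [← evalAlgebra_apply hx, detBracket, map_mul, RingHom.map_det, evalAlgebra_apply,
    algFun_toAlgebra hh hx, nambuBracket, hP x hx, AlternatingMap.smul_apply, wedgeVec_apply,
    smul_eq_mul]
  refine congrArg (fun N => h x * Matrix.det N) (Matrix.ext fun i j => ?_)
  rw [RingHom.mapMatrix_apply, Matrix.map_apply, Matrix.of_apply, evalAlgebra_apply]
  exact algFun_vfieldDerivation hW (hY j) _ hx

lemma algFun_update (f : Fin p → smoothAlgebra n W) (k : Fin p) (u : smoothAlgebra n W) :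
    (fun i => algFun (Function.update f k u i)) =
      Function.update (fun i => algFun (f i)) k (algFun u) := by
  funext i
  by_cases hi : i = k
  · subst hi; simp
  · simp [hi]

/-- The dictionary between the analytic identity at all points of W and an identity in the algebra
of smooth functions. Openness of W is needed because outer brackets differentiate inner ones. -/
lemma fundamentalAt_iff (hW : IsOpen W) {br : (Fin p → smoothAlgebra n W) → smoothAlgebra n W}
    (hb : ∀ f, ∀ x ∈ W, algFun (br f) x = nambuBracket P (fun i => algFun (f i)) x) (l : Fin p)
    (F g : Fin p → smoothAlgebra n W) :
    (∀ x ∈ W, FundamentalAt P l (fun i => algFun (F i)) (fun i => algFun (g i)) x) ↔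
      br (Function.update F l (br g)) =
        ∑ k, br (Function.update g k (br (Function.update F l (g k)))) := by
  have hev : ∀ (F f : Fin p → smoothAlgebra n W) l, ∀ x ∈ W,
      nambuBracket P (Function.update (fun i => algFun (F i)) l
        (nambuBracket P (fun i => algFun (f i)))) x =
      algFun (br (Function.update F l (br f))) x := by
    intro F f l x hx
    rw [hb _ x hx, algFun_update]
    exact nambuBracket_congr (eventuallyEq_update (fun i => Filter.EventuallyEq.rfl) l
      (Filter.eventuallyEq_of_mem (hW.mem_nhds hx) fun y hy => (hb f y hy).symm))
  have key : ∀ x ∈ W, FundamentalAt P l (fun i => algFun (F i)) (fun i => algFun (g i)) x ↔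
      algFun (br (Function.update F l (br g))) x =
      algFun (∑ k, br (Function.update g k (br (Function.update F l (g k))))) x := by
    intro x hx
    have h1 : algFun (∑ k, br (Function.update g k (br (Function.update F l (g k))))) x =
        ∑ k, algFun (br (Function.update g k (br (Function.update F l (g k))))) x := by
      rw [← evalAlgebra_apply hx, map_sum]
      exact Finset.sum_congr rfl fun k _ => evalAlgebra_apply hx _
    rw [FundamentalAt, hev F g l x hx, h1]
    refine Eq.congr_right (Finset.sum_congr rfl fun k _ => ?_)
    rw [← hev g _ k x hx, algFun_update]
  refine ⟨fun H => algFun_ext fun x hx => (key x hx).1 (H x hx), fun H x hx => ?_⟩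
  rw [key x hx, H]

/-- A multivector field spanned by commuting vector fields is a Nambu structure. -/
lemma isNambuOn_of_commute (hp : 0 < p) (hW : IsOpen W) {Y : Fin p → VField n M}
    (hY : ∀ j, SmoothVField W (Y j)) {h : M → ℝ} (hh : SmoothFun n W h)
    (hP : ∀ x ∈ W, P x = h x • wedgeVec (fun j => Y j x))
    (hc : ∀ i j (f : M → ℝ), SmoothFun n W f → ∀ x ∈ W,
      act (Y i) (act (Y j) f) x = act (Y j) (act (Y i) f) x) : IsNambuOn W P := by
  rw [isNambuOn_iff hp]
  constructor
  · intro V hV hVW f hf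
    refine ((hh.mono hVW).mul (SmoothFun.det (A := fun i j x => act (Y j) (f i) x) fun i j =>
      ((hY j).mono hVW).act hV (hf i))).congr fun x hx => ?_
    rw [nambuBracket, hP x (hVW hx), AlternatingMap.smul_apply, wedgeVec_apply, smul_eq_mul]
    rfl
  · intro F g hF hg x hx
    have hD : ∀ i j (u : smoothAlgebra n W), vfieldDerivation hW (hY i)
        (vfieldDerivation hW (hY j) u) = vfieldDerivation hW (hY j)
        (vfieldDerivation hW (hY i) u) := by
      have h1 : ∀ i j (u : smoothAlgebra n W), ∀ x ∈ W, algFun (vfieldDerivation hW (hY i)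
          (vfieldDerivation hW (hY j) u)) x = act (Y i) (act (Y j) (algFun u)) x := by
        intro i j u x hx
        rw [algFun_vfieldDerivation hW (hY i) _ hx, act, act]
        rw [dF_congr (Filter.eventuallyEq_of_mem (hW.mem_nhds hx)
          fun y hy => algFun_vfieldDerivation hW (hY j) u hy)]
      intro i j u
      refine algFun_ext fun x hx => ?_
      rw [h1 i j u x hx, h1 j i u x hx]
      exact hc i j _ (smoothFun_algFun u) x hx
    have H := (fundamentalAt_iff hW
      (fun f x hx => algFun_detBracket hW hY hh hP f hx) ⟨p - 1, by omega⟩ (fun i => (hF i).toAlgebra)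
      fun i => (hg i).toAlgebra).2 (detBracket_fundamental _ hD _ _ _ _) x hx
    exact H.congr
      (fun i => Filter.eventuallyEq_of_mem (hW.mem_nhds hx) fun y hy =>
        (algFun_toAlgebra (hF i) hy).symm)
      (fun i => Filter.eventuallyEq_of_mem (hW.mem_nhds hx) fun y hy =>
        (algFun_toAlgebra (hg i) hy).symm)

/-- The vector fields spanning a Nambu structure commute if they are dual to the differentials of
some functions. -/
lemma IsNambuOn.commute (hp : 0 < p) (hPN : IsNambuOn W P) (hW : IsOpen W)
    {Y : Fin p → VField n M} (hY : ∀ j, SmoothVField W (Y j)) {h : M → ℝ} (hh : SmoothFun n W h)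
    (h0 : ∀ x ∈ W, h x ≠ 0) (hP : ∀ x ∈ W, P x = h x • wedgeVec (fun j => Y j x))
    {y : Fin p → M → ℝ} (hy : ∀ i, SmoothFun n W (y i))
    (hYy : ∀ i j, ∀ x ∈ W, dF n (y j) x (Y i x) = if i = j then 1 else 0) (i j : Fin p)
    {f : M → ℝ} (hf : SmoothFun n W f) (hx : x ∈ W) :
    act (Y i) (act (Y j) f) x = act (Y j) (act (Y i) f) x := by
  have hev : ∀ {u : M → ℝ} (hu : SmoothFun n W u), ∀ x ∈ W, dF n (algFun hu.toAlgebra) x =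
      dF n u x := fun hu x hx =>
    dF_congr (Filter.eventuallyEq_of_mem (hW.mem_nhds hx) fun y hy => algFun_toAlgebra hu hy)
  have H := commute_of_fundamental (fun j => vfieldDerivation hW (hY j)) hh.toAlgebra
    ⟨p - 1, by omega⟩ (fun F g => (fundamentalAt_iff hW
      (fun f x hx => algFun_detBracket hW hY hh hP f hx) _ F g).1 fun x hx =>
      ((isNambuOn_iff hp).1 hPN).2 _ _ (fun i => smoothFun_algFun _)
        (fun i => smoothFun_algFun _) x hx) (fun i => (hy i).toAlgebra) (fun i j => by
      refine algFun_ext fun x hx => ?_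
      rw [algFun_vfieldDerivation hW (hY i) _ hx, act, hev (hy j) x hx, hYy i j x hx,
        ← evalAlgebra_apply hx]
      split_ifs <;> simp) i j hf.toAlgebra
  have H2 := congrArg (evalAlgebra hx) H
  have h1 : ∀ i j, evalAlgebra hx (vfieldDerivation hW (hY i)
      (vfieldDerivation hW (hY j) hf.toAlgebra)) = act (Y i) (act (Y j) f) x := by
    intro i j
    rw [evalAlgebra_apply, algFun_vfieldDerivation hW (hY i) _ hx, act, act]
    rw [dF_congr (f := algFun (vfieldDerivation hW (hY j) hf.toAlgebra)) (g := act (Y j) f)]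
    refine Filter.eventuallyEq_of_mem (hW.mem_nhds hx) fun y hy => ?_
    rw [algFun_vfieldDerivation hW (hY j) _ hy, act, act, hev hf y hy]
  rw [map_mul, map_mul, map_sub, map_zero, h1, h1, evalAlgebra_apply, algFun_toAlgebra hh hx] at H2
  exact sub_eq_zero.1 ((mul_eq_zero.1 H2).resolve_left (mul_ne_zero (h0 x hx) (h0 x hx)))

end Derivations

/-! ### Bases adapted to given covectors -/

section DualBases

variable {V : Type*} [AddCommGroup V] [Module ℝ V] [TopologicalSpace V]
  [IsTopologicalAddGroup V] [ContinuousSMul ℝ V] [T2Space V] [FiniteDimensional ℝ V]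

/-- Reflexivity of a finite dimensional space; it converts slot functionals into tangent vectors. -/
lemma exists_vector_of_functional (Λ : (V →L[ℝ] ℝ) →ₗ[ℝ] ℝ) :
    ∃ v : V, ∀ α : V →L[ℝ] ℝ, α v = Λ α := by
  let b := Module.finBasis ℝ V
  refine ⟨∑ i, Λ (LinearMap.toContinuousLinearMap (b.coord i)) • b i, fun α => ?_⟩
  have h : α = ∑ i, α (b i) • LinearMap.toContinuousLinearMap (b.coord i) := by
    refine ContinuousLinearMap.ext fun v => ?_
    conv_lhs => rw [← b.sum_repr v, map_sum]
    rw [sum_apply]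
    refine Finset.sum_congr rfl fun i _ => ?_
    rw [map_smul, smul_eq_mul, mul_comm]
    rfl
  conv_rhs => rw [h]
  rw [map_sum, map_sum]
  refine Finset.sum_congr rfl fun i _ => ?_
  rw [map_smul, map_smul, smul_eq_mul, smul_eq_mul, mul_comm]

lemma finrank_continuousDual : Module.finrank ℝ (V →L[ℝ] ℝ) = Module.finrank ℝ V := by
  rw [← Subspace.dual_finrank_eq (K := ℝ) (V := V)]
  exact (LinearMap.toContinuousLinearMap (𝕜 := ℝ) (E := V) (F' := ℝ)).finrank_eq.symm

instance finiteDimensional_continuousDual : FiniteDimensional ℝ (V →L[ℝ] ℝ) :=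
  Module.Finite.equiv (LinearMap.toContinuousLinearMap (𝕜 := ℝ) (E := V) (F' := ℝ))

lemma exists_basis_of_dual {n : ℕ} (hn : Module.finrank ℝ V = n) (ε : Fin n → (V →L[ℝ] ℝ))
    (v : Fin n → V) (h : ∀ i j, ε i (v j) = if i = j then 1 else 0) :
    ∃ c : Module.Basis (Fin n) ℝ V, (∀ j, c j = v j) ∧
      ∀ i, LinearMap.toContinuousLinearMap (c.coord i) = ε i := by
  have hv : LinearIndependent ℝ v := by
    rw [Fintype.linearIndependent_iff]
    intro r hr i
    have := congrArg (ε i) hr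
    rw [map_sum, map_zero] at this
    simpa [h] using this
  -- The construction of a basis from an independent family asks for a nonempty index type.
  rcases Nat.eq_zero_or_pos n with h0 | h0
  · subst h0
    have : Subsingleton V := Module.finrank_zero_iff.1 hn
    exact ⟨Module.Basis.empty V, fun j => j.elim0, fun i => i.elim0⟩
  have : Nonempty (Fin n) := ⟨⟨0, h0⟩⟩
  let c := basisOfLinearIndependentOfCardEqFinrank hv (by simp [hn])
  have hc : ∀ j, c j = v j := fun j => by simp [c]
  refine ⟨c, hc, fun i => ?_⟩
  have : c.coord i = (ε i : V →ₗ[ℝ] ℝ) := by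
    refine c.ext fun j => ?_
    rw [ContinuousLinearMap.coe_coe, hc, h, ← hc, Module.Basis.coord_apply,
      Module.Basis.repr_self, Finsupp.single_apply]
    simp [eq_comm]
  ext w
  exact congrArg (fun A => A w) this

/-- The covectors θ are completed to a basis of the dual space, arranged to come last, and
reflexivity supplies the basis of V to which it is dual. -/
lemma exists_basis_extending {p : ℕ} (hn : Module.finrank ℝ V = p + 2) {θ : Fin 2 → (V →L[ℝ] ℝ)}
    (hθ : LinearIndependent ℝ θ) : ∃ c : Module.Basis (Fin (p + 2)) ℝ V,
      ∀ i, LinearMap.toContinuousLinearMap (c.coord (Fin.natAdd p i)) = θ i := by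
  classical
  let B := Module.Basis.sumExtend hθ
  have : Fintype (Fin 2 ⊕ Module.Basis.sumExtendIndex hθ) := Module.Basis.fintypeIndexOfRankLtAleph0 B
    (Module.rank_lt_aleph0 ℝ _)
  have : Fintype (Module.Basis.sumExtendIndex hθ) := Fintype.ofInjective
    (Sum.inr : _ → Fin 2 ⊕ Module.Basis.sumExtendIndex hθ) Sum.inr_injective
  have hcard : Fintype.card (Module.Basis.sumExtendIndex hθ) = p := by
    have h1 := Module.finrank_eq_nat_card_basis B
    rw [finrank_continuousDual, hn, Nat.card_sum, Nat.card_eq_fintype_card,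
      Nat.card_eq_fintype_card, Fintype.card_fin] at h1
    omega
  let e := ((Equiv.sumComm (Fin 2) (Module.Basis.sumExtendIndex hθ)).trans
    (Equiv.sumCongr (Fintype.equivFinOfCardEq hcard) (Equiv.refl (Fin 2)))).trans
    (finSumFinEquiv (m := p) (n := 2))
  let B' := B.reindex e
  have hB' : ∀ i, B' (Fin.natAdd p i) = θ i := by
    intro i
    have : e.symm (Fin.natAdd p i) = Sum.inl i := by
      rw [Equiv.symm_apply_eq]
      simp [e]
    rw [Module.Basis.reindex_apply, this]
    simp only [B, Module.Basis.sumExtend, Module.Basis.reindex_apply, Module.Basis.extend_apply_self]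
    rfl
  choose v hv using fun j => exists_vector_of_functional (B'.coord j)
  obtain ⟨c, -, hc⟩ := exists_basis_of_dual hn B' v (fun i j => by
    rw [hv, Module.Basis.coord_apply, Module.Basis.repr_self, Finsupp.single_apply])
  exact ⟨c, fun i => (hc _).trans (hB' i)⟩

end DualBases

/-! ### Smooth dual frames -/

section Frames

variable {n p : ℕ} {M : Type*} [TopologicalSpace M]
  [ChartedSpace (EuclideanSpace ℝ (Fin n)) M] [IsManifold (𝓡 n) ∞ M] {U W : Set M} {x : M}

lemma finrank_tangentSpace (x : M) : Module.finrank ℝ (TangentSpace (𝓡 n) x) = n :=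
  finrank_euclideanSpace_fin (𝕜 := ℝ) (n := n)

lemma smoothVField_of_local {X : VField n M}
    (h : ∀ x ∈ U, ∃ W, IsOpen W ∧ x ∈ W ∧ SmoothVField (U ∩ W) X) : SmoothVField U X :=
  contMDiffOn_of_locally_contMDiffOn h

/-- Independent smooth 1-forms have a smooth dual frame. -/
lemma exists_dual_frame {ε : Fin n → CovField n M} (hU : IsOpen U)
    (hε : ∀ i, SmoothCovField U (ε i)) (hx : x ∈ U) (hi : LinearIndependent ℝ (fun i => ε i x)) :
    ∃ W, IsOpen W ∧ x ∈ W ∧ W ⊆ U ∧ ∃ Y : Fin n → VField n M, (∀ j, SmoothVField W (Y j)) ∧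
      ∀ y ∈ W, ∀ i j, ε i y (Y j y) = if i = j then 1 else 0 := by
  have hφ := chartAt_mem (n := n) x
  have hxs := mem_chart_source (EuclideanSpace ℝ (Fin n)) x
  set φ := chartAt (EuclideanSpace ℝ (Fin n)) x with hφd
  have hUφ : IsOpen (U ∩ φ.source) := hU.inter φ.open_source
  have hC : ∀ j, SmoothVField (U ∩ φ.source) (coordVector φ j) := fun j =>
    (smoothVField_coordVector hφ j).mono Set.inter_subset_right
  -- The dual frame is obtained by Cramer's rule from the matrix of the forms on coordinate fields;
  -- where its determinant is nonzero all entries of the inverse are smooth.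
  let N : M → Matrix (Fin n) (Fin n) ℝ := fun y => Matrix.of fun i j => ε i y (coordVector φ j y)
  have hN : ∀ i j, SmoothFun n (U ∩ φ.source) (fun y => N y i j) := fun i j =>
    ((hε i).mono Set.inter_subset_left).evalForm hUφ (hC j)
  have hdet : SmoothFun n (U ∩ φ.source) (fun y => (N y).det) := SmoothFun.det hN
  have hadj : ∀ i j, SmoothFun n (U ∩ φ.source) (fun y => (N y).adjugate i j) := by
    intro i j
    refine (SmoothFun.det (A := fun a b y => (N y).updateRow j (Pi.single i 1) a b) ?_).congr
      fun y _ => Matrix.adjugate_apply _ _ _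
    intro a b
    by_cases ha : a = j
    · subst ha
      simpa using smoothFun_const _ _
    · simpa [Matrix.updateRow_ne ha] using hN a b
  -- A left null vector of N(x) would be a linear relation between the forms at x.
  have hdx : (N x).det ≠ 0 := by
    intro h0
    obtain ⟨v, hv0, hv⟩ := Matrix.exists_vecMul_eq_zero_iff.2 h0
    apply hv0
    rw [Fintype.linearIndependent_iff] at hi
    refine funext fun i => hi v ?_ i
    refine ContinuousLinearMap.ext fun w => ?_
    rw [← sum_coordVector hφ hxs w, map_sum]
    refine Finset.sum_eq_zero fun j _ => ?_
    have := congrFun hv j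
    rw [map_smul, sum_apply]
    refine smul_eq_zero_of_right _ ?_
    exact this
  refine ⟨(U ∩ φ.source) ∩ (fun y => (N y).det) ⁻¹' {0}ᶜ,
    (ContMDiffOn.continuousOn hdet).isOpen_inter_preimage hUφ isOpen_compl_singleton,
    ⟨⟨hx, hxs⟩, hdx⟩, fun y hy => hy.1.1,
    fun j y => ∑ k, (((N y).det)⁻¹ * (N y).adjugate k j) • coordVector φ k y, fun j => ?_, ?_⟩
  · refine SmoothVField.sum fun k _ => SmoothVField.smul
      (((hdet.mono Set.inter_subset_left).inv fun y hy => hy.2).mul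
        ((hadj k j).mono Set.inter_subset_left)) ((hC k).mono Set.inter_subset_left)
  · intro y hy i j
    rw [map_sum]
    have h1 : ∀ k, ε i y ((((N y).det)⁻¹ * (N y).adjugate k j) • coordVector φ k y) =
        ((N y).det)⁻¹ * (N y i k * (N y).adjugate k j) := by
      intro k
      rw [map_smul, smul_eq_mul]
      change _ * N y i k = _
      ring
    simp only [h1]
    rw [← Finset.mul_sum, ← Matrix.mul_apply, Matrix.mul_adjugate, Matrix.smul_apply,
      Matrix.one_apply, smul_eq_mul, ← mul_assoc, inv_mul_cancel₀ hy.2, one_mul]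

end Frames

/-! ### Local product form of a Nambu structure -/

section LocalForm

variable {p : ℕ} {M : Type*} [TopologicalSpace M]
  [ChartedSpace (EuclideanSpace ℝ (Fin (p + 2))) M] [IsManifold (𝓡 (p + 2)) ∞ M]
  {U W : Set M} {x : M} {P : MultiField (p + 2) M p}

/-- Near a point where it does not vanish, a Nambu structure is a multiple of a product of vector
fields that are dual to the differentials of given functions. -/
lemma IsNambuOn.exists_local_form [T2Space M] (hp : 2 ≤ p) (hP : IsNambuOn Set.univ P)
    (hdec : p = 2 → ∀ x : M, ∃ X : Fin p → TangentSpace (𝓡 (p + 2)) x, IsWedgeOf (P x) X)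
    (hW : IsOpen W) {y : Fin p → M → ℝ} (hy : ∀ i, SmoothFun (p + 2) W (y i))
    (h0 : ∀ x ∈ W, nambuBracket P y x ≠ 0) :
    ∃ Y : Fin p → VField (p + 2) M, (∀ j, SmoothVField W (Y j)) ∧
      (∀ i j, ∀ x ∈ W, dF (p + 2) (y j) x (Y i x) = if i = j then 1 else 0) ∧
      ∀ x ∈ W, P x = nambuBracket P y x • wedgeVec (fun j => Y j x) := by
  -- Y_k represents the functional α ↦ Π(dy₁, …, α, …, dy_p) / {y₁, …, y_p}, with α in slot k.
  choose Y hY using fun (k : Fin p) (x : M) => exists_vector_of_functional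
    (slotFunctional (P x) (fun i => dF (p + 2) (y i) x) k)
  refine ⟨Y, fun k => ?_, fun i j x hx => ?_, fun x hx => ?_⟩
  -- The coordinates of Y_k are quotients of Nambu brackets of smooth functions.
  · refine smoothVField_of_local fun x _ => ?_
    have hφ := chartAt_mem (n := p + 2) x
    set φ := chartAt (EuclideanSpace ℝ (Fin (p + 2))) x with hφd
    refine ⟨φ.source, φ.open_source, mem_chart_source _ x,
      smoothVField_of_coord hφ Set.inter_subset_right fun i => ?_⟩
    have hWφ : IsOpen (W ∩ φ.source) := hW.inter φ.open_source
    have hy' : ∀ i, SmoothFun (p + 2) (W ∩ φ.source) (y i) := fun i =>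
      (hy i).mono Set.inter_subset_left
    refine (((hP.1 _ hWφ (Set.subset_univ _) y hy').inv fun z hz => h0 z hz.1).mul
      (hP.1 _ hWφ (Set.subset_univ _) (Function.update y k fun z => φ z i) fun j => ?_)).congr
      fun z hz => ?_
    · by_cases hj : j = k
      · subst hj
        simpa using (smoothFun_coord hφ i).mono Set.inter_subset_right
      · simpa [hj] using hy' j
    · rw [hY, slotFunctional_apply, nambuBracket_update]
      rfl
  · rw [hY, slotFunctional_self _ (h0 x hx)]
  · refine AlternatingMap.ext fun α => ?_
    have hE : Module.finrank ℝ (TangentSpace (𝓡 (p + 2)) x →L[ℝ] ℝ) = p + 2 :=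
      finrank_continuousDual.trans (finrank_tangentSpace x)
    rw [eq_det_of_annihilated (P x) (y := fun i => dF (p + 2) (y i) x) (h0 x hx) ?_ α,
      AlternatingMap.smul_apply, wedgeVec_apply, smul_eq_mul]
    · simp only [hY]
      rfl
    · intro a ha f i
      -- Order 2 uses the assumed decomposability, order at least 3 the quadratic identity.
      rcases hp.eq_or_lt with h2 | h3
      · obtain ⟨X, hX⟩ := hdec h2.symm x
        exact annihilated_of_isWedgeOf hX (h0 x hx) a ha f i
      · have hil : (⟨0, by omega⟩ : Fin p) ≠ ⟨p - 1, by omega⟩ := by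
          intro h
          have := congrArg Fin.val h
          simp at this
          omega
        exact annihilated_of_quadratic_identity hE h3 (P x) (h0 x hx) hil
          (fun F g a b => hP.quadratic_identity (by omega) x hil F g a b) a ha f i

end LocalForm

/-! ### From Dirac structures to Nambu structures -/

section Converse

variable {p : ℕ} {M : Type*} [TopologicalSpace M]
  [ChartedSpace (EuclideanSpace ℝ (Fin (p + 2))) M] [IsManifold (𝓡 (p + 2)) ∞ M]
  {U W : Set M} {x : M}

lemma eq_zero_of_wedge_eq_zero {V : Type*} [AddCommGroup V] [Module ℝ V] [TopologicalSpace V]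
    [IsTopologicalAddGroup V] [ContinuousSMul ℝ V] {a b : V →L[ℝ] ℝ}
    (hab : LinearIndependent ℝ ![a, b]) {v : V} (h : ∀ w, a v * b w - a w * b v = 0) :
    a v = 0 ∧ b v = 0 := by
  have h1 : (-(b v)) • a + (a v) • b = 0 := by
    ext w
    change -(b v) * a w + a v * b w = 0
    linarith [h w]
  have h2 := (LinearIndependent.pair_iff.1 hab) _ _ h1
  exact ⟨h2.2, neg_eq_zero.1 h2.1⟩

lemma smoothCovField_zero {n : ℕ} {M : Type*} [TopologicalSpace M]
    [ChartedSpace (EuclideanSpace ℝ (Fin n)) M] [IsManifold (𝓡 n) ∞ M] (U : Set M) :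
    SmoothCovField U (fun _ => 0 : CovField n M) :=
  fun W _ _ _ _ => smoothFun_const W 0

/-- The kernel of the 2-form of a Dirac structure is involutive. -/
lemma IsInvolutiveOn.kernel_bracket {n : ℕ} {M : Type*} [TopologicalSpace M]
    [ChartedSpace (EuclideanSpace ℝ (Fin n)) M] [IsManifold (𝓡 n) ∞ M]
    {θ₁ θ₂ η : CovField n M} {β : FormField n M 2}
    (hη : SmoothCovField Set.univ η) (hind : ∀ x, LinearIndependent ℝ ![θ₁ x, θ₂ x])
    (hβ : ∀ x, β x = wedge ![θ₁ x, θ₂ x]) (h : IsInvolutiveOn Set.univ (graphFamily β η))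
    {X Y : VField n M} (hX : SmoothVField Set.univ X) (hY : SmoothVField Set.univ Y)
    (hX0 : ∀ x, θ₁ x (X x) = 0 ∧ θ₂ x (X x) = 0) (hY0 : ∀ x, θ₁ x (Y x) = 0 ∧ θ₂ x (Y x) = 0)
    (x : M) : θ₁ x (VectorField.mlieBracket (𝓡 n) X Y x) = 0 ∧
      θ₂ x (VectorField.mlieBracket (𝓡 n) X Y x) = 0 := by
  -- For X in the kernel of β these are sections of the family with zero dual part, so the bracket
  -- of two of them again has zero dual part. Membership then says that β annihilates [X, Y].
  let sec : VField n M → Sec n M := fun X x => ((X x, -η x (X x)), (0, 0))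
  have hs : ∀ {X : VField n M}, SmoothVField Set.univ X → SmoothSec Set.univ (sec X) := fun hX =>
    ⟨hX, (hη.evalForm isOpen_univ hX).neg, smoothCovField_zero _, smoothFun_const _ 0⟩
  have hm : ∀ {X : VField n M}, (∀ x, θ₁ x (X x) = 0 ∧ θ₂ x (X x) = 0) →
      ∀ x ∈ Set.univ, sec X x ∈ graphFamily β η x := by
    intro X hX x _
    change sec X x ∈ graphFibre (β x) (η x)
    rw [mem_graphFibre]
    refine ⟨rfl, ContinuousLinearMap.ext fun w => ?_⟩
    change (0 : ℝ) = interiorProd (β x) (X x) w + 0 * η x w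
    rw [interiorProd_apply, hβ, wedge_pair, (hX x).1, (hX x).2]
    ring
  have key := h _ _ (hs hX) (hs hY) (hm hX0) (hm hY0) x trivial
  have key2 := (mem_graphFibre.1 key).2
  have hz : ∀ c : ℝ, dF n (fun _ : M => c) x = 0 := dF_const
  have hg : (bracket (sec X) (sec Y) x).2.2 = 0 := by
    change dF n (fun _ => 0) x (X x) - dF n (fun _ => 0) x (Y x)
      + (1 / 2) * ((0 : ℝ) - 0 - -η x (Y x) * 0 + -η x (X x) * 0) = 0
    rw [hz]
    change (0 : ℝ) - 0 + _ = 0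
    ring
  have hlie : ∀ {Z : VField n M}, SmoothVField Set.univ Z → lieForm Z (fun _ => 0) x = 0 := by
    intro Z hZ
    refine ContinuousLinearMap.ext fun v => ?_
    have hs := smoothVField_extendVector x v
    have ho := (chartAt (EuclideanSpace ℝ (Fin n)) x).open_source
    have := lieForm_apply ho (smoothCovField_zero _) (hZ.mono (Set.subset_univ _)) hs
      (mem_chart_source _ x)
    rw [extendVector_self] at this
    refine this.trans ?_
    change dF n (fun _ => (0 : ℝ)) x (Z x) - (0 : ℝ) = 0
    rw [hz, sub_zero]
    rfl
  have hα : (bracket (sec X) (sec Y) x).2.1 = 0 := by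
    change lieForm X (fun _ => 0) x - lieForm Y (fun _ => 0) x
        + (1 / 2 : ℝ) • dF n (fun y => (0 : ℝ) - 0) x
        + (-η x (X x)) • (0 : TangentSpace (𝓡 n) x →L[ℝ] ℝ) - (-η x (Y x)) • 0
        + (1 / 2 : ℝ) • ((0 : ℝ) • dF n (fun x => -η x (X x)) x - (0 : ℝ) • dF n (fun x => -η x (Y x)) x
            - (-η x (X x)) • dF n (fun _ => (0 : ℝ)) x + (-η x (Y x)) • dF n (fun _ => (0 : ℝ)) x) = 0
    rw [hlie hX, hlie hY, hz, hz]
    simp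
  rw [hg, hα, zero_smul, add_zero] at key2
  refine eq_zero_of_wedge_eq_zero (hind x) fun w => ?_
  rw [← wedge_pair, ← hβ, ← interiorProd_apply]
  exact (congrArg (fun A => A w) key2).symm

/-- The form of a Dirac structure `L_(θ₁ ∧ θ₂, d ln |f|)` is the contraction of any volume form
with a unique Nambu structure. -/
lemma exists_unique_nambu [T2Space M] (hp : 2 ≤ p) {θ₁ θ₂ η : CovField (p + 2) M}
    {β : FormField (p + 2) M 2} (hη : SmoothCovField Set.univ η)
    (hθ₁ : SmoothCovField Set.univ θ₁) (hθ₂ : SmoothCovField Set.univ θ₂)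
    (hind : ∀ x, LinearIndependent ℝ ![θ₁ x, θ₂ x]) (hβ : ∀ x, β x = wedge ![θ₁ x, θ₂ x])
    (h : IsInvolutiveOn Set.univ (graphFamily β η)) {Ω : FormField (p + 2) M (p + 2)}
    (hU : IsOpen U) (hΩ : SmoothForm U Ω) (hΩ0 : ∀ x ∈ U, Ω x ≠ 0) :
    ∃ P : MultiField (p + 2) M p, IsNambuOn U P ∧ (∀ x ∈ U, contract (P x) (Ω x) = β x) ∧
      ∀ P' : MultiField (p + 2) M p, (∀ x ∈ U, contract (P' x) (Ω x) = β x) →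
        ∀ x ∈ U, P' x = P x := by
  choose c hc using fun x => exists_basis_extending (finrank_tangentSpace x) (hind x)
  set P : MultiField (p + 2) M p := fun x =>
    ((Ω x (c x))⁻¹) • wedgeVec (fun k => c x (Fin.castAdd 2 k)) with hPd
  have hP : ∀ x ∈ U, contract (P x) (Ω x) = β x := by
    intro x hx
    rw [hPd, contract_frame (c x) (hΩ0 x hx), hc, hc, hβ]
    rfl
  have huniq : ∀ P' : MultiField (p + 2) M p, ∀ x ∈ U, contract (P' x) (Ω x) = β x →
      P' x = P x := fun P' x hx h' =>
    eq_of_contract_eq (c x) (hΩ0 x hx) (h'.trans (hP x hx).symm)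
  refine ⟨P, ?_, hP, fun P' h' x hx => huniq P' x hx (h' x hx)⟩
  refine isNambuOn_of_local (by omega) fun x₀ hx₀ => ?_
  -- Their differentials at x₀ complete θ₁, θ₂ to a basis, hence to a coframe near x₀. Exact forms
  -- are chosen so that the dual fields will commute.
  let y : Fin p → M → ℝ := fun i =>
    linearFun x₀ (LinearMap.toContinuousLinearMap ((c x₀).coord (Fin.castAdd 2 i)))
  let ε : Fin (p + 2) → CovField (p + 2) M := fun i =>
    Fin.addCases (fun i => dF (p + 2) (y i)) (fun j => ![θ₁, θ₂] j) i
  have hεl : ∀ i, ε (Fin.castAdd 2 i) = dF (p + 2) (y i) := fun i => by simp [ε]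
  have hεr : ∀ j, ε (Fin.natAdd p j) = ![θ₁, θ₂] j := fun j => by simp [ε]
  set S := (chartAt (EuclideanSpace ℝ (Fin (p + 2))) x₀).source with hS
  have hUS : IsOpen (U ∩ S) := hU.inter (chartAt (EuclideanSpace ℝ (Fin (p + 2))) x₀).open_source
  have hys : ∀ i, SmoothFun (p + 2) (U ∩ S) (y i) := fun i =>
    (smoothFun_linearFun x₀ _).mono Set.inter_subset_right
  have hεs : ∀ i, SmoothCovField (U ∩ S) (ε i) := by
    intro i
    refine Fin.addCases (fun i => ?_) (fun j => ?_) i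
    · rw [hεl]
      exact smoothCovField_dF (hys i)
    · rw [hεr]
      fin_cases j
      · exact hθ₁.mono (Set.subset_univ _)
      · exact hθ₂.mono (Set.subset_univ _)
  have hε0 : ∀ i, ε i x₀ = LinearMap.toContinuousLinearMap ((c x₀).coord i) := by
    intro i
    refine Fin.addCases (fun i => ?_) (fun j => ?_) i
    · rw [hεl]
      exact dF_linearFun x₀ _
    · rw [hεr, hc]
      fin_cases j <;> rfl
  have hεi : LinearIndependent ℝ (fun i => ε i x₀) := by
    rw [Fintype.linearIndependent_iff]
    intro r hr i
    have := congrArg (fun A => A (c x₀ i)) hr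
    simp only [hε0] at this
    rw [sum_apply] at this
    simpa [Finsupp.single_apply] using this
  obtain ⟨W, hW, hxW, hWU, Y, hY, hεY⟩ := exists_dual_frame hUS hεs
    ⟨hx₀, mem_chart_source _ x₀⟩ hεi
  have hWU' : W ⊆ U := hWU.trans Set.inter_subset_left
  have hθY : ∀ (i : Fin p), ∀ x ∈ W, θ₁ x (Y (Fin.castAdd 2 i) x) = 0 ∧
      θ₂ x (Y (Fin.castAdd 2 i) x) = 0 := by
    intro i x hx
    have h1 := hεY x hx (Fin.natAdd p 0) (Fin.castAdd 2 i)
    have h2 := hεY x hx (Fin.natAdd p 1) (Fin.castAdd 2 i)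
    have hne : ∀ j : Fin 2, Fin.natAdd p j ≠ Fin.castAdd 2 i := by
      intro j hj
      have := congrArg Fin.val hj
      simp at this
      omega
    rw [hεr, if_neg (hne _)] at h1 h2
    exact ⟨h1, h2⟩
  have hyY : ∀ (i j : Fin p), ∀ x ∈ W, dF (p + 2) (y j) x (Y (Fin.castAdd 2 i) x) =
      if j = i then 1 else 0 := by
    intro i j x hx
    have h1 := hεY x hx (Fin.castAdd 2 j) (Fin.castAdd 2 i)
    rw [hεl] at h1
    rw [h1]
    simp
  refine ⟨W, hW, hxW, hWU', isNambuOn_of_commute (by omega) hW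
    (fun j => hY (Fin.castAdd 2 j)) (h := fun x => (Ω x (fun i => Y i x))⁻¹) ?_ ?_ ?_⟩
  · refine (hΩ W hW hWU' Y hY).inv fun x hx => ?_
    obtain ⟨b, hb, -⟩ := exists_basis_of_dual (finrank_tangentSpace x) (fun i => ε i x)
      (fun j => Y j x) (hεY x hx)
    rw [← funext hb]
    exact topForm_basis_ne_zero b (hΩ0 x (hWU' hx))
  · intro x hx
    obtain ⟨b, hb, hb2⟩ := exists_basis_of_dual (finrank_tangentSpace x) (fun i => ε i x)
      (fun j => Y j x) (hεY x hx)
    -- P is built from bases chosen independently at each point; uniqueness identifies it with an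
    -- expression in the smooth local frame.
    refine (huniq (fun x => (Ω x (fun i => Y i x))⁻¹ •
      wedgeVec (fun j => Y (Fin.castAdd 2 j) x)) x (hWU' hx) ?_).symm
    have h1 := contract_frame b (hΩ0 x (hWU' hx))
    simp only [hb2, hεr] at h1
    rw [funext hb] at h1
    rw [h1, hβ]
    rfl
  · intro i j f hf x hx
    -- Involutivity is known only for sections over all of M, so the frame fields are cut off; the
    -- cut-off fields stay in the kernel and agree with the old ones near x.
    obtain ⟨χ, hχ, hχ1, hχ0⟩ := exists_smoothVField_univ hW (hY (Fin.castAdd 2 i)) hx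
    obtain ⟨χ', hχ', hχ'1, hχ'0⟩ := exists_smoothVField_univ hW (hY (Fin.castAdd 2 j)) hx
    set X₁ : VField (p + 2) M := fun z => χ z • Y (Fin.castAdd 2 i) z with hX₁
    set X₂ : VField (p + 2) M := fun z => χ' z • Y (Fin.castAdd 2 j) z with hX₂
    have hker : ∀ (χ : M → ℝ) i, (∀ z ∉ W, χ z = 0) →
        ∀ z, θ₁ z (χ z • Y (Fin.castAdd 2 i) z) = 0 ∧ θ₂ z (χ z • Y (Fin.castAdd 2 i) z) = 0 := by
      intro χ i h0 z
      rw [map_smul, map_smul]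
      by_cases hz : z ∈ W
      · rw [(hθY i z hz).1, (hθY i z hz).2, smul_zero]
        exact ⟨rfl, rfl⟩
      · rw [h0 z hz, zero_smul, zero_smul]
        exact ⟨rfl, rfl⟩
    have hbr := h.kernel_bracket hη hind hβ hχ hχ' (hker χ i hχ0) (hker χ' j hχ'0) x
    have hact : ∀ u : M → ℝ, act X₁ u =ᶠ[𝓝 x] act (Y (Fin.castAdd 2 i)) u := by
      intro u
      filter_upwards [hχ1] with z hz
      simp only [act, hX₁, hz, one_smul]
    have hact' : ∀ u : M → ℝ, act X₂ u =ᶠ[𝓝 x] act (Y (Fin.castAdd 2 j)) u := by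
      intro u
      filter_upwards [hχ'1] with z hz
      simp only [act, hX₂, hz, one_smul]
    have hcomm : ∀ u : M → ℝ, SmoothFun (p + 2) W u →
        dF (p + 2) u x (VectorField.mlieBracket (𝓡 (p + 2)) X₁ X₂ x) =
        act (Y (Fin.castAdd 2 i)) (act (Y (Fin.castAdd 2 j)) u) x -
          act (Y (Fin.castAdd 2 j)) (act (Y (Fin.castAdd 2 i)) u) x := by
      intro u hu
      rw [act_mlieBracket hW (hχ.mono (Set.subset_univ _)) (hχ'.mono (Set.subset_univ _)) hu hx,
        (hact _).eq_of_nhds, (hact' _).eq_of_nhds, act, act, dF_congr (hact' u),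
        dF_congr (hact u)]
      rfl
    have hconst : ∀ i j k, act (Y (Fin.castAdd 2 i)) (act (Y (Fin.castAdd 2 j)) (y k)) x = 0 := by
      intro i j k
      rw [act, dF_congr (f := act (Y (Fin.castAdd 2 j)) (y k)) (g := fun _ => if k = j then 1 else 0)
        (Filter.eventuallyEq_of_mem (hW.mem_nhds hx) fun z hz => hyY j k z hz), dF_const]
      rfl
    -- The whole coframe kills the bracket: dy_k because the functions Y_i · y_k are constant, θ₁
    -- and θ₂ because the kernel is involutive.
    have hzero : VectorField.mlieBracket (𝓡 (p + 2)) X₁ X₂ x = 0 := by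
      obtain ⟨b, -, hb2⟩ := exists_basis_of_dual (finrank_tangentSpace x) (fun i => ε i x)
        (fun j => Y j x) (hεY x hx)
      refine b.ext_elem fun k => ?_
      rw [map_zero, Finsupp.zero_apply]
      refine Eq.trans (congrArg (fun A => A (VectorField.mlieBracket (𝓡 (p + 2)) X₁ X₂ x))
        (hb2 k)) ?_
      change ε k x _ = 0
      refine Fin.addCases (fun k => ?_) (fun k => ?_) k
      · rw [hεl, hcomm _ ((hys k).mono hWU), hconst, hconst, sub_zero]
      · rw [hεr]
        fin_cases k
        · exact hbr.1
        · exact hbr.2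
    have := hcomm f hf
    rw [hzero, map_zero] at this
    exact (sub_eq_zero.1 this.symm)

end Converse

/-! ### Charts from functions with independent differentials -/

section Charts

variable {n p : ℕ} {M : Type*} [TopologicalSpace M]
  [ChartedSpace (EuclideanSpace ℝ (Fin n)) M] [IsManifold (𝓡 n) ∞ M] {U W : Set M} {x : M}

/-- Functions with independent differentials at a point are the coordinates of a chart near it. -/
lemma exists_chart_of_linearIndependent {u : Fin n → M → ℝ} (hW : IsOpen W)
    (hu : ∀ i, SmoothFun n W (u i)) (hx : x ∈ W)
    (hi : LinearIndependent ℝ (fun i => dF n (u i) x)) :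
    ∃ φ ∈ IsManifold.maximalAtlas (𝓡 n) ∞ M, x ∈ φ.source ∧ φ.source ⊆ W ∧
      ∀ y ∈ φ.source, ∀ i, φ y i = u i y := by
  have hψ := chartAt_mem (n := n) x
  have hxs := mem_chart_source (EuclideanSpace ℝ (Fin n)) x
  set ψ := chartAt (EuclideanSpace ℝ (Fin n)) x with hψd
  let G : EuclideanSpace ℝ (Fin n) → EuclideanSpace ℝ (Fin n) := fun v =>
    WithLp.toLp 2 fun i => u i (ψ.symm v)
  have hO : IsOpen (ψ.target ∩ ψ.symm ⁻¹' W) := ψ.isOpen_inter_preimage_symm hW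
  have hG : ContDiffOn ℝ ∞ G (ψ.target ∩ ψ.symm ⁻¹' W) := by
    intro v hv
    refine (contDiffAt_piLp (p := 2)).2 (fun i => ?_) |>.contDiffWithinAt
    have := (hu i).comp_symm hψ hW (ψ.map_target hv.1) hv.2
    rw [ψ.right_inv hv.1] at this
    exact this
  have hmem : ψ x ∈ ψ.target ∩ ψ.symm ⁻¹' W :=
    ⟨ψ.map_source hxs, by simpa [ψ.left_inv hxs] using hx⟩
  have hGd : DifferentiableAt ℝ G (ψ x) :=
    (hG.contDiffAt (hO.mem_nhds hmem)).differentiableAt (by simp)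
  have hGi : ∀ i w, fderiv ℝ G (ψ x) (mfderiv (𝓡 n) (𝓡 n) ψ x w) i = dF n (u i) x w := by
    intro i w
    rw [dF_eq_fderiv hψ hxs ((hu i).mdifferentiableAt hW hx)]
    have h1 := ((EuclideanSpace.proj (𝕜 := ℝ) i :
      EuclideanSpace ℝ (Fin n) →L[ℝ] ℝ).hasFDerivAt.comp (ψ x) hGd.hasFDerivAt).fderiv
    exact (congrArg (fun A => A (mfderiv (𝓡 n) (𝓡 n) ψ x w)) h1).symm
  -- A vector killed by the derivative of G comes from a tangent vector killed by all the du_i,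
  -- which form a basis of covectors; injectivity suffices by finite dimension.
  have hinj : Function.Injective (fderiv ℝ G (ψ x)).toLinearMap := by
    rw [← LinearMap.ker_eq_bot, LinearMap.ker_eq_bot']
    intro v hv
    obtain ⟨w, hw⟩ := (mdifferentiable_of_mem hψ).mfderiv_surjective hxs v
    obtain ⟨W', -, hxW', -, Y, -, hY⟩ := exists_dual_frame hW (fun i => smoothCovField_dF (hu i))
      hx hi
    obtain ⟨c, -, hc⟩ := exists_basis_of_dual (finrank_tangentSpace x)
      (fun i => dF n (u i) x) (fun j => Y j x) (hY x hxW')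
    have hw0 : w = 0 := by
      refine c.ext_elem fun i => ?_
      rw [map_zero, Finsupp.zero_apply]
      refine Eq.trans (congrArg (fun A => A w) (hc i)) ?_
      change dF n (u i) x w = 0
      rw [← hGi i w, hw]
      exact congrArg (fun z : EuclideanSpace ℝ (Fin n) => z i) hv
    rw [← hw, hw0]
    exact map_zero _
  let f' : EuclideanSpace ℝ (Fin n) ≃L[ℝ] EuclideanSpace ℝ (Fin n) :=
    (LinearEquiv.ofInjectiveEndo _ hinj).toContinuousLinearEquiv
  have hf' : HasFDerivAt G (f' : EuclideanSpace ℝ (Fin n) →L[ℝ] _) (ψ x) := by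
    have : (f' : EuclideanSpace ℝ (Fin n) →L[ℝ] EuclideanSpace ℝ (Fin n)) = fderiv ℝ G (ψ x) :=
      ContinuousLinearMap.ext fun v => rfl
    rw [this]
    exact hGd.hasFDerivAt
  obtain ⟨e, hxe, hes, heG, he1, he2⟩ := exists_smooth_openPartialHomeomorph hO hG hmem hf'
  refine ⟨ψ.trans e, ?_, ?_, ?_, ?_⟩
  · refine OpenPartialHomeomorph.mem_maximalAtlas_of_contMDiffOn _ ?_ ?_
    · rw [OpenPartialHomeomorph.coe_trans]
      exact he1.contMDiffOn.comp ((contMDiffOn_of_mem_maximalAtlas hψ).mono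
        (by rw [OpenPartialHomeomorph.trans_source]; exact Set.inter_subset_left))
        (by rw [OpenPartialHomeomorph.trans_source]; exact Set.inter_subset_right)
    · rw [OpenPartialHomeomorph.coe_trans_symm]
      exact (contMDiffOn_symm_of_mem_maximalAtlas hψ).comp (he2.contMDiffOn.mono
        (by rw [OpenPartialHomeomorph.trans_target]; exact Set.inter_subset_left))
        (by rw [OpenPartialHomeomorph.trans_target]; exact Set.inter_subset_right)
  · rw [OpenPartialHomeomorph.trans_source]
    exact ⟨hxs, hxe⟩
  · rw [OpenPartialHomeomorph.trans_source]
    intro y hy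
    have := (hes hy.2).2
    rwa [Set.mem_preimage, ψ.left_inv hy.1] at this
  · intro y hy i
    rw [OpenPartialHomeomorph.trans_source] at hy
    rw [OpenPartialHomeomorph.coe_trans, Function.comp_apply, heG]
    change u i (ψ.symm (ψ y)) = _
    rw [ψ.left_inv hy.1]

end Charts

/-! ### Coordinates adapted to a decomposable p-vector -/

section NormalForm

variable {p : ℕ} {M : Type*} [TopologicalSpace M]
  [ChartedSpace (EuclideanSpace ℝ (Fin (p + 2))) M] [IsManifold (𝓡 (p + 2)) ∞ M] {y : M}

/-- The Y_j have no components along the last two coordinates, so passing to the first p coordinate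
vectors multiplies the wedge product by a determinant. Only h times this determinant has to be 1;
the Y_j themselves need not be coordinate vectors. -/
lemma isWedgeOf_coordVector {φ : OpenPartialHomeomorph M (EuclideanSpace ℝ (Fin (p + 2)))}
    (hφ : φ ∈ IsManifold.maximalAtlas (𝓡 (p + 2)) ∞ M) (hy : y ∈ φ.source)
    {P : (TangentSpace (𝓡 (p + 2)) y →L[ℝ] ℝ) [⋀^Fin p]→ₗ[ℝ] ℝ} {h : ℝ}
    {Y : Fin p → TangentSpace (𝓡 (p + 2)) y} (hP : P = h • wedgeVec Y)
    (hz : ∀ k j, dF (p + 2) (fun z => φ z (Fin.natAdd p k)) y (Y j) = 0)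
    (hdet : h * (Matrix.of fun i j =>
      dF (p + 2) (fun z => φ z (Fin.castAdd 2 i)) y (Y j)).det = 1) :
    IsWedgeOf P (fun j : Fin p => coordVector φ (Fin.castAdd 2 j) y) := by
  intro α
  have h1 : (Matrix.of fun i j => α i (Y j)) =
      (Matrix.of fun i j => α i (coordVector φ (Fin.castAdd 2 j) y)) *
      (Matrix.of fun i j => dF (p + 2) (fun z => φ z (Fin.castAdd 2 i)) y (Y j)) := by
    ext i j
    rw [Matrix.mul_apply, Matrix.of_apply]
    conv_lhs => rw [← sum_coordVector hφ hy (Y j), map_sum, Fin.sum_univ_add]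
    have h2 : ∑ k : Fin 2, α i (dF (p + 2) (fun z => φ z (Fin.natAdd p k)) y (Y j) •
        coordVector φ (Fin.natAdd p k) y) = 0 := by
      refine Finset.sum_eq_zero fun k _ => ?_
      rw [hz, zero_smul, map_zero]
    rw [h2, add_zero]
    refine Finset.sum_congr rfl fun k _ => ?_
    rw [map_smul, smul_eq_mul, mul_comm]
    rfl
  rw [hP, AlternatingMap.smul_apply, wedgeVec_apply, h1, Matrix.det_mul, smul_eq_mul,
    mul_left_comm, hdet, mul_one]

/-- Near a point where it does not vanish, a multivector field of degree `p` does not vanish on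
the differentials of some `p` among the coordinates of a chart. -/
lemma exists_coord_ne_zero {P : (TangentSpace (𝓡 (p + 2)) y →L[ℝ] ℝ) [⋀^Fin p]→ₗ[ℝ] ℝ}
    (hP : P ≠ 0) {φ : OpenPartialHomeomorph M (EuclideanSpace ℝ (Fin (p + 2)))}
    (hφ : φ ∈ IsManifold.maximalAtlas (𝓡 (p + 2)) ∞ M) (hy : y ∈ φ.source) :
    ∃ π : Equiv.Perm (Fin (p + 2)),
      P (fun k => dF (p + 2) (fun z => φ z (π (Fin.castAdd 2 k))) y) ≠ 0 := by
  obtain ⟨I, hI⟩ : ∃ I : Fin p → Fin (p + 2),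
      P (fun k => dF (p + 2) (fun z => φ z (I k)) y) ≠ 0 := by
    by_contra! hall
    apply hP
    refine AlternatingMap.ext fun α => ?_
    have hα : α = fun k => ∑ j, α k (coordVector φ j y) •
        dF (p + 2) (fun z => φ z j) y := by
      funext k
      refine ContinuousLinearMap.ext fun v => ?_
      conv_lhs => rw [← sum_coordVector hφ hy v, map_sum]
      rw [sum_apply]
      refine Finset.sum_congr rfl fun i _ => ?_
      rw [map_smul]
      exact mul_comm _ _
    rw [hα]
    refine (multilinear_expand P.toMultilinearMap _ _).trans (Finset.sum_eq_zero fun I _ => ?_)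
    exact mul_eq_zero_of_right _ (hall I)
  have hinj : Function.Injective I := by
    intro k l hkl
    by_contra hne
    exact hI (P.map_eq_zero_of_eq _ (by simp only [hkl]) hne)
  obtain ⟨π, hπ⟩ := exists_perm_extending I (Fin.castAdd 2) hinj (Fin.castAdd_injective p 2)
  exact ⟨π, by simpa only [hπ] using hI⟩

/-- The splitting of the coordinates into two groups. -/
def splitCoord (p : ℕ) (π : Equiv.Perm (Fin (p + 2))) :
    EuclideanSpace ℝ (Fin (p + 2)) ≃L[ℝ] (Fin p → ℝ) × (Fin 2 → ℝ) :=
  LinearEquiv.toContinuousLinearEquiv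
    { toFun := fun v => (fun k => v (π (Fin.castAdd 2 k)), fun k => v (π (Fin.natAdd p k)))
      map_add' := fun _ _ => rfl
      map_smul' := fun _ _ => rfl
      invFun := fun q => WithLp.toLp 2 fun i => Fin.append q.1 q.2 (π.symm i)
      left_inv := fun v => by
        refine PiLp.ext (α := fun _ : Fin (p + 2) => ℝ) fun i => ?_
        change Fin.append _ _ (π.symm i) = v i
        obtain ⟨j, rfl⟩ := π.surjective i
        rw [Equiv.symm_apply_apply]
        refine Fin.addCases (fun j => ?_) (fun j => ?_) j
        · rw [Fin.append_left]
        · rw [Fin.append_right]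
      right_inv := fun q => by
        refine Prod.ext (funext fun k => ?_) (funext fun k => ?_)
        · change Fin.append q.1 q.2 (π.symm (π _)) = _
          rw [Equiv.symm_apply_apply, Fin.append_left]
        · change Fin.append q.1 q.2 (π.symm (π _)) = _
          rw [Equiv.symm_apply_apply, Fin.append_right] }

lemma mfderiv_comp_apply {n : ℕ} {M : Type*} [TopologicalSpace M]
    [ChartedSpace (EuclideanSpace ℝ (Fin n)) M] {G G' : Type*} [NormedAddCommGroup G]
    [NormedSpace ℝ G] [NormedAddCommGroup G'] [NormedSpace ℝ G'] {f : G → G'} {ρ : M → G} {x : M}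
    (hf : DifferentiableAt ℝ f (ρ x)) (hρ : MDifferentiableAt (𝓡 n) 𝓘(ℝ, G) ρ x)
    (v : TangentSpace (𝓡 n) x) :
    (mfderiv (𝓡 n) 𝓘(ℝ, G') (fun y => f (ρ y)) x v : G') =
      fderiv ℝ f (ρ x) (mfderiv (𝓡 n) 𝓘(ℝ, G) ρ x v) := by
  have h := (hf.hasFDerivAt.hasMFDerivAt.comp x hρ.hasMFDerivAt).mfderiv
  exact congrArg (fun A => A v) h

end NormalForm

/-! ### Straightening of commuting vector fields -/

section Straightening

variable {p : ℕ} {M : Type*} [TopologicalSpace M]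
  [ChartedSpace (EuclideanSpace ℝ (Fin (p + 2))) M] [IsManifold (𝓡 (p + 2)) ∞ M]

/-- Commuting vector fields that are dual to the differentials of some of the coordinates of a
chart are coordinate vector fields for suitable coordinates. -/
lemma exists_straightening {ψ : OpenPartialHomeomorph M (EuclideanSpace ℝ (Fin (p + 2)))}
    (hψ : ψ ∈ IsManifold.maximalAtlas (𝓡 (p + 2)) ∞ M) {π : Equiv.Perm (Fin (p + 2))}
    {W : Set M} (hW : IsOpen W) (hWψ : W ⊆ ψ.source) {x₀ : M} (hx₀ : x₀ ∈ W)
    {Y : Fin p → VField (p + 2) M} (hY : ∀ k, SmoothVField W (Y k))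
    (hYy : ∀ i j, ∀ x ∈ W, dF (p + 2) (fun z => ψ z (π (Fin.castAdd 2 j))) x (Y i x) =
      if i = j then 1 else 0)
    (hc : ∀ i j (f : M → ℝ), SmoothFun (p + 2) W f → ∀ x ∈ W,
      act (Y i) (act (Y j) f) x = act (Y j) (act (Y i) f) x) :
    ∃ (S : Set M) (O : Set ((Fin p → ℝ) × (Fin 2 → ℝ))) (ρ : M → (Fin p → ℝ) × (Fin 2 → ℝ))
      (r : (Fin p → ℝ) × (Fin 2 → ℝ) → M), IsOpen S ∧ IsOpen O ∧ x₀ ∈ S ∧ S ⊆ W ∧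
      Set.MapsTo ρ S O ∧ (∀ z ∈ S, r (ρ z) = z) ∧
      ContMDiffOn (𝓡 (p + 2)) 𝓘(ℝ, (Fin p → ℝ) × (Fin 2 → ℝ)) ∞ ρ S ∧
      (∀ F : M → ℝ, SmoothFun (p + 2) W F → ContDiffOn ℝ ∞ (F ∘ r) O) ∧
      (∀ z ∈ S, ∀ k, (mfderiv (𝓡 (p + 2)) 𝓘(ℝ, (Fin p → ℝ) × (Fin 2 → ℝ)) ρ z (Y k z) :
        (Fin p → ℝ) × (Fin 2 → ℝ)) = (Pi.single k 1, 0)) ∧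
      ∀ g : (Fin p → ℝ) × (Fin 2 → ℝ), ∃ v : TangentSpace (𝓡 (p + 2)) x₀,
        (mfderiv (𝓡 (p + 2)) 𝓘(ℝ, (Fin p → ℝ) × (Fin 2 → ℝ)) ρ x₀ v :
          (Fin p → ℝ) × (Fin 2 → ℝ)) = g := by
  have hne : (∞ : WithTop ℕ∞) ≠ 0 := by simp
  let κ := splitCoord p π
  let c := ψ x₀
  -- Coordinates centred at x₀ and split into the p functions dual to the Y_k and the two others,
  -- called s_j; r is the inverse of q.
  let q : M → (Fin p → ℝ) × (Fin 2 → ℝ) := fun z => κ (ψ z - c)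
  let r : (Fin p → ℝ) × (Fin 2 → ℝ) → M := fun g => ψ.symm (κ.symm g + c)
  let s : Fin 2 → M → ℝ := fun j z => ψ z (π (Fin.natAdd p j))
  have hs : ∀ j, SmoothFun (p + 2) W (s j) := fun j => (smoothFun_coord hψ _).mono hWψ
  have haff : Continuous fun g => κ.symm g + c := κ.symm.continuous.add continuous_const
  let Q : Set ((Fin p → ℝ) × (Fin 2 → ℝ)) :=
    (fun g => κ.symm g + c) ⁻¹' (ψ.target ∩ ψ.symm ⁻¹' W)
  have hQ : IsOpen Q := (ψ.isOpen_inter_preimage_symm hW).preimage haff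
  have hqr : ∀ g ∈ Q, q (r g) = g := by
    intro g hg
    change κ (ψ (ψ.symm (κ.symm g + c)) - c) = g
    rw [ψ.right_inv hg.1, add_sub_cancel_right, κ.apply_symm_apply]
  have hκq : ∀ z, κ.symm (q z) + c = ψ z := by
    intro z
    change κ.symm (κ (ψ z - c)) + c = ψ z
    rw [κ.symm_apply_apply, sub_add_cancel]
  have hrq : ∀ z ∈ W, r (q z) = z := by
    intro z hz
    change ψ.symm (κ.symm (q z) + c) = z
    rw [hκq, ψ.left_inv (hWψ hz)]
  have hqQ : ∀ z ∈ W, q z ∈ Q := by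
    intro z hz
    change κ.symm (q z) + c ∈ ψ.target ∩ ψ.symm ⁻¹' W
    rw [hκq]
    exact ⟨ψ.map_source (hWψ hz), by rwa [Set.mem_preimage, ψ.left_inv (hWψ hz)]⟩
  have hFr : ∀ F : M → ℝ, SmoothFun (p + 2) W F → ContDiffOn ℝ ∞ (F ∘ r) Q := by
    intro F hF g hg
    have h1 := hF.comp_symm hψ hW (ψ.map_target hg.1) hg.2
    rw [ψ.right_inv hg.1] at h1
    have h2 : ContDiff ℝ ∞ fun g => κ.symm g + c := κ.symm.contDiff.add contDiff_const
    exact (h1.comp g h2.contDiffAt).contDiffWithinAt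
  have hqs : ContMDiffOn (𝓡 (p + 2)) 𝓘(ℝ, (Fin p → ℝ) × (Fin 2 → ℝ)) ∞ q ψ.source := by
    have h2 : ContDiff ℝ ∞ fun v => κ (v - c) := κ.contDiff.comp (contDiff_id.sub contDiff_const)
    exact h2.contMDiff.comp_contMDiffOn (contMDiffOn_of_mem_maximalAtlas hψ)
  have hqm : ∀ z ∈ W, MDifferentiableAt (𝓡 (p + 2)) 𝓘(ℝ, (Fin p → ℝ) × (Fin 2 → ℝ)) q z :=
    fun z hz => (hqs.contMDiffAt (ψ.open_source.mem_nhds (hWψ hz))).mdifferentiableAt hne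
  have hdsub : ∀ z ∈ W, ∀ i, dF (p + 2) (fun z => ψ z i - ψ x₀ i) z =
      dF (p + 2) (fun z => ψ z i) z := by
    intro z hz i
    rw [dF_sub ((smoothFun_coord hψ i).mdifferentiableAt ψ.open_source (hWψ hz))
      ((smoothFun_const ψ.source _).mdifferentiableAt ψ.open_source (hWψ hz)), dF_const, sub_zero]
  have hdq : ∀ z ∈ W, ∀ v, (mfderiv (𝓡 (p + 2)) 𝓘(ℝ, (Fin p → ℝ) × (Fin 2 → ℝ)) q z v :
      (Fin p → ℝ) × (Fin 2 → ℝ)) =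
      (fun k => dF (p + 2) (fun z => ψ z (π (Fin.castAdd 2 k))) z v,
        fun j => dF (p + 2) (s j) z v) := by
    intro z hz v
    refine Prod.ext (funext fun k => ?_) (funext fun j => ?_)
    · let L : (Fin p → ℝ) × (Fin 2 → ℝ) →L[ℝ] ℝ :=
        (ContinuousLinearMap.proj k).comp (ContinuousLinearMap.fst ℝ _ _)
      have h := mfderiv_comp_apply (f := L) L.differentiableAt (hqm z hz) v
      rw [L.fderiv] at h
      refine h.symm.trans ?_
      exact congrArg (fun A => A v) (hdsub z hz (π (Fin.castAdd 2 k)))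
    · let L : (Fin p → ℝ) × (Fin 2 → ℝ) →L[ℝ] ℝ :=
        (ContinuousLinearMap.proj j).comp (ContinuousLinearMap.snd ℝ _ _)
      have h := mfderiv_comp_apply (f := L) L.differentiableAt (hqm z hz) v
      rw [L.fderiv] at h
      refine h.symm.trans ?_
      exact congrArg (fun A => A v) (hdsub z hz (π (Fin.natAdd p j)))
  let b : Fin 2 → Fin p → M → ℝ := fun j k => act (Y k) (s j)
  have hb : ∀ j k, SmoothFun (p + 2) W (b j k) := fun j k => (hY k).act hW (hs j)
  -- By duality Y_k has unit component along its own coordinate and components Y_k · s_j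
  -- transversally, so the fields span the graph of a.
  let a : (Fin p → ℝ) × (Fin 2 → ℝ) → (Fin p → ℝ) →L[ℝ] (Fin 2 → ℝ) := fun g =>
    ContinuousLinearMap.pi fun j => ∑ k, b j k (r g) • ContinuousLinearMap.proj k
  have haj : ∀ g τ j, a g τ j = ∑ k, b j k (r g) * τ k := by
    intro g τ j
    simp [a]
  have ha : ContDiffOn ℝ ∞ a Q := by
    rw [contDiffOn_clm_apply]
    intro τ
    rw [contDiffOn_pi]
    intro j
    simp only [haj]
    exact ContDiffOn.sum fun k _ => (hFr _ (hb j k)).mul contDiffOn_const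
  have hdqY : ∀ z ∈ W, ∀ τ : Fin p → ℝ,
      (mfderiv (𝓡 (p + 2)) 𝓘(ℝ, (Fin p → ℝ) × (Fin 2 → ℝ)) q z (∑ k, τ k • Y k z) :
        (Fin p → ℝ) × (Fin 2 → ℝ)) = (τ, a (q z) τ) := by
    intro z hz τ
    rw [hdq z hz]
    refine Prod.ext (funext fun k => ?_) (funext fun j => ?_)
    · change dF (p + 2) (fun z => ψ z (π (Fin.castAdd 2 k))) z _ = τ k
      rw [map_sum]
      simp [hYy _ _ z hz]
    · change dF (p + 2) (s j) z _ = a (q z) τ j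
      rw [map_sum, haj, hrq z hz]
      refine Finset.sum_congr rfl fun k _ => ?_
      rw [map_smul]
      exact mul_comm _ _
  -- The derivative of a along the graph gives the second derivatives Y_l Y_k s_j, so Frobenius
  -- integrability is commutation tested on the s_j.
  have hint : ∀ g ∈ Q, ∀ τ τ' : Fin p → ℝ,
      fderiv ℝ a g (τ, a g τ) τ' = fderiv ℝ a g (τ', a g τ') τ := by
    have key : ∀ g ∈ Q, ∀ (τ τ' : Fin p → ℝ) j, fderiv ℝ a g (τ, a g τ) τ' j =
        ∑ k, ∑ l, τ' k * τ l * act (Y l) (act (Y k) (s j)) (r g) := by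
      intro g hg τ τ' j
      have hrg : r g ∈ W := hg.2
      have had := ((ha.contDiffAt (hQ.mem_nhds hg)).differentiableAt hne).hasFDerivAt
      let L : ((Fin p → ℝ) →L[ℝ] (Fin 2 → ℝ)) →L[ℝ] ℝ :=
        (ContinuousLinearMap.proj j).comp (ContinuousLinearMap.apply ℝ (Fin 2 → ℝ) τ')
      have h1 := L.hasFDerivAt.comp g had
      have h2 : fderiv ℝ a g (τ, a g τ) τ' j = fderiv ℝ (L ∘ a) g (τ, a g τ) := by
        rw [h1.fderiv]
        rfl
      have h3 : (τ, a g τ) = (mfderiv (𝓡 (p + 2)) 𝓘(ℝ, (Fin p → ℝ) × (Fin 2 → ℝ)) q (r g)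
          (∑ k, τ k • Y k (r g)) : (Fin p → ℝ) × (Fin 2 → ℝ)) := by
        rw [hdqY _ hrg, hqr g hg]
      have h4 := mfderiv_comp_apply (f := L ∘ a) (ρ := q) (x := r g)
        (by rw [hqr g hg]; exact h1.differentiableAt) (hqm _ hrg) (∑ k, τ k • Y k (r g))
      rw [hqr g hg] at h4
      have h5 : dF (p + 2) (fun y => (L ∘ a) (q y)) (r g) =
          dF (p + 2) (fun y => ∑ k, b j k y * τ' k) (r g) := by
        refine dF_congr (Filter.eventuallyEq_of_mem (hW.mem_nhds hrg) fun z hz => ?_)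
        change a (q z) τ' j = _
        rw [haj, hrq z hz]
      refine (h2.trans ((congrArg (fderiv ℝ (L ∘ a) g) h3).trans h4.symm)).trans
        ((congrArg (fun A => A (∑ k, τ k • Y k (r g))) h5).trans ?_)
      rw [SmoothFun.dF_sum hW hrg fun k _ => (hb j k).mul (smoothFun_const W (τ' k)), sum_apply]
      refine Finset.sum_congr rfl fun k _ => ?_
      rw [dF_mul ((hb j k).mdifferentiableAt hW hrg)
        ((smoothFun_const W (τ' k)).mdifferentiableAt hW hrg), dF_const, smul_zero, zero_add,
        map_sum]
      refine Finset.sum_congr rfl fun l _ => ?_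
      rw [map_smul]
      change τ l * (τ' k * act (Y l) (act (Y k) (s j)) (r g)) = _
      ring
    intro g hg τ τ'
    funext j
    rw [key g hg, key g hg, Finset.sum_comm]
    refine Finset.sum_congr rfl fun k _ => Finset.sum_congr rfl fun l _ => ?_
    rw [hc k l _ (hs j) _ hg.2]
    ring
  have hq0 : q x₀ = (0, 0) := by
    change κ (ψ x₀ - ψ x₀) = (0, 0)
    rw [sub_self, map_zero]
    rfl
  obtain ⟨e, he0, hee, heQ, hes, hes', -, hed⟩ := exists_frobenius_straightening hQ ha
    (z₀ := 0) (hq0 ▸ hqQ x₀ hx₀) hint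
  let S : Set M := W ∩ q ⁻¹' e.target
  have hS : IsOpen S := (hqs.continuousOn.mono hWψ).isOpen_inter_preimage hW e.open_target
  have hx₀S : x₀ ∈ S := by
    refine ⟨hx₀, ?_⟩
    rw [Set.mem_preimage, hq0, ← hee]
    exact e.map_source he0
  have hem : ∀ z ∈ S, DifferentiableAt ℝ e.symm (q z) := fun z hz =>
    (hes'.contDiffAt (e.open_target.mem_nhds hz.2)).differentiableAt hne
  have hdρ : ∀ z ∈ S, ∀ v, (mfderiv (𝓡 (p + 2)) 𝓘(ℝ, (Fin p → ℝ) × (Fin 2 → ℝ))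
      (fun y => e.symm (q y)) z v : (Fin p → ℝ) × (Fin 2 → ℝ)) =
      fderiv ℝ e.symm (q z) (mfderiv (𝓡 (p + 2)) 𝓘(ℝ, (Fin p → ℝ) × (Fin 2 → ℝ)) q z v) :=
    fun z hz v => mfderiv_comp_apply (hem z hz) (hqm z hz.1) v
  have hinv : ∀ z ∈ S, ∀ g, fderiv ℝ e.symm (q z) (fderiv ℝ e (e.symm (q z)) g) = g := by
    intro z hz g
    have hsrc := e.map_target hz.2
    have h1 := ((hes.contDiffAt (e.open_source.mem_nhds hsrc)).differentiableAt hne).hasFDerivAt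
    have h2 : HasFDerivAt e.symm (fderiv ℝ e.symm (q z)) (e (e.symm (q z))) := by
      rw [e.right_inv hz.2]
      exact (hem z hz).hasFDerivAt
    have h3 := h2.comp _ h1
    have h4 : HasFDerivAt (e.symm ∘ e) (ContinuousLinearMap.id ℝ _) (e.symm (q z)) :=
      (hasFDerivAt_id _).congr_of_eventuallyEq
        (Filter.eventuallyEq_of_mem (e.open_source.mem_nhds hsrc) fun y hy => e.left_inv hy)
    exact congrArg (fun A => A g) (h3.unique h4)
  refine ⟨S, e.source, fun z => e.symm (q z), r ∘ e, hS, e.open_source, hx₀S, fun z hz => hz.1,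
    fun z hz => e.map_target hz.2, fun z hz => ?_, ?_, fun F hF => ?_, fun z hz k => ?_,
    fun g => ?_⟩
  · rw [Function.comp_apply, e.right_inv hz.2, hrq z hz.1]
  · exact hes'.contMDiffOn.comp (hqs.mono fun z hz => hWψ hz.1) fun z hz => hz.2
  · exact (hFr F hF).comp hes fun g hg => heQ (e.map_source hg)
  · rw [hdρ z hz]
    have h1 := hdqY z hz.1 (Pi.single k 1)
    have h2 : ∑ l, (Pi.single k (1 : ℝ) : Fin p → ℝ) l • Y l z = Y k z := by
      rw [Finset.sum_eq_single k]
      · rw [Pi.single_eq_same, one_smul]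
      · intro l _ hl
        rw [Pi.single_eq_of_ne hl, zero_smul]
      · simp
    rw [h2] at h1
    -- The derivative of e maps the coordinate direction k to the image of Y_k under q, so its
    -- inverse straightens Y_k.
    have h3 := hed (e.symm (q z)) (e.map_target hz.2) (Pi.single k 1)
    rw [e.right_inv hz.2] at h3
    exact (congrArg (fderiv ℝ e.symm (q z)) (h1.trans h3.symm)).trans (hinv z hz _)
  · set G := fderiv ℝ e (e.symm (q x₀)) g with hG
    -- The tangent vector whose coordinates in the chart are prescribed by G.
    let v : TangentSpace (𝓡 (p + 2)) x₀ :=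
      ∑ i, Fin.append G.1 G.2 (π.symm i) • coordVector ψ i x₀
    have hv : ∀ i, dF (p + 2) (fun z => ψ z i) x₀ v = Fin.append G.1 G.2 (π.symm i) := by
      intro i
      rw [map_sum]
      simp only [map_smul, dF_coord_coordVector hψ (hWψ hx₀), smul_eq_mul, mul_ite, mul_one,
        mul_zero, Finset.sum_ite_eq, Finset.mem_univ, if_true]
    have h1 : (mfderiv (𝓡 (p + 2)) 𝓘(ℝ, (Fin p → ℝ) × (Fin 2 → ℝ)) q x₀ v :
        (Fin p → ℝ) × (Fin 2 → ℝ)) = G := by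
      rw [hdq x₀ hx₀]
      refine Prod.ext (funext fun k => ?_) (funext fun j => ?_)
      · refine (hv _).trans ?_
        rw [Equiv.symm_apply_apply, Fin.append_left]
      · refine (hv _).trans ?_
        rw [Equiv.symm_apply_apply, Fin.append_right]
    refine ⟨v, (hdρ x₀ hx₀S v).trans ?_⟩
    exact (congrArg (fderiv ℝ e.symm (q x₀)) h1).trans (hinv x₀ hx₀S g)

end Straightening

/-! ### Normal form of a Nambu structure and its Dirac structures -/

section NormalForm

variable {p : ℕ} {M : Type*} [TopologicalSpace M]
  [ChartedSpace (EuclideanSpace ℝ (Fin (p + 2))) M] [IsManifold (𝓡 (p + 2)) ∞ M]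

/-- Near a point where it does not vanish, a Nambu structure is the product of the first
coordinate vector fields of a chart. -/
theorem IsNambuOn.exists_normal_chart [T2Space M] (hp : 2 ≤ p) {P : MultiField (p + 2) M p}
    (hP : IsNambuOn Set.univ P)
    (hdec : p = 2 → ∀ x : M, ∃ X : Fin p → TangentSpace (𝓡 (p + 2)) x, IsWedgeOf (P x) X)
    {x₀ : M} (h0 : P x₀ ≠ 0) :
    ∃ φ ∈ IsManifold.maximalAtlas (𝓡 (p + 2)) ∞ M, x₀ ∈ φ.source ∧
      ∀ y ∈ φ.source, IsWedgeOf (P y) (fun j : Fin p => coordVector φ (Fin.castAdd 2 j) y) := by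
  have hne : (∞ : WithTop ℕ∞) ≠ 0 := by simp
  have hp0 : 0 < p := by omega
  have hψ := chartAt_mem (n := p + 2) x₀
  have hxs := mem_chart_source (EuclideanSpace ℝ (Fin (p + 2))) x₀
  set ψ := chartAt (EuclideanSpace ℝ (Fin (p + 2))) x₀ with hψd
  obtain ⟨π, hπ⟩ := exists_coord_ne_zero h0 hψ hxs
  let y : Fin p → M → ℝ := fun k z => ψ z (π (Fin.castAdd 2 k))
  let h : M → ℝ := nambuBracket P y
  have hhψ : SmoothFun (p + 2) ψ.source h :=
    hP.1 _ ψ.open_source (Set.subset_univ _) y fun i => smoothFun_coord hψ _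
  let W : Set M := ψ.source ∩ h ⁻¹' {0}ᶜ
  have hW : IsOpen W :=
    ContMDiffOn.continuousOn hhψ |>.isOpen_inter_preimage ψ.open_source isOpen_compl_singleton
  have hWψ : W ⊆ ψ.source := Set.inter_subset_left
  have hx₀ : x₀ ∈ W := ⟨hxs, hπ⟩
  have hhW : ∀ x ∈ W, h x ≠ 0 := fun x hx => hx.2
  have hh : SmoothFun (p + 2) W h := hhψ.mono hWψ
  have hy : ∀ i, SmoothFun (p + 2) W (y i) := fun i => (smoothFun_coord hψ _).mono hWψ
  obtain ⟨Y, hY, hYy, hPY⟩ := hP.exists_local_form hp hdec hW hy hhW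
  obtain ⟨S, O, ρ, r, hS, hO, hxS, hSW, hρO, hrρ, hρ, hr, hρY, hsurj⟩ :=
    exists_straightening hψ hW hWψ hx₀ hY hYy fun i j f hf x hx =>
      (hP.restrict hp0 hW).commute hp0 hW hY hh hhW hPY hy hYy i j hf hx
  let i₀ : Fin p := ⟨0, hp0⟩
  -- In the straightened coordinates Π is h times the product of the first p coordinate fields.
  -- Replacing the coordinate i₀ by a primitive w of 1/h in its direction removes h.
  obtain ⟨w, V, hV, hxV, -, hw, hwV⟩ := exists_directional_primitive
    (k := fun g => (h (r g))⁻¹) (U := O ∩ {g | h (r g) ≠ 0})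
    ((hr h hh).continuousOn.isOpen_inter_preimage hO isOpen_compl_singleton)
    (((hr h hh).mono Set.inter_subset_left).inv fun g hg => hg.2) (x₀ := ρ x₀)
    ⟨hρO hxS, by change h (r (ρ x₀)) ≠ 0; rw [hrρ x₀ hxS]; exact hπ⟩
    (ℓ := (ContinuousLinearMap.proj i₀).comp (ContinuousLinearMap.fst ℝ (Fin p → ℝ) (Fin 2 → ℝ)))
    (v := (Pi.single i₀ 1, 0)) (by simp)
  let S' : Set M := S ∩ ρ ⁻¹' V
  have hS' : IsOpen S' := hρ.continuousOn.isOpen_inter_preimage hS hV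
  let pr₁ : Fin p → (Fin p → ℝ) × (Fin 2 → ℝ) →L[ℝ] ℝ := fun i =>
    (ContinuousLinearMap.proj i).comp (ContinuousLinearMap.fst ℝ _ _)
  let pr₂ : Fin 2 → (Fin p → ℝ) × (Fin 2 → ℝ) →L[ℝ] ℝ := fun j =>
    (ContinuousLinearMap.proj j).comp (ContinuousLinearMap.snd ℝ _ _)
  let F : Fin (p + 2) → (Fin p → ℝ) × (Fin 2 → ℝ) → ℝ :=
    Fin.addCases (fun i => if i = i₀ then w else pr₁ i) fun j => pr₂ j
  have hF₀ : F (Fin.castAdd 2 i₀) = w := by simp [F]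
  have hF₁ : ∀ i, i ≠ i₀ → F (Fin.castAdd 2 i) = pr₁ i := fun i hi => by simp [F, hi]
  have hF₂ : ∀ j, F (Fin.natAdd p j) = pr₂ j := fun j => by simp [F]
  have hF : ∀ i, ContDiff ℝ ∞ (F i) := by
    refine fun i => Fin.addCases (fun i => ?_) (fun j => ?_) i
    · by_cases hi : i = i₀
      · rw [hi, hF₀]
        exact hw
      · rw [hF₁ i hi]
        exact (pr₁ i).contDiff
    · rw [hF₂]
      exact (pr₂ j).contDiff
  have hD₁ : ∀ g i, i ≠ i₀ → fderiv ℝ (F (Fin.castAdd 2 i)) g = pr₁ i := fun g i hi => by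
    rw [hF₁ i hi, ContinuousLinearMap.fderiv]
  have hD₂ : ∀ g j, fderiv ℝ (F (Fin.natAdd p j)) g = pr₂ j := fun g j => by
    rw [hF₂, ContinuousLinearMap.fderiv]
  have hD₀ : ∀ z ∈ S', fderiv ℝ (F (Fin.castAdd 2 i₀)) (ρ z) (Pi.single i₀ 1, 0) = (h z)⁻¹ :=
    fun z hz => by rw [hF₀, hwV _ hz.2, hrρ z hz.1]
  let u : Fin (p + 2) → M → ℝ := fun i z => F i (ρ z)
  have hu : ∀ i, SmoothFun (p + 2) S' (u i) := fun i =>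
    (hF i).contMDiff.comp_contMDiffOn (hρ.mono Set.inter_subset_left)
  have hdu : ∀ z ∈ S', ∀ i v, dF (p + 2) (u i) z v = fderiv ℝ (F i) (ρ z)
      (mfderiv (𝓡 (p + 2)) 𝓘(ℝ, (Fin p → ℝ) × (Fin 2 → ℝ)) ρ z v) := fun z hz i v =>
    mfderiv_comp_apply ((hF i).differentiable hne _)
      ((hρ.contMDiffAt (hS.mem_nhds hz.1)).mdifferentiableAt hne) v
  have hduY : ∀ z ∈ S', ∀ i k, dF (p + 2) (u i) z (Y k z) =
      fderiv ℝ (F i) (ρ z) (Pi.single k 1, 0) := fun z hz i k =>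
    (hdu z hz i _).trans (congrArg (fderiv ℝ (F i) (ρ z)) (hρY z hz.1 k))
  have hxS' : x₀ ∈ S' := ⟨hxS, hxV⟩
  have hind : LinearIndependent ℝ (fun i => dF (p + 2) (u i) x₀) := by
    rw [Fintype.linearIndependent_iff]
    intro c hc
    have hg : ∀ g, ∑ i, c i * fderiv ℝ (F i) (ρ x₀) g = 0 := by
      intro g
      obtain ⟨v, hv⟩ := hsurj g
      have h1 := congrArg (fun A : TangentSpace (𝓡 (p + 2)) x₀ →L[ℝ] ℝ => A v) hc
      rw [sum_apply] at h1
      refine Eq.trans (Finset.sum_congr rfl fun i _ => ?_) h1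
      exact congrArg (c i * ·)
        ((congrArg (fderiv ℝ (F i) (ρ x₀)) hv).symm.trans (hdu x₀ hxS' i v).symm)
    simp only [Fin.sum_univ_add, hD₂] at hg
    have hsplit : ∀ g : (Fin p → ℝ) × (Fin 2 → ℝ),
        ∑ i, c (Fin.castAdd 2 i) * fderiv ℝ (F (Fin.castAdd 2 i)) (ρ x₀) g =
        c (Fin.castAdd 2 i₀) * fderiv ℝ (F (Fin.castAdd 2 i₀)) (ρ x₀) g +
          ∑ i ∈ Finset.univ.erase i₀, c (Fin.castAdd 2 i) * g.1 i := by
      intro g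
      rw [← Finset.add_sum_erase _ _ (Finset.mem_univ i₀)]
      congr 1
      refine Finset.sum_congr rfl fun i hi => ?_
      rw [hD₁ _ i (Finset.ne_of_mem_erase hi)]
      rfl
    -- In direction i₀ every new coordinate except w has zero derivative, while w has derivative 1/h
    -- ≠ 0; the other coefficients are then read off in the remaining coordinate directions.
    have hc₀ : c (Fin.castAdd 2 i₀) = 0 := by
      have h1 := hg (Pi.single i₀ 1, 0)
      rw [hsplit, hD₀ x₀ hxS', Finset.sum_eq_zero, Finset.sum_eq_zero] at h1
      · simpa [hhW x₀ hx₀] using h1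
      · intro j _
        exact mul_zero _
      · intro i hi
        change _ * (Pi.single i₀ 1 : Fin p → ℝ) i = 0
        rw [Pi.single_eq_of_ne (Finset.ne_of_mem_erase hi), mul_zero]
    simp only [hsplit, hc₀, zero_mul, zero_add] at hg
    refine fun i => Fin.addCases (fun i => ?_) (fun j => ?_) i
    · by_cases hi : i = i₀
      · rw [hi, hc₀]
      · have h1 := hg (Pi.single i 1, 0)
        simpa [pr₂, Pi.single_apply, hi] using h1
    · have h1 := hg (0, Pi.single j 1)
      simpa [pr₂, Pi.single_apply] using h1
  obtain ⟨φ, hφ, hxφ, hφS, hφu⟩ := exists_chart_of_linearIndependent hS' hu hxS' hind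
  refine ⟨φ, hφ, hxφ, fun z hz => ?_⟩
  have hzS := hφS hz
  have hdφ : ∀ i, dF (p + 2) (fun z => φ z i) z = dF (p + 2) (u i) z := fun i =>
    dF_congr (Filter.eventuallyEq_of_mem (φ.open_source.mem_nhds hz) fun x hx => hφu x hx i)
  refine isWedgeOf_coordVector hφ hz (hPY z (hSW hzS.1)) (fun k j => ?_) ?_
  · rw [hdφ, hduY z hzS, hD₂]
    rfl
  -- Only row i₀ differs from the identity matrix, so the determinant is the diagonal entry 1/h
  -- whatever the other derivatives of w are.
  · have hmat : (Matrix.of fun i j => dF (p + 2) (fun z => φ z (Fin.castAdd 2 i)) z (Y j z)) =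
        (1 : Matrix (Fin p) (Fin p) ℝ).updateRow i₀
          (fun j => dF (p + 2) (u (Fin.castAdd 2 i₀)) z (Y j z)) := by
      ext i j
      rw [Matrix.of_apply, hdφ]
      by_cases hi : i = i₀
      · rw [hi, Matrix.updateRow_self]
      · rw [Matrix.updateRow_ne hi, hduY z hzS, hD₁ _ i hi, Matrix.one_apply]
        change (Pi.single j 1 : Fin p → ℝ) i = _
        rw [Pi.single_apply]
    rw [hmat, det_updateRow_one, hduY z hzS, hD₀ z hzS]
    exact mul_inv_cancel₀ (hhW z (hSW hzS.1))

/-- The coordinate vectors are a basis dual to the coordinate differentials with volume 1, so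
`contract_frame` leaves the product of the last two differentials, with no sign. -/
lemma contract_coordVolume {φ : OpenPartialHomeomorph M (EuclideanSpace ℝ (Fin (p + 2)))}
    (hφ : φ ∈ IsManifold.maximalAtlas (𝓡 (p + 2)) ∞ M) {y : M} (hy : y ∈ φ.source)
    {P : (TangentSpace (𝓡 (p + 2)) y →L[ℝ] ℝ) [⋀^Fin p]→ₗ[ℝ] ℝ}
    (hP : IsWedgeOf P (fun j : Fin p => coordVector φ (Fin.castAdd 2 j) y)) (r : ℝ) :
    contract P (r • coordVolume φ y) = r • wedge
      ![dF (p + 2) (fun z => φ z (Fin.natAdd p 0)) y,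
        dF (p + 2) (fun z => φ z (Fin.natAdd p 1)) y] := by
  obtain ⟨c, hc, hc2⟩ := exists_basis_of_dual (finrank_tangentSpace y)
    (fun i => dF (p + 2) (fun z => φ z i) y) (fun j => coordVector φ j y)
    (fun i j => dF_coord_coordVector hφ hy i j)
  have h1 : coordVolume φ y c = 1 := by
    rw [funext hc, coordVolume, wedge_apply]
    have : (Matrix.of fun i j => dF (p + 2) (fun z => φ z j) y (coordVector φ i y)) = 1 := by
      ext i j
      rw [Matrix.of_apply, dF_coord_coordVector hφ hy, Matrix.one_apply]
      simp [eq_comm]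
    rw [this, Matrix.det_one]
  have h2 : coordVolume φ y ≠ 0 := by
    intro h
    rw [h] at h1
    exact zero_ne_one h1
  have h3 := contract_frame c h2
  rw [h1, inv_one, one_smul, hc2, hc2] at h3
  simp only [hc] at h3
  rw [contract_smul_right, hP.eq, h3]

/-- The Dirac structures attached to a Nambu structure in normal form. -/
lemma isDiracOn_contract {φ : OpenPartialHomeomorph M (EuclideanSpace ℝ (Fin (p + 2)))}
    (hφ : φ ∈ IsManifold.maximalAtlas (𝓡 (p + 2)) ∞ M) {P : MultiField (p + 2) M p}
    (hP : ∀ y ∈ φ.source, IsWedgeOf (P y) (fun j : Fin p => coordVector φ (Fin.castAdd 2 j) y))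
    {f : M → ℝ} (hf : SmoothFun (p + 2) φ.source f) (h0 : ∀ y ∈ φ.source, f y ≠ 0) :
    IsDiracOn φ.source (graphFamily (fun y => contract (P y) (f y • coordVolume φ y))
      (dLogAbs (p + 2) f)) :=
  isDiracOn_smul_wedge_dF φ.open_source hf h0 (smoothFun_coord hφ _) (smoothFun_coord hφ _)
    fun y hy => contract_coordVolume hφ hy (hP y hy) (f y)

end NormalForm

end

end NambuDirac

/-! ### The theorem, with n = p + 2 -/

theorem mainTheorem9 {p : ℕ} (hp : 2 ≤ p) {M : Type*} [TopologicalSpace M]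
    [ChartedSpace (EuclideanSpace ℝ (Fin (p + 2))) M] [IsManifold (𝓡 (p + 2)) ∞ M]
    [T2Space M] [SecondCountableTopology M] :
    (∀ P : NambuDirac.MultiField (p + 2) M p, NambuDirac.IsNambuOn Set.univ P →
      (p = 2 → ∀ x : M, ∃ X : Fin p → TangentSpace (𝓡 (p + 2)) x,
        NambuDirac.IsWedgeOf (P x) X) →
      ∀ x₀ : M, P x₀ ≠ 0 →
        ∃ φ ∈ IsManifold.maximalAtlas (𝓡 (p + 2)) ∞ M, x₀ ∈ φ.source ∧
          (∀ y ∈ φ.source, NambuDirac.IsWedgeOf (P y)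
            (fun j : Fin p => NambuDirac.coordVector φ (Fin.castAdd 2 j) y)) ∧
          ∀ f : M → ℝ, NambuDirac.SmoothFun (p + 2) φ.source f →
            (∀ y ∈ φ.source, f y ≠ 0) →
            NambuDirac.IsDiracOn φ.source
              (NambuDirac.graphFamily
                (fun y => NambuDirac.contract (P y) (f y • NambuDirac.coordVolume φ y))
                (NambuDirac.dLogAbs (p + 2) f))) ∧
    (∀ (f : M → ℝ) (θ₁ θ₂ : NambuDirac.CovField (p + 2) M)
      (β : NambuDirac.FormField (p + 2) M 2),
      NambuDirac.SmoothFun (p + 2) Set.univ f → (∀ x, f x ≠ 0) →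
      NambuDirac.SmoothCovField Set.univ θ₁ → NambuDirac.SmoothCovField Set.univ θ₂ →
      (∀ x, LinearIndependent ℝ ![θ₁ x, θ₂ x]) →
      (∀ x, β x = NambuDirac.wedge ![θ₁ x, θ₂ x]) →
      NambuDirac.IsDiracOn Set.univ
        (NambuDirac.graphFamily β (NambuDirac.dLogAbs (p + 2) f)) →
      (∀ g : M → ℝ, NambuDirac.SmoothFun (p + 2) Set.univ g → (∀ x, g x ≠ 0) →
        NambuDirac.IsDiracOn Set.univ
          (NambuDirac.graphFamily (fun x => g x • β x)
            (NambuDirac.dLogAbs (p + 2) (fun x => f x * g x)))) ∧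
      ∀ (U : Set M) (Ω : NambuDirac.FormField (p + 2) M (p + 2)), IsOpen U →
        NambuDirac.SmoothForm U Ω → (∀ x ∈ U, Ω x ≠ 0) →
        ∃ P : NambuDirac.MultiField (p + 2) M p,
          NambuDirac.IsNambuOn U P ∧
          (∀ x ∈ U, NambuDirac.contract (P x) (Ω x) = β x) ∧
          ∀ P' : NambuDirac.MultiField (p + 2) M p,
            (∀ x ∈ U, NambuDirac.contract (P' x) (Ω x) = β x) → ∀ x ∈ U, P' x = P x) := by
  refine ⟨fun P hP hdec x₀ h0 => ?_, fun f θ₁ θ₂ β hf hf0 hθ₁ hθ₂ hind hβ hD => ⟨fun g hg hg0 => ?_,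
    fun U Ω hU hΩ hΩ0 => ?_⟩⟩
  · obtain ⟨φ, hφ, hx₀, hφP⟩ := hP.exists_normal_chart hp hdec h0
    exact ⟨φ, hφ, hx₀, hφP, fun f hf hf0 => NambuDirac.isDiracOn_contract hφ hφP hf hf0⟩
  · exact NambuDirac.isDiracOn_smul isOpen_univ hf hg (fun x _ => hf0 x) (fun x _ => hg0 x)
      ((NambuDirac.smoothForm_wedge_pair hθ₁ hθ₂).congr fun x _ => hβ x) hD.2.2
  · exact NambuDirac.exists_unique_nambu hp
      (NambuDirac.smoothCovField_dF (hf.logAbs fun x _ => hf0 x)) hθ₁ hθ₂ hind hβ hD.2.2 hU hΩ hΩ0
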